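/- **Lemma 2.4 (periodic Krichever–Phong formula).** Let $l>0$, let the phase space be the real vector space of smooth $2l$-periodic functions $\psi:\mathbb R\to\mathbb C$, and put $\langle f\rangle=\frac1{2l}\int_{-l}^{l}f\,dx$, $$V=V_2=-\tfrac{i\lambda}{2}\sigma_3+Y_0,\quad Y_0=\begin{pmatrix}0&\bar\psi\\ \psi&0\end{pmatrix},\quad \sigma_3=\begin{pmatrix}1&0\\0&-1\end{pmatrix},\quad J=\begin{pmatrix}0&1\\-1&0\end{pmatrix}.$$ Let $M'=VM$, $M|_{x=-l}=I$, and $\Gamma=\{(\lambda,w):\det(M(l)-wI)=0\}$. Over $\lambda\notin\mathbb R$ there are exactly two points of $\Gamma$, one on the sheet of $P_+$ and one on the sheet of $P_-$, where $w\sim e^{\pm i\lambda l}$ at $P_\pm$ (on the sheet of $P_\pm$, $|w|<1$ if $\pm\operatorname{Im}\lambda>0$ and $|w|>1$ if $\pm\operatorname{Im}\lambda<0$); the involution $\epsilon(\lambda,w)=(\lambda,1/w)$ exchanges them. At such a point $Q$ let $e(x,Q)$ be the Floquet (Baker–Akhiezer) solution, $e'=Ve$, $e(x+2l)=we(x)$,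 $e^1(-l)+e^2(-l)=1$; let $e^+(x,Q)=e(x,\epsilon Q)^T$, $\Phi=\langle e^+Je\rangle$ and $e^*=e^+/\Phi$. Variations $\delta$ are directional derivatives in $\psi$ at fixed $\lambda$ and fixed sheet, and $(\alpha\wedge\beta)(X,Y)=\alpha(X)\beta(Y)-\alpha(Y)\beta(X)$. The residue at $P_\pm$ of $f\,d\lambda$ means the coefficient of $\lambda^{-1}$ in the expansion of $f$ at infinity: the number $c$ with $f(\lambda)=\text{polynomial}+c/\lambda+o(1/\lambda)$ as $\lambda\to\infty$ in every double sector $|\operatorname{Im}\lambda|\ge\varepsilon|\lambda|$, $\varepsilon>0$. For $n=0,1$ put $$\omega_n=\sum_{P_\pm}\operatorname{res}\ \lambda^n\langle e^*J\,\delta V\wedge\delta e\rangle\,d\lambda .$$ Then the following hold for all smooth $2l$-periodic potentials, in particular for finite-gap potentials. 1. For $\lambda\notin\mathbb R$, $e$ exists and is unique, $e^+Je$ does not depend on $x$, $\Phi\ne0$, and $\delta e$ exists and is continuous in $x$. For $n=0,1$ the residues at $P_+$ and at $P_-$ exist and are unique. Whenever $\lambda^n\langle e^*J\delta V\wedge\delta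 e\rangle$ extends from the nonreal $\lambda$ on the sheet of $P_\pm$ to a function that is holomorphic for $|\lambda|>R$ and grows at most polynomially, the residue at $P_\pm$ equals $\frac1{2\pi i}\oint_{|\lambda|=r}\lambda^n\langle e^*J\delta V\wedge\delta e\rangle\,d\lambda$ for every $r>0$ with $r>R$. 2. $\omega_0$ is a closed, nondegenerate 2-form on the phase space, and $\omega_0=2i\langle\delta\bar\psi\wedge\delta\psi\rangle$. 3. Let $r_1=-i\bar\psi$, $r_{s+1}=i\bigl(r_s'+\psi\sum_{j=1}^{s-1}r_jr_{s-j}\bigr)$ and $H_m=(-1)^{m-1}\frac i2\int_{-l}^{l}\psi\, r_m\,dx$ for $m\ge1$. The $H_m$ are real; $H_1=\frac12\int_{-l}^l|\psi|^2dx$, $H_2=\frac1{2i}\int_{-l}^l\psi\bar\psi'dx$, $H_3=\frac12\int_{-l}^l(|\psi'|^2+|\psi|^4)dx$; and they are the coefficients of the quasimomentum at infinity: for every $N\ge0$ and $\varepsilon>0$, on the sheet of $P_\pm$, $$w=\exp\Bigl(\pm2il\Bigl(\tfrac\lambda2-\sum_{k=1}^{N}\tfrac{(-1)^{k-1}H_k}{l}\lambda^{-k}\Bigr)\Bigr)\bigl(1+o(\lambda^{-N})\bigr),\qquad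 \lambda\to\infty,\ |\operatorname{Im}\lambda|\ge\varepsilon|\lambda| .$$ 4. Let $S=\sum_{k\ge0}S_k\lambda^{-k}$, $S_0=-\frac i2\sigma_3$, be the formal solution of $S'=[V,S]$, $S^2=-\frac14I$, and let $V_m=(-1)^m\sum_{k=0}^{m-1}\lambda^{m-1-k}S_k$, $m\ge1$ (so $V_1=\frac i2\sigma_3$, $V_2=V$, $V_3=\frac{i\lambda^2}2\sigma_3-\lambda Y_0+i|\psi|^2\sigma_3-i\sigma_3Y_0'$). For every $m\ge1$ the equation $[\partial_{\tau_m}-V_m,\partial_x-V_2]=0$ determines a unique vector field $X_m$ on the phase space (the velocity $\partial_{\tau_m}\psi$ of the $m$-th flow of the NLS hierarchy), and it is Hamiltonian with respect to $\omega_0$ with Hamiltonian $H_m$ up to a constant factor: $\omega_0(X_m,\cdot)=-\frac2l\,\delta H_m$. 5. On the level sets of $H_1$, that is, on variations with $\delta H_1=0$, $$\omega_1=\bigl\langle\delta\psi\wedge\delta\bar\psi'+\delta\bar\psi\wedge\delta\psi'+2\,\delta\partial^{-1}|\psi|^2\wedge\delta|\psi|^2\bigr\rangle,\qquad \partial^{-1}f(x)=\int_{-l}^xf\,ds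 .$$ -/

import Mathlib

open Complex Filter Asymptotics
open scoped ComplexConjugate ContDiff Matrix Topology

noncomputable section

namespace KrichPhong

/-! ## Phase space and auxiliary linear problem -/

/-- The phase space: smooth complex functions of period `2l`, as a real vector space
(a variation `δψ = X` has `δψ̄ = conj X`, so forms on it are real-multilinear). -/
def Phase (l : ℝ) : Submodule ℝ (ℝ → ℂ) where
  carrier := {f | ContDiff ℝ ∞ f ∧ Function.Periodic f (2 * l)}
  add_mem' := fun ha hb => ⟨ha.1.add hb.1, ha.2.add hb.2⟩
  zero_mem' := ⟨contDiff_const, fun _ => rfl⟩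
  smul_mem' := fun c f hf => ⟨contDiff_const.smul hf.1, fun x => by
    have := hf.2 x
    simp [this]⟩

/-- The mean value `⟨f⟩ = (1/2l) ∫_{-l}^{l} f dx`. -/
def avg (l : ℝ) (f : ℝ → ℂ) : ℂ := ((2 * l : ℝ) : ℂ)⁻¹ * ∫ x in (-l)..l, f x

/-- The Pauli matrix `σ₃`. -/
def sigma3 : Matrix (Fin 2) (Fin 2) ℂ := !![1, 0; 0, -1]

/-- `J = iσ₂`. -/
def matJ : Matrix (Fin 2) (Fin 2) ℂ := !![0, 1; -1, 0]

/-- The off-diagonal matrix `Y₀` of a potential. It is real-linear in `u`, so it is also the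
variation `δV` of the matrix `V` in the direction `δψ = u`. -/
def matY (u : ℝ → ℂ) (x : ℝ) : Matrix (Fin 2) (Fin 2) ℂ := !![0, conj (u x); u x, 0]

/-- `V(x, lam) = -(i lam / 2) σ₃ + Y₀`. -/
def matV (ψ : ℝ → ℂ) (lam : ℂ) (x : ℝ) : Matrix (Fin 2) (Fin 2) ℂ :=
  (-(I * lam / 2)) • sigma3 + matY ψ x

/-- `M = M(·, y, lam)` is the transition matrix: `M' = V M`, `M(y, y, lam) = 1`. -/
def IsTransitionMatrix (ψ : ℝ → ℂ) (lam : ℂ) (y : ℝ) (M : ℝ → Matrix (Fin 2) (Fin 2) ℂ) : Prop :=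
  M y = 1 ∧ ∀ x i j, HasDerivAt (fun s => M s i j) ((matV ψ lam x * M x) i j) x

/-- The curve `Γ = {(lam, w) : det (M(l, -l, lam) - w) = 0}` of Floquet multipliers. -/
def spectralCurve (l : ℝ) (ψ : ℝ → ℂ) : Set (ℂ × ℂ) :=
  {Q | ∃ M, IsTransitionMatrix ψ Q.1 (-l) M ∧ (M l - Q.2 • (1 : Matrix (Fin 2) (Fin 2) ℂ)).det = 0}

/-- The involution `(lam, w) ↦ (lam, 1/w)` that exchanges the two sheets. -/
def sheetSwap (Q : ℂ × ℂ) : ℂ × ℂ := (Q.1, Q.2⁻¹)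

/-- `(lam, w)` is a point of `Γ` over a nonreal `lam`, on the sheet of `P₊` (`σ = 1`) or of
`P₋` (`σ = -1`). Near `P_σ` one has `w ~ exp (σ i lam l)`; since `|w| = 1` forces `lam` to be
real, this sheet is, over each open half-plane, the one where `|w| < 1` if `σ Im lam > 0`, and
where `|w| > 1` if `σ Im lam < 0`. -/
def OnSheet (l : ℝ) (ψ : ℝ → ℂ) (σ : ℤˣ) (lam w : ℂ) : Prop :=
  (lam, w) ∈ spectralCurve l ψ ∧ ((σ : ℤ) : ℝ) * lam.im * Real.log ‖w‖ < 0

/-- The Floquet multiplier `w` over a nonreal `lam` on the sheet of `P_σ`. -/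
def multiplier (l : ℝ) (ψ : ℝ → ℂ) (σ : ℤˣ) (lam : ℂ) : ℂ :=
  Classical.epsilon (OnSheet l ψ σ lam)

/-- The point of `Γ` over a nonreal `lam` on the sheet of `P_σ`. -/
def curvePoint (l : ℝ) (ψ : ℝ → ℂ) (σ : ℤˣ) (lam : ℂ) : ℂ × ℂ := (lam, multiplier l ψ σ lam)

/-- `e` is the normalized Floquet solution at `Q = (lam, w)`: `e' = V e`,
`e(x + 2l) = w e(x)` and `e¹(-l) + e²(-l) = 1`. -/
structure IsFloquet (l : ℝ) (ψ : ℝ → ℂ) (Q : ℂ × ℂ) (e : ℝ → Fin 2 → ℂ) : Prop where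
  ode : ∀ x, HasDerivAt e (matV ψ Q.1 x *ᵥ e x) x
  mult : ∀ x, e (x + 2 * l) = Q.2 • e x
  norm : e (-l) 0 + e (-l) 1 = 1

/-- The Floquet (Baker–Akhiezer) solution `e(x, Q)`. -/
def floquet (l : ℝ) (ψ : ℝ → ℂ) (Q : ℂ × ℂ) : ℝ → Fin 2 → ℂ :=
  Classical.epsilon (IsFloquet l ψ Q)

/-- The dual solution `e⁺(x, Q) = e(x, ε Q)ᵀ`, with `ε` the exchange of sheets. -/
def floquetPlus (l : ℝ) (ψ : ℝ → ℂ) (Q : ℂ × ℂ) : ℝ → Fin 2 → ℂ :=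
  floquet l ψ (sheetSwap Q)

/-- `Φ(Q) = ⟨e⁺ J e⟩`. -/
def wronskian (l : ℝ) (ψ : ℝ → ℂ) (Q : ℂ × ℂ) : ℂ :=
  avg l fun x => floquetPlus l ψ Q x ⬝ᵥ (matJ *ᵥ floquet l ψ Q x)

/-- The dual solution `e* = e⁺ / Φ`. -/
def floquetStar (l : ℝ) (ψ : ℝ → ℂ) (Q : ℂ × ℂ) (x : ℝ) : Fin 2 → ℂ :=
  (wronskian l ψ Q)⁻¹ • floquetPlus l ψ Q x

/-! ## The two-forms -/

/-- The Floquet solution at `(lam, σ)` for the potential `ψ + t X`. -/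
def floquetLine (l : ℝ) (ψ X : ℝ → ℂ) (σ : ℤˣ) (lam : ℂ) (x t : ℝ) : Fin 2 → ℂ :=
  floquet l (ψ + t • X) (curvePoint l (ψ + t • X) σ lam) x

/-- The variation `δe(x, Q)` in the direction `δψ = X`, for a fixed value of `lam`. -/
def floquetVar (l : ℝ) (ψ X : ℝ → ℂ) (σ : ℤˣ) (lam : ℂ) (x : ℝ) : Fin 2 → ℂ :=
  deriv (floquetLine l ψ X σ lam x) 0

/-- The value on `(X, Y)` of `⟨e* J δV ∧ δe⟩` at the point of the sheet of `P_σ` over `lam`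
(with `(α ∧ β)(X, Y) = α(X) β(Y) - α(Y) β(X)`). -/
def xi (l : ℝ) (ψ X Y : ℝ → ℂ) (σ : ℤˣ) (lam : ℂ) : ℂ :=
  avg l fun x => floquetStar l ψ (curvePoint l ψ σ lam) x ⬝ᵥ
    (matJ *ᵥ (matY X x *ᵥ floquetVar l ψ Y σ lam x - matY Y x *ᵥ floquetVar l ψ X σ lam x))

/-- `lam → ∞` inside the double sector `|Im lam| ≥ ε |lam|`. -/
def sector (ε : ℝ) : Filter ℂ := Bornology.cobounded ℂ ⊓ 𝓟 {lam | ε * ‖lam‖ ≤ |lam.im|}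

/-- `c` is the residue of `f(lam) d lam` at infinity, in the sense of the coefficient of `1 / lam`:
`f(lam) = (polynomial) + c / lam + o(1 / lam)` as `lam → ∞` nontangentially to the real axis.
If `f` is meromorphic at infinity, `c` is the coefficient of `1 / lam` of its Laurent series. -/
def HasResidue (f : ℂ → ℂ) (c : ℂ) : Prop :=
  ∃ P : Polynomial ℂ, ∀ ε : ℝ, 0 < ε →
    (fun lam => f lam - P.eval lam - c / lam) =o[sector ε] fun lam => lam⁻¹

/-- The residue at infinity (the coefficient of `1 / lam`). -/
def residue (f : ℂ → ℂ) : ℂ := Classical.epsilon (HasResidue f)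

/-- `ω_n = ∑_{P±} res lamⁿ ⟨e* J δV ∧ δe⟩ d lam`. -/
def omega (l : ℝ) (n : ℕ) (ψ X Y : Phase l) : ℂ :=
  ∑ σ : ℤˣ, residue fun lam => lam ^ n * xi l ψ X Y σ lam

/-- The `C^k` norm of a smooth periodic function; these norms define its Fréchet topology. -/
def ckNorm (k : ℕ) (X : ℝ → ℂ) : ℝ :=
  ∑ j ∈ Finset.range (k + 1), ⨆ x : ℝ, ‖iteratedDeriv j X x‖

/-- A closed two-form on the phase space. Its exterior derivative is computed on constant vector
fields: `dω(X, Y, Z) = D_X ω(Y, Z) + D_Y ω(Z, X) + D_Z ω(X, Y)`. -/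
structure IsClosedTwoForm (l : ℝ) (Ω : Phase l → Phase l → Phase l → ℂ) : Prop where
  bilinear : ∀ ψ, ∃ B : Phase l →ₗ[ℝ] Phase l →ₗ[ℝ] ℂ, ∀ X Y, Ω ψ X Y = B X Y
  alternating : ∀ ψ X, Ω ψ X X = 0
  continuous : ∀ ψ, ∃ (k : ℕ) (C : ℝ), ∀ X Y : Phase l,
    ‖Ω ψ X Y‖ ≤ C * ckNorm k X * ckNorm k Y
  smooth : ∀ (ψ Y Z : Phase l) (d : ℕ) (X : Fin d → Phase l),
    ContDiff ℝ ∞ fun s : Fin d → ℝ => Ω (ψ + ∑ i, s i • X i) Y Z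
  closed : ∀ ψ X Y Z : Phase l,
    deriv (fun t : ℝ => Ω (ψ + t • X) Y Z) 0 + deriv (fun t : ℝ => Ω (ψ + t • Y) Z X) 0
      + deriv (fun t : ℝ => Ω (ψ + t • Z) X Y) 0 = 0

/-! ## The NLS hierarchy -/

/-- The coefficients of the formal series `S = ∑ S_k lam^{-k}`, `S_0 = -(i/2) σ₃`, that solves
`S' = [V, S]` and `S² = -1/4`, that is, of
`S_k' = [Y₀, S_k] - (i/2) [σ₃, S_{k+1}]` (which gives the off-diagonal part of `S_{k+1}`) and
`∑_{j=0}^{k+1} S_j S_{k+1-j} = 0` (which gives the diagonal part). -/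
def seriesS (ψ : ℝ → ℂ) : ℕ → ℝ → Matrix (Fin 2) (Fin 2) ℂ
  | 0 => fun _ => (-(I / 2)) • sigma3
  | k + 1 => fun x => (I • sigma3) *
      (Matrix.of (fun i j => deriv (fun y => seriesS ψ k y i j) x)
        - (matY ψ x * seriesS ψ k x - seriesS ψ k x * matY ψ x)
        - ∑ j : Fin k, seriesS ψ (j + 1) x * seriesS ψ (k - j) x)
  termination_by k => k

/-- The matrices of the hierarchy, `V_m = (-1)^m` times the polynomial part of `lam^{m-1} S`.
The first three are `V_1 = (i/2) σ₃`, `V_2 = V` and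
`V_3 = (i lam²/2) σ₃ - lam Y₀ + i |ψ|² σ₃ - i σ₃ Y₀'`. -/
def laxV (ψ : ℝ → ℂ) (m : ℕ) (lam : ℂ) (x : ℝ) : Matrix (Fin 2) (Fin 2) ℂ :=
  ((-1 : ℂ) ^ m) • ∑ k ∈ Finset.range m, lam ^ (m - 1 - k) • seriesS ψ k x

/-- `X` is the velocity at `ψ` of the flow `[∂_τ - V_m, ∂_x - V_2] = 0`: the equation
`∂_τ V_2 = ∂_x V_m + [V_m, V_2]` holds with `∂_τ ψ = X`, for all `lam` and `x`. -/
def IsFlowVelocity (ψ : ℝ → ℂ) (m : ℕ) (X : ℝ → ℂ) : Prop :=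
  ∀ (lam : ℂ) (x : ℝ), matY X x =
    Matrix.of (fun i j => deriv (fun y => laxV ψ m lam y i j) x)
      + (laxV ψ m lam x * matV ψ lam x - matV ψ lam x * laxV ψ m lam x)

/-- The coefficients of the formal solution `r = ∑_{k ≥ 1} r_k lam^{-k}` of the Riccati equation
`r' = -i lam r + ψ̄ - ψ r²`, satisfied by the ratio `r = e¹ / e²`. -/
def riccatiCoeff (ψ : ℝ → ℂ) : ℕ → ℝ → ℂ
  | 0 => fun _ => 0
  | 1 => fun x => -I * conj (ψ x)
  | s + 2 => fun x => I * (deriv (riccatiCoeff ψ (s + 1)) x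
      + ψ x * ∑ j : Fin (s + 2), riccatiCoeff ψ j x * riccatiCoeff ψ (s + 1 - j) x)
  termination_by k => k

/-- The Hamiltonians `H_m`, `m ≥ 1`: the conserved integrals generated by the quasimomentum `p`,
normalized so that `H_1 = ½∫|ψ|²`, `H_2 = (1/2i)∫ψψ̄'`, `H_3 = ½∫(|ψ'|² + |ψ|⁴)`. -/
def hamiltonian (l : ℝ) (m : ℕ) (ψ : ℝ → ℂ) : ℂ :=
  (-1) ^ (m - 1) * (I / 2) * ∫ x in (-l)..l, ψ x * riccatiCoeff ψ m x

/-- The partial sum `lam/2 - ∑_{k=1}^{N} p_k lam^{-k}` of the quasimomentum at infinity, with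
`p_k = (-1)^{k-1} H_k / l`. -/
def quasimomentumSum (l : ℝ) (ψ : ℝ → ℂ) (N : ℕ) (lam : ℂ) : ℂ :=
  lam / 2 - ∑ k ∈ Finset.Icc 1 N, (-1) ^ (k - 1) * hamiltonian l k ψ / (l : ℂ) * (lam ^ k)⁻¹

/-- The variation `δ|ψ|²` in the direction `δψ = X`. -/
def densityVar (ψ X : ℝ → ℂ) (x : ℝ) : ℂ := conj (ψ x) * X x + ψ x * conj (X x)

end KrichPhong

end

/-!
The proof rests on the Riccati equation for the ratio `r = e¹ / e²` of the components of the
Floquet solution. For nonreal `lam` the energy identity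
`(|e¹|² - |e²|²)' = Im lam (|e¹|² + |e²|²)` shows that no multiplier lies on the unit circle and
that `|e¹| < |e²|` on the sheet of `P₊` and `|e¹| > |e²|` on the sheet of `P₋`
(`IsFloquetSol.sign`, `OnSheet.sign`). Hence `r` is a smooth periodic function with `|r| < 1`, the
normalization is possible, and the Wronskian `e⁺ J e`, proportional to `1 - q r` with
`q = e² / e¹` taken on the other sheet, does not vanish. The mirror symmetry
`e ↦ (conj e², conj e¹)`, `lam ↦ conj lam`, exchanges the sheets, so that everything is computed
on the sheet of `P₊` only.

The Floquet solution is recovered from `r`, with `log w = i lam l + ∫ ψ r` (`multiplier_eq_exp`).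
Its variation reduces to that of `r`, which is the periodic solution of a linear equation
(`ratio_sub_ratio`, `hasDerivAt_ratio_line`). The maximum principle for periodic solutions of
`f' = -(i lam + a) f + g` in a double sector (`isBigO_of_periodic_ode`) turns the formal solution
of the Riccati equation into an asymptotic expansion, uniformly in `x` (`ratio_expansion`). This
gives the expansion of the quasimomentum and, with the first terms of `δr` and `δ log e²`, the
expansion of `⟨e* J δV ∧ δe⟩` to order `lam⁻²`, that is, `ω₀` and `ω₁` (`xi_one_expansion`,
`omega_zero_eq`, `omega_one_eq`). The form `ω₀` does not depend on the potential, so it is closed.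

The hierarchy is treated by formal power series in `1 / lam`. From the formal ratios `r` and
`q = conj r` the matrix with entries `∓(i/2)(1 + q r)/(1 - q r)` on the diagonal and
`i r/(1 - q r)`, `-i q/(1 - q r)` off the diagonal solves the Lax equation, and the recursion for
`S` has only one solution (`isLaxSeries_laxCoeff`, `IsLaxSeries.eq_seriesS`). The zero curvature
equation telescopes and gives the velocity of the flow as an entry of `S_m`
(`isFlowVelocity_iff`). For the variation of the Hamiltonians, let `r` belong to `ψ + t Y` and `q`
to `ψ`; then `(log (1 - q r))' = -((ψ + t Y) r + conj ψ q) + t (Y r - conj Y q)/(1 - q r)`, and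
the coefficients of the left side integrate to zero over a period (`coeff_logDeriv`,
`integral_riccatiCoeff_line`). At `t = 0` this says that the Hamiltonians are real, and to first
order in `t` it expresses their derivatives by the off-diagonal entries of `S_m`, which is the
Hamiltonian property of the flows.
-/

open Complex Filter Asymptotics
open scoped ComplexConjugate ContDiff Matrix Topology

noncomputable section

namespace KrichPhong

/-! ### Linear differential equations -/

section LinearODE

variable {E : Type*} [NormedAddCommGroup E] [NormedSpace ℝ E]

/-- The terms of the Picard (Peano–Baker) series of `Φ' = A Φ`, `Φ(y) = x₀`. -/
def picardTerm (A : ℝ → E →L[ℝ] E) (y : ℝ) (x₀ : E) : ℕ → ℝ → E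
  | 0 => fun _ => x₀
  | n + 1 => fun t => ∫ s in y..t, A s (picardTerm A y x₀ n s)

lemma continuous_picardTerm {A : ℝ → E →L[ℝ] E} (hA : Continuous A) (y : ℝ) (x₀ : E) (n : ℕ) :
    Continuous (picardTerm A y x₀ n) := by
  induction n with
  | zero => exact continuous_const
  | succ n ih =>
    exact intervalIntegral.continuous_primitive
      (fun a b => (hA.clm_apply ih).intervalIntegrable a b) y

lemma hasDerivAt_picardTerm_succ [CompleteSpace E] {A : ℝ → E →L[ℝ] E} (hA : Continuous A)
    (y : ℝ) (x₀ : E) (n : ℕ) (t : ℝ) :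
    HasDerivAt (picardTerm A y x₀ (n + 1)) (A t (picardTerm A y x₀ n t)) t := by
  have hc := hA.clm_apply (continuous_picardTerm hA y x₀ n)
  exact intervalIntegral.integral_hasDerivAt_right (hc.intervalIntegrable _ _)
    (hc.stronglyMeasurableAtFilter _ _) hc.continuousAt

lemma norm_picardTerm_le {A : ℝ → E →L[ℝ] E} {K : ℝ} (hK : ∀ t, ‖A t‖ ≤ K)
    (y : ℝ) (x₀ : E) (n : ℕ) (t : ℝ) :
    ‖picardTerm A y x₀ n t‖ ≤ K ^ n * |t - y| ^ n / n.factorial * ‖x₀‖ := by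
  have hK0 : 0 ≤ K := (norm_nonneg _).trans (hK 0)
  induction n generalizing t with
  | zero => simp [picardTerm]
  | succ n ih =>
    have hb : ∀ s, ‖A s (picardTerm A y x₀ n s)‖ ≤
        K ^ (n + 1) / n.factorial * ‖x₀‖ * |s - y| ^ n := fun s => by
      calc _ ≤ ‖A s‖ * ‖picardTerm A y x₀ n s‖ := (A s).le_opNorm _
        _ ≤ K * (K ^ n * |s - y| ^ n / n.factorial * ‖x₀‖) := by
          gcongr
          · exact hK s
          · exact ih s
        _ = _ := by ring
    simp only [picardTerm]
    rw [intervalIntegral.norm_intervalIntegral_eq]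
    calc _ ≤ ∫ s in Set.uIoc y t, K ^ (n + 1) / n.factorial * ‖x₀‖ * |s - y| ^ n := by
          apply MeasureTheory.norm_integral_le_of_norm_le
          · exact (Continuous.integrableOn_uIoc (by fun_prop))
          · exact Filter.Eventually.of_forall hb
      _ = _ := by
          rw [MeasureTheory.integral_const_mul, integral_pow_abs_sub_uIoc, Nat.factorial_succ]
          push_cast
          field_simp

/-- Global solvability of a linear equation with bounded continuous coefficients. -/
theorem exists_linearODE_solution [CompleteSpace E] {A : ℝ → E →L[ℝ] E} (hA : Continuous A) {K : ℝ}
    (hK : ∀ t, ‖A t‖ ≤ K) (y : ℝ) (x₀ : E) :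
    ∃ Φ : ℝ → E, Φ y = x₀ ∧ ∀ t, HasDerivAt Φ (A t (Φ t)) t := by
  have hK0 : 0 ≤ K := (norm_nonneg _).trans (hK 0)
  set g := picardTerm A y x₀ with hg
  have hsum : ∀ t, Summable fun n => g n t := fun t => by
    refine Summable.of_norm_bounded (g := fun n => (K * |t - y|) ^ n / n.factorial * ‖x₀‖)
      ((Real.summable_pow_div_factorial _).mul_right _) fun n => ?_
    rw [mul_pow]
    exact norm_picardTerm_le hK y x₀ n t
  refine ⟨fun t => ∑' n, g n t, ?_, fun t => ?_⟩
  · change ∑' n, g n y = x₀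
    rw [tsum_eq_single 0]
    · simp [hg, picardTerm]
    · intro n hn
      obtain ⟨m, rfl⟩ := Nat.exists_eq_succ_of_ne_zero hn
      simp [hg, picardTerm]
  -- Termwise differentiation on the ball of radius `T`; the term of index `0` is constant.
  · set T := |t - y| + 1
    let g' : ℕ → ℝ → E := fun n s => A s (g n s)
    have key : HasDerivAt (fun s => ∑' n, g (n + 1) s) (∑' n, g' n t) t := by
      refine hasDerivAt_tsum_of_isPreconnected
        (u := fun n : ℕ => K * ((K * T) ^ n / n.factorial * ‖x₀‖)) (t := Metric.ball y T) (y₀ := y)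
        (((Real.summable_pow_div_factorial _).mul_right _).mul_left _)
        Metric.isOpen_ball (convex_ball y T).isPreconnected ?_ ?_ ?_ ?_ ?_
      · intro n s _
        exact hasDerivAt_picardTerm_succ hA y x₀ n s
      · intro n s hs
        have hs' : |s - y| ≤ T := by
          rw [Metric.mem_ball, Real.dist_eq] at hs
          exact hs.le
        calc _ ≤ ‖A s‖ * ‖g n s‖ := (A s).le_opNorm _
          _ ≤ K * (K ^ n * |s - y| ^ n / n.factorial * ‖x₀‖) := by
            gcongr
            · exact hK s
            · exact norm_picardTerm_le hK y x₀ n s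
          _ ≤ _ := by
            rw [mul_pow]
            gcongr
      · exact Metric.mem_ball_self (by positivity)
      · exact (summable_nat_add_iff 1).2 (hsum y)
      · rw [Metric.mem_ball, Real.dist_eq]
        exact lt_add_one _
    have h1 : (fun s => ∑' n, g n s) = fun s => x₀ + ∑' n, g (n + 1) s := by
      funext s
      rw [(hsum s).tsum_eq_zero_add]
      rfl
    rw [(A t).map_tsum (hsum t), h1]
    exact key.const_add _

end LinearODE

/-! ### Solutions of the linear problem and Floquet multipliers -/

lemma contDiff_phase {l : ℝ} (ψ : Phase l) : ContDiff ℝ ∞ (ψ : ℝ → ℂ) := ψ.2.1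

lemma continuous_phase {l : ℝ} (ψ : Phase l) : Continuous (ψ : ℝ → ℂ) := ψ.2.1.continuous

lemma periodic_phase {l : ℝ} (ψ : Phase l) (x : ℝ) :
    (ψ : ℝ → ℂ) (x + 2 * l) = (ψ : ℝ → ℂ) x := ψ.2.2 x

lemma exists_bound_of_periodic {F : Type*} [NormedAddCommGroup F] {f : ℝ → F} {c : ℝ}
    (hc : 0 < c) (hp : ∀ x, f (x + c) = f x) (hf : Continuous f) :
    ∃ C, 0 ≤ C ∧ ∀ x, ‖f x‖ ≤ C := by
  obtain ⟨C, hC⟩ := (Function.Periodic.isBounded_of_continuous hp hc.ne' hf).exists_norm_le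
  exact ⟨C, (norm_nonneg _).trans (hC _ ⟨0, rfl⟩), fun x => hC _ ⟨x, rfl⟩⟩

/-- `e` solves `e' = V e`. -/
def IsSol (ψ : ℝ → ℂ) (lam : ℂ) (e : ℝ → Fin 2 → ℂ) : Prop :=
  ∀ x, HasDerivAt e (matV ψ lam x *ᵥ e x) x

/-- The matrix `V` as a continuous real-linear operator. -/
def opV (ψ : ℝ → ℂ) (lam : ℂ) (x : ℝ) : (Fin 2 → ℂ) →L[ℝ] (Fin 2 → ℂ) :=
  LinearMap.toContinuousLinearMap ((Matrix.mulVecLin (matV ψ lam x)).restrictScalars ℝ)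

lemma opV_apply (ψ : ℝ → ℂ) (lam : ℂ) (x : ℝ) (v : Fin 2 → ℂ) :
    opV ψ lam x v = matV ψ lam x *ᵥ v := rfl

lemma matV_mulVec (ψ : ℝ → ℂ) (lam : ℂ) (x : ℝ) (v : Fin 2 → ℂ) :
    matV ψ lam x *ᵥ v = ![-(I * lam / 2) * v 0 + conj (ψ x) * v 1,
      ψ x * v 0 + I * lam / 2 * v 1] := by
  ext i
  fin_cases i <;> simp [matV, matY, sigma3, Matrix.mulVec, dotProduct, Fin.sum_univ_two]

lemma isSol_iff {ψ : ℝ → ℂ} {lam : ℂ} {e : ℝ → Fin 2 → ℂ} :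
    IsSol ψ lam e ↔ ∀ x,
      HasDerivAt (fun s => e s 0) (-(I * lam / 2) * e x 0 + conj (ψ x) * e x 1) x ∧
      HasDerivAt (fun s => e s 1) (ψ x * e x 0 + I * lam / 2 * e x 1) x := by
  unfold IsSol
  refine forall_congr' fun x => ?_
  rw [hasDerivAt_pi, Fin.forall_fin_two, matV_mulVec]
  simp

lemma continuous_opV {ψ : ℝ → ℂ} (hψ : Continuous ψ) (lam : ℂ) : Continuous (opV ψ lam) := by
  rw [continuous_clm_apply]
  intro v
  simp only [opV_apply, matV_mulVec]
  refine continuous_pi fun i => ?_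
  fin_cases i
  · simp only [Fin.zero_eta, Matrix.cons_val_zero]
    exact continuous_const.add ((continuous_conj.comp hψ).mul continuous_const)
  · simp only [Fin.mk_one, Matrix.cons_val_one]
    exact (hψ.mul continuous_const).add continuous_const

section

variable {l : ℝ} (hl : 0 < l) (ψ : Phase l) (lam : ℂ)
include hl

lemma exists_bound_opV : ∃ K, 0 ≤ K ∧ ∀ x, ‖opV ψ lam x‖ ≤ K := by
  refine exists_bound_of_periodic (c := 2 * l) (by positivity) (fun x => ?_)
    (continuous_opV (continuous_phase ψ) lam)
  ext v i
  simp only [opV_apply, matV_mulVec, periodic_phase ψ]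

lemma exists_isSol (y : ℝ) (e₀ : Fin 2 → ℂ) : ∃ e, IsSol ψ lam e ∧ e y = e₀ := by
  obtain ⟨K, -, hK⟩ := exists_bound_opV hl ψ lam
  obtain ⟨e, h1, h2⟩ := exists_linearODE_solution (continuous_opV (continuous_phase ψ) lam) hK y e₀
  exact ⟨e, h2, h1⟩

variable {ψ lam}

lemma IsSol.unique {e f : ℝ → Fin 2 → ℂ} (he : IsSol ψ lam e) (hf : IsSol ψ lam f) {y : ℝ}
    (h : e y = f y) : e = f := by
  obtain ⟨K, hK0, hK⟩ := exists_bound_opV hl ψ lam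
  refine ODE_solution_unique_univ (v := fun t v => opV ψ lam t v) (s := fun _ => Set.univ)
    (K := K.toNNReal) (t₀ := y) (fun t => ?_) (fun t => ⟨he t, trivial⟩)
    (fun t => ⟨hf t, trivial⟩) h
  refine ((opV ψ lam t).lipschitz.weaken ?_).lipschitzOnWith
  rw [← NNReal.coe_le_coe, Real.coe_toNNReal _ hK0]
  exact hK t

end

lemma IsSol.smul {ψ : ℝ → ℂ} {lam : ℂ} {e : ℝ → Fin 2 → ℂ} (he : IsSol ψ lam e) (c : ℂ) :
    IsSol ψ lam fun x => c • e x := fun x => by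
  rw [Matrix.mulVec_smul]
  exact (he x).const_smul c

lemma IsSol.shift {l : ℝ} {ψ : Phase l} {lam : ℂ} {e : ℝ → Fin 2 → ℂ} (he : IsSol ψ lam e) :
    IsSol ψ lam fun x => e (x + 2 * l) := fun x => by
  have h := (he (x + 2 * l)).comp_add_const x (2 * l)
  rwa [show matV ψ lam (x + 2 * l) = matV ψ lam x by simp [matV, matY, periodic_phase ψ]] at h

lemma IsTransitionMatrix.isSol_mulVec {ψ : ℝ → ℂ} {lam : ℂ} {y : ℝ}
    {M : ℝ → Matrix (Fin 2) (Fin 2) ℂ} (hM : IsTransitionMatrix ψ lam y M) (v : Fin 2 → ℂ) :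
    IsSol ψ lam fun x => M x *ᵥ v := fun x => by
  rw [hasDerivAt_pi]
  intro i
  rw [Matrix.mulVec_mulVec]
  simp only [Matrix.mulVec, dotProduct]
  exact HasDerivAt.fun_sum fun j _ => (hM.2 x i j).mul_const (v j)

lemma exists_isTransitionMatrix {l : ℝ} (hl : 0 < l) (ψ : Phase l) (lam : ℂ) (y : ℝ) :
    ∃ M, IsTransitionMatrix ψ lam y M := by
  choose e he h0 using fun j : Fin 2 => exists_isSol hl ψ lam y (Pi.single j 1)
  refine ⟨fun x => Matrix.of fun i j => e j x i, ?_, fun x i j => ?_⟩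
  · ext i j
    simp [h0, Matrix.one_apply, Pi.single_apply]
  · exact hasDerivAt_pi.1 (he j x) i

lemma IsTransitionMatrix.det_eq_one {ψ : ℝ → ℂ} {lam : ℂ} {y : ℝ}
    {M : ℝ → Matrix (Fin 2) (Fin 2) ℂ} (hM : IsTransitionMatrix ψ lam y M) (x : ℝ) :
    (M x).det = 1 := by
  have hd : ∀ x, HasDerivAt (fun s => (M s).det) 0 x := fun x => by
    simp only [Matrix.det_fin_two]
    refine (((hM.2 x 0 0).mul (hM.2 x 1 1)).sub
      ((hM.2 x 0 1).mul (hM.2 x 1 0))).congr_deriv ?_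
    simp [matV, matY, sigma3, Matrix.mul_apply, Fin.sum_univ_two]
    ring
  have := is_const_of_deriv_eq_zero (fun x => (hd x).differentiableAt) (fun x => (hd x).deriv) x y
  simpa [hM.1] using this

/-- `e` is a nonzero solution of `e' = V e` with Floquet multiplier `w`. -/
structure IsFloquetSol (l : ℝ) (ψ : ℝ → ℂ) (lam w : ℂ) (e : ℝ → Fin 2 → ℂ) : Prop where
  sol : IsSol ψ lam e
  mult : ∀ x, e (x + 2 * l) = w • e x
  ne_zero : ∀ x, e x ≠ 0

section

variable {l : ℝ} (hl : 0 < l) {ψ : Phase l} {lam w : ℂ}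
include hl

lemma IsTransitionMatrix.mulVec_eq {y : ℝ} {M : ℝ → Matrix (Fin 2) (Fin 2) ℂ}
    (hM : IsTransitionMatrix ψ lam y M) {e : ℝ → Fin 2 → ℂ} (he : IsSol ψ lam e) (x : ℝ) :
    M x *ᵥ e y = e x :=
  congrFun ((hM.isSol_mulVec (e y)).unique hl he (y := y) (by simp [hM.1])) x

lemma IsSol.ne_zero {e : ℝ → Fin 2 → ℂ} (he : IsSol ψ lam e) {y : ℝ} (hy : e y ≠ 0) (x : ℝ) :
    e x ≠ 0 := fun hx => hy <| by
  have h0 : IsSol ψ lam fun _ => (0 : Fin 2 → ℂ) := fun x => by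
    simpa using hasDerivAt_const x (0 : Fin 2 → ℂ)
  exact congrFun (he.unique hl h0 hx) y

lemma mem_spectralCurve_iff_exists :
    (lam, w) ∈ spectralCurve l ψ ↔ ∃ e, IsFloquetSol l ψ lam w e := by
  constructor
  · rintro ⟨M, hM, hdet⟩
    obtain ⟨v, hv, h⟩ := Matrix.exists_mulVec_eq_zero_iff.2 hdet
    have hs := hM.isSol_mulVec v
    refine ⟨fun x => M x *ᵥ v, hs, fun x => ?_, hs.ne_zero hl (y := -l) (by simpa [hM.1])⟩
    refine congrFun (hs.shift.unique hl (hs.smul w) (y := -l) ?_) x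
    rw [Matrix.sub_mulVec, Matrix.smul_mulVec, Matrix.one_mulVec, sub_eq_zero] at h
    simpa [hM.1, show -l + 2 * l = l by ring] using h
  · rintro ⟨e, he⟩
    obtain ⟨M, hM⟩ := exists_isTransitionMatrix hl ψ lam (-l)
    refine ⟨M, hM, Matrix.exists_mulVec_eq_zero_iff.1 ⟨e (-l), he.ne_zero _, ?_⟩⟩
    rw [Matrix.sub_mulVec, Matrix.smul_mulVec, Matrix.one_mulVec, sub_eq_zero,
      hM.mulVec_eq hl he.sol, ← he.mult, show -l + 2 * l = l by ring]

variable (ψ lam) in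
/-- The two multipliers over `lam` are the roots of `w² - Δ w + 1`. -/
lemma exists_trace_spectralCurve :
    ∃ Δ : ℂ, ∀ w, (lam, w) ∈ spectralCurve l ψ ↔ w ^ 2 - Δ * w + 1 = 0 := by
  obtain ⟨M, hM⟩ := exists_isTransitionMatrix hl ψ lam (-l)
  have huniq : ∀ M', IsTransitionMatrix ψ lam (-l) M' → M' l = M l := fun M' hM' => by
    refine Matrix.ext_of_mulVec_single fun j => ?_
    refine congrFun ((hM'.isSol_mulVec (Pi.single j 1)).unique hl
      (hM.isSol_mulVec (Pi.single j 1)) (y := -l) ?_) l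
    simp only [hM.1, hM'.1]
  refine ⟨(M l).trace, fun w => ?_⟩
  have hdet : (M l - w • (1 : Matrix (Fin 2) (Fin 2) ℂ)).det =
      w ^ 2 - (M l).trace * w + 1 := by
    have h1 := hM.det_eq_one l
    rw [Matrix.det_fin_two] at h1
    simp [Matrix.det_fin_two, Matrix.trace_fin_two]
    linear_combination h1
  constructor
  · rintro ⟨M', hM', h⟩
    rwa [huniq M' hM', hdet] at h
  · intro h
    exact ⟨M, hM, hdet.trans h⟩

omit hl in
lemma IsFloquetSol.mult_ne_zero {e : ℝ → Fin 2 → ℂ} (he : IsFloquetSol l ψ lam w e) : w ≠ 0 := by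
  rintro rfl
  exact he.ne_zero _ (by simpa using he.mult 0)

/-- The energy identity `(|e¹|² - |e²|²)' = Im lam (|e¹|² + |e²|²)` separates the sheets. -/
lemma IsFloquetSol.sign (hlam : lam.im ≠ 0) {e : ℝ → Fin 2 → ℂ} (he : IsFloquetSol l ψ lam w e)
    (x : ℝ) : 0 < (‖w‖ ^ 2 - 1) * lam.im * (‖e x 0‖ ^ 2 - ‖e x 1‖ ^ 2) := by
  set f : ℝ → ℝ := fun x => lam.im * (‖e x 0‖ ^ 2 - ‖e x 1‖ ^ 2) with hf
  have hd : ∀ x, HasDerivAt f (lam.im ^ 2 * (‖e x 0‖ ^ 2 + ‖e x 1‖ ^ 2)) x := fun x => by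
    obtain ⟨h0, h1⟩ := isSol_iff.1 he.sol x
    refine ((h0.norm_sq.sub h1.norm_sq).const_mul lam.im).congr_deriv ?_
    simp only [Complex.inner, ← Complex.normSq_eq_norm_sq, Complex.normSq_apply]
    simp
    ring
  have hpos : ∀ x, 0 < lam.im ^ 2 * (‖e x 0‖ ^ 2 + ‖e x 1‖ ^ 2) := fun x => by
    have h2 : e x 0 ≠ 0 ∨ e x 1 ≠ 0 := by
      by_contra! h
      exact he.ne_zero x (by ext i; fin_cases i <;> simp [h])
    rcases h2 with h | h <;> positivity
  have hmono : StrictMono f := strictMono_of_deriv_pos fun x => by rw [(hd x).deriv]; exact hpos x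
  have h3 : f x < f (x + 2 * l) := hmono (by linarith)
  simp only [hf, he.mult, Pi.smul_apply, smul_eq_mul, norm_mul, mul_pow] at h3
  linarith

end

lemma IsSol.wronskian_const {ψ : ℝ → ℂ} {lam : ℂ} {e f : ℝ → Fin 2 → ℂ} (he : IsSol ψ lam e)
    (hf : IsSol ψ lam f) (x y : ℝ) :
    e x 0 * f x 1 - e x 1 * f x 0 = e y 0 * f y 1 - e y 1 * f y 0 := by
  have hd : ∀ x, HasDerivAt (fun x => e x 0 * f x 1 - e x 1 * f x 0) 0 x := fun x => by
    obtain ⟨h0, h1⟩ := isSol_iff.1 he x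
    obtain ⟨k0, k1⟩ := isSol_iff.1 hf x
    refine ((h0.mul k1).sub (h1.mul k0)).congr_deriv ?_
    ring
  exact is_const_of_deriv_eq_zero (fun x => (hd x).differentiableAt) (fun x => (hd x).deriv) x y

/-- Two Floquet solutions over the same `lam` whose multipliers are not inverse to each other
are proportional. -/
lemma IsFloquetSol.wronskian_eq_zero {l : ℝ} {ψ : ℝ → ℂ} {lam w w' : ℂ} {e f : ℝ → Fin 2 → ℂ}
    (he : IsFloquetSol l ψ lam w e) (hf : IsFloquetSol l ψ lam w' f) (h : w * w' ≠ 1) (x : ℝ) :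
    e x 0 * f x 1 - e x 1 * f x 0 = 0 := by
  have h1 := he.sol.wronskian_const hf.sol (x + 2 * l) x
  simp only [he.mult, hf.mult, Pi.smul_apply, smul_eq_mul] at h1
  refine (mul_eq_zero.1 (?_ : (w * w' - 1) * _ = 0)).resolve_left (sub_ne_zero.2 h)
  linear_combination h1

/-! ### The two sheets -/

/-- The mirror image `x ↦ (conj e², conj e¹)` maps solutions over `lam` to solutions over
`conj lam`. -/
def mirror (e : ℝ → Fin 2 → ℂ) (x : ℝ) : Fin 2 → ℂ := ![conj (e x 1), conj (e x 0)]

lemma IsSol.mirror {ψ : ℝ → ℂ} {lam : ℂ} {e : ℝ → Fin 2 → ℂ} (he : IsSol ψ lam e) :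
    IsSol ψ (conj lam) (mirror e) := isSol_iff.2 fun x => by
  obtain ⟨h0, h1⟩ := isSol_iff.1 he x
  have k0 := h0.star
  have k1 := h1.star
  refine ⟨k1.congr_deriv ?_, k0.congr_deriv ?_⟩ <;> simp [KrichPhong.mirror] <;> ring

lemma IsFloquetSol.mirror {l : ℝ} {ψ : ℝ → ℂ} {lam w : ℂ} {e : ℝ → Fin 2 → ℂ}
    (he : IsFloquetSol l ψ lam w e) :
    IsFloquetSol l ψ (conj lam) (conj w) (KrichPhong.mirror e) where
  sol := he.sol.mirror
  mult x := by
    ext i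
    fin_cases i <;> simp [KrichPhong.mirror, he.mult]
  ne_zero x h := he.ne_zero x <| by
    have h0 := congrFun h 0
    have h1 := congrFun h 1
    ext i
    fin_cases i <;> simp_all [KrichPhong.mirror]

section

variable {l : ℝ} (hl : 0 < l) {ψ : Phase l} {lam : ℂ}
include hl

/-- The mirror symmetry exchanges the sheets as well as the half-planes. -/
lemma OnSheet.conj {σ : ℤˣ} {w : ℂ} (h : OnSheet l ψ σ lam w) :
    OnSheet l ψ (-σ) (conj lam) (conj w) := by
  obtain ⟨e, he⟩ := (mem_spectralCurve_iff_exists hl).1 h.1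
  refine ⟨(mem_spectralCurve_iff_exists hl).2 ⟨_, he.mirror⟩, ?_⟩
  have := h.2
  simpa using this

/-- The two roots of `w² - Δ w + 1` are inverse to each other, so they lie on different sheets. -/
lemma OnSheet.inv {σ : ℤˣ} {w : ℂ} (h : OnSheet l ψ σ lam w) :
    OnSheet l ψ (-σ) lam w⁻¹ := by
  obtain ⟨Δ, hΔ⟩ := exists_trace_spectralCurve hl ψ lam
  obtain ⟨e, he⟩ := (mem_spectralCurve_iff_exists hl).1 h.1
  have h0 := he.mult_ne_zero
  refine ⟨(hΔ _).2 ?_, ?_⟩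
  · have := (hΔ w).1 h.1
    field_simp
    linear_combination this
  · have := h.2
    simpa using this

/-- On a sheet, the multiplier is either inside or outside the unit circle, and the sign of
`|e¹|² - |e²|²` is opposite to the sign of the sheet. -/
lemma OnSheet.sign {σ : ℤˣ} {w : ℂ} (h : OnSheet l ψ σ lam w) {e : ℝ → Fin 2 → ℂ}
    (he : IsFloquetSol l ψ lam w e) (x : ℝ) :
    ((σ : ℤ) : ℝ) * (‖e x 0‖ ^ 2 - ‖e x 1‖ ^ 2) < 0 := by
  have hlam : lam.im ≠ 0 := fun h0 => by simpa [h0] using h.2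
  have h1 := he.sign hl hlam x
  have h2 := h.2
  have hw : 0 < ‖w‖ := norm_pos_iff.2 he.mult_ne_zero
  have hne : ‖w‖ ≠ 1 := fun h0 => by simp [h0] at h1
  have h3 : 0 < (‖w‖ ^ 2 - 1) * Real.log ‖w‖ := by
    rcases lt_or_gt_of_ne hne with h | h
    · exact mul_pos_of_neg_of_neg (by nlinarith) (Real.log_neg hw h)
    · exact mul_pos (by nlinarith) (Real.log_pos h)
  set A := ‖w‖ ^ 2 - 1
  set G := ‖e x 0‖ ^ 2 - ‖e x 1‖ ^ 2
  by_contra! h4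
  have h5 : (A * lam.im * G) * ((σ : ℤ) * lam.im * Real.log ‖w‖) < 0 := mul_neg_of_pos_of_neg h1 h2
  have h6 : 0 ≤ (A * Real.log ‖w‖) * ((σ : ℤ) * G) * lam.im ^ 2 := by positivity
  linarith

lemma OnSheet.unique {σ : ℤˣ} {w w' : ℂ} (h : OnSheet l ψ σ lam w) (h' : OnSheet l ψ σ lam w') :
    w = w' := by
  obtain ⟨Δ, hΔ⟩ := exists_trace_spectralCurve hl ψ lam
  have h1 := (hΔ w).1 h.1
  have h2 := (hΔ w').1 h'.1
  obtain ⟨e, he⟩ := (mem_spectralCurve_iff_exists hl).1 h.1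
  have h3 : (w - w') * (w * w' - 1) = 0 := by linear_combination w' * h1 - w * h2
  rcases mul_eq_zero.1 h3 with h3 | h3
  · exact sub_eq_zero.1 h3
  · exfalso
    have h4 : w' = w⁻¹ := eq_inv_of_mul_eq_one_right (sub_eq_zero.1 h3)
    have h5 := h.2
    have h6 := h'.2
    rw [h4, norm_inv, Real.log_inv] at h6
    linarith

lemma exists_onSheet (σ : ℤˣ) (hlam : lam.im ≠ 0) : ∃ w, OnSheet l ψ σ lam w := by
  obtain ⟨Δ, hΔ⟩ := exists_trace_spectralCurve hl ψ lam
  obtain ⟨s, hs⟩ := IsAlgClosed.exists_eq_mul_self (Δ ^ 2 - 4)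
  have hw : ((Δ + s) / 2) ^ 2 - Δ * ((Δ + s) / 2) + 1 = 0 := by linear_combination -hs / 4
  set w := (Δ + s) / 2
  have hmem := (hΔ w).2 hw
  obtain ⟨e, he⟩ := (mem_spectralCurve_iff_exists hl).1 hmem
  have h1 := he.sign hl hlam 0
  have hlog : Real.log ‖w‖ ≠ 0 := by
    refine Real.log_ne_zero_of_pos_of_ne_one (norm_pos_iff.2 he.mult_ne_zero) fun h0 => ?_
    simp [h0] at h1
  have hne : ((σ : ℤ) : ℝ) * lam.im * Real.log ‖w‖ ≠ 0 :=
    mul_ne_zero (mul_ne_zero (by simp) hlam) hlog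
  rcases lt_or_gt_of_ne hne with h | h
  · exact ⟨w, hmem, h⟩
  · have : OnSheet l ψ (-σ) lam w := ⟨hmem, by simpa using h⟩
    exact ⟨w⁻¹, by simpa using this.inv hl⟩

lemma onSheet_multiplier (σ : ℤˣ) (hlam : lam.im ≠ 0) :
    OnSheet l ψ σ lam (multiplier l ψ σ lam) :=
  Classical.epsilon_spec (exists_onSheet hl σ hlam)

lemma OnSheet.eq_multiplier {σ : ℤˣ} {w : ℂ} (h : OnSheet l ψ σ lam w) :
    w = multiplier l ψ σ lam :=
  h.unique hl (Classical.epsilon_spec ⟨w, h⟩)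

lemma multiplier_neg (σ : ℤˣ) (hlam : lam.im ≠ 0) :
    multiplier l ψ (-σ) lam = (multiplier l ψ σ lam)⁻¹ :=
  (((onSheet_multiplier hl σ hlam).inv hl).eq_multiplier hl).symm

lemma multiplier_conj (σ : ℤˣ) (hlam : lam.im ≠ 0) :
    multiplier l ψ (-σ) (conj lam) = conj (multiplier l ψ σ lam) :=
  (((onSheet_multiplier hl σ hlam).conj hl).eq_multiplier hl).symm

lemma sheetSwap_curvePoint (σ : ℤˣ) (hlam : lam.im ≠ 0) :
    sheetSwap (curvePoint l ψ σ lam) = curvePoint l ψ (-σ) lam := by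
  simp [sheetSwap, curvePoint, multiplier_neg hl σ hlam]

lemma IsFloquet.isFloquetSol {w : ℂ} {e : ℝ → Fin 2 → ℂ} (he : IsFloquet l ψ (lam, w) e) :
    IsFloquetSol l ψ lam w e :=
  ⟨he.ode, he.mult, IsSol.ne_zero hl he.ode (y := -l) fun h => by simpa [h] using he.norm⟩

lemma existsUnique_isFloquet (σ : ℤˣ) (hlam : lam.im ≠ 0) :
    ∃! e, IsFloquet l ψ (curvePoint l ψ σ lam) e := by
  have hw := onSheet_multiplier hl (ψ := ψ) σ hlam
  obtain ⟨e, he⟩ := (mem_spectralCurve_iff_exists hl).1 hw.1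
  have hs := hw.sign hl he (-l)
  -- The normalization is possible because `|e¹| ≠ |e²|` for a solution on either sheet.
  have hne : e (-l) 0 + e (-l) 1 ≠ 0 := fun h => by
    rw [eq_neg_of_add_eq_zero_left h, norm_neg, sub_self, mul_zero] at hs
    exact lt_irrefl _ hs
  set c := (e (-l) 0 + e (-l) 1)⁻¹
  have hc : c ≠ 0 := inv_ne_zero hne
  refine ⟨fun x => c • e x, ⟨he.sol.smul c, fun x => ?_, ?_⟩, fun f hf => ?_⟩
  · simp only [he.mult, smul_comm c]
    rfl
  · simp only [Pi.smul_apply, smul_eq_mul, ← mul_add]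
    exact inv_mul_cancel₀ hne
  · have hff := hf.isFloquetSol hl
    have hsq : multiplier l ψ σ lam * multiplier l ψ σ lam ≠ 1 := fun h => by
      have h1 := he.sign hl hlam 0
      rw [sq, ← norm_mul, h, norm_one] at h1
      simp at h1
    have h2 := hff.wronskian_eq_zero he hsq (-l)
    have h3 := hf.norm
    refine hff.sol.unique hl (he.sol.smul c) (y := -l) ?_
    have h0 : f (-l) 0 = c * e (-l) 0 := by
      rw [eq_inv_mul_iff_mul_eq₀ hne]
      linear_combination h2 + e (-l) 0 * h3
    have h1 : f (-l) 1 = c * e (-l) 1 := by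
      rw [eq_inv_mul_iff_mul_eq₀ hne]
      linear_combination -h2 + e (-l) 1 * h3
    ext i
    fin_cases i
    · exact h0
    · exact h1

lemma isFloquet_floquet (σ : ℤˣ) (hlam : lam.im ≠ 0) :
    IsFloquet l ψ (curvePoint l ψ σ lam) (floquet l ψ (curvePoint l ψ σ lam)) :=
  Classical.epsilon_spec (existsUnique_isFloquet hl σ hlam).exists

/-- The two sheets are mirror images of each other. -/
lemma floquet_mirror (σ : ℤˣ) (hlam : lam.im ≠ 0) :
    floquet l ψ (curvePoint l ψ (-σ) (conj lam)) =
      mirror (floquet l ψ (curvePoint l ψ σ lam)) := by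
  have hlam' : (conj lam).im ≠ 0 := by simpa using hlam
  have h := isFloquet_floquet hl (ψ := ψ) σ hlam
  refine (existsUnique_isFloquet hl (-σ) hlam').unique (isFloquet_floquet hl (-σ) hlam') ?_
  have hm := (h.isFloquetSol hl).mirror
  refine ⟨hm.sol, fun x => ?_, ?_⟩
  · rw [hm.mult, ← multiplier_conj hl σ hlam]
    rfl
  · have := congrArg conj h.norm
    simpa [mirror, add_comm] using this

end

/-! ### The Riccati equation -/

/-- The second component `e²` of the Floquet solution on the sheet of `P₊`. -/
def lower (l : ℝ) (ψ : ℝ → ℂ) (lam : ℂ) (x : ℝ) : ℂ :=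
  floquet l ψ (curvePoint l ψ 1 lam) x 1

/-- The ratio `r = e¹ / e²` on the sheet of `P₊`. -/
def ratio (l : ℝ) (ψ : ℝ → ℂ) (lam : ℂ) (x : ℝ) : ℂ :=
  floquet l ψ (curvePoint l ψ 1 lam) x 0 / lower l ψ lam x

/-- The ratio `q = e² / e¹` on the sheet of `P₋`, written through the ratio on the sheet of `P₊`
by means of the mirror symmetry. -/
def dualRatio (l : ℝ) (ψ : ℝ → ℂ) (lam : ℂ) (x : ℝ) : ℂ := conj (ratio l ψ (conj lam) x)

section

variable {l : ℝ} (hl : 0 < l) (ψ : Phase l) {lam : ℂ} (hlam : lam.im ≠ 0)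
include hl hlam

/-- On the sheet of `P₊` the second component dominates, over both half-planes. -/
lemma norm_floquet_lt (x : ℝ) :
    ‖floquet l ψ (curvePoint l ψ 1 lam) x 0‖ < ‖lower l ψ lam x‖ := by
  have h := (onSheet_multiplier hl (ψ := ψ) 1 hlam).sign hl
    ((isFloquet_floquet hl 1 hlam).isFloquetSol hl) x
  simp only [Units.val_one, Int.cast_one, one_mul] at h
  exact lt_of_pow_lt_pow_left₀ 2 (norm_nonneg _) (by rw [lower]; linarith)

lemma lower_ne_zero (x : ℝ) : lower l ψ lam x ≠ 0 :=
  norm_pos_iff.1 ((norm_nonneg _).trans_lt (norm_floquet_lt hl ψ hlam x))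

lemma norm_ratio_lt (x : ℝ) : ‖ratio l ψ lam x‖ < 1 := by
  rw [ratio, norm_div, div_lt_one (norm_pos_iff.2 (lower_ne_zero hl ψ hlam x))]
  exact norm_floquet_lt hl ψ hlam x

lemma floquet_zero_eq (x : ℝ) :
    floquet l ψ (curvePoint l ψ 1 lam) x 0 = ratio l ψ lam x * lower l ψ lam x :=
  (div_mul_cancel₀ _ (lower_ne_zero hl ψ hlam x)).symm

lemma hasDerivAt_lower (x : ℝ) : HasDerivAt (lower l ψ lam)
    ((I * lam / 2 + (ψ : ℝ → ℂ) x * ratio l ψ lam x) * lower l ψ lam x) x := by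
  refine (isSol_iff.1 (isFloquet_floquet hl (ψ := ψ) 1 hlam).ode x).2.congr_deriv ?_
  rw [floquet_zero_eq hl ψ hlam]
  change _ + I * lam / 2 * lower l ψ lam x = _
  ring

lemma hasDerivAt_ratio (x : ℝ) : HasDerivAt (ratio l ψ lam)
    (-(I * lam) * ratio l ψ lam x + conj ((ψ : ℝ → ℂ) x)
      - (ψ : ℝ → ℂ) x * ratio l ψ lam x ^ 2) x := by
  have h0 := (isSol_iff.1 (isFloquet_floquet hl (ψ := ψ) 1 hlam).ode x).1
  have hne := lower_ne_zero hl ψ hlam x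
  refine (h0.div (hasDerivAt_lower hl ψ hlam x) hne).congr_deriv ?_
  rw [floquet_zero_eq hl ψ hlam]
  change ((-(I * lam / 2) * _ + _ * lower l ψ lam x) * _ - _) / _ = _
  field_simp
  ring

lemma lower_add_period (x : ℝ) :
    lower l ψ lam (x + 2 * l) = multiplier l ψ 1 lam * lower l ψ lam x := by
  rw [lower, (isFloquet_floquet hl (ψ := ψ) 1 hlam).mult]
  rfl

lemma multiplier_ne_zero : multiplier l ψ 1 lam ≠ 0 :=
  ((isFloquet_floquet hl (ψ := ψ) 1 hlam).isFloquetSol hl).mult_ne_zero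

lemma ratio_add_period (x : ℝ) : ratio l ψ lam (x + 2 * l) = ratio l ψ lam x := by
  have h := multiplier_ne_zero hl ψ hlam
  have h1 := lower_ne_zero hl ψ hlam x
  rw [ratio, lower_add_period hl ψ hlam, (isFloquet_floquet hl (ψ := ψ) 1 hlam).mult, ratio]
  simp only [curvePoint, Pi.smul_apply, smul_eq_mul]
  field_simp

lemma lower_norm : lower l ψ lam (-l) * (1 + ratio l ψ lam (-l)) = 1 := by
  have h := (isFloquet_floquet hl (ψ := ψ) 1 hlam).norm
  rw [floquet_zero_eq hl ψ hlam] at h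
  change _ + lower l ψ lam (-l) = 1 at h
  linear_combination h

lemma continuous_ratio : Continuous (ratio l ψ lam) :=
  continuous_iff_continuousAt.2 fun x => (hasDerivAt_ratio hl ψ hlam x).continuousAt

lemma continuous_lower : Continuous (lower l ψ lam) :=
  continuous_iff_continuousAt.2 fun x => (hasDerivAt_lower hl ψ hlam x).continuousAt

/-- The second component is the exponential of the integral of `i lam / 2 + ψ r`. -/
lemma lower_eq_mul_exp (y x : ℝ) : lower l ψ lam x = lower l ψ lam y *
    exp (I * lam / 2 * (x - y) + ∫ s in y..x, (ψ : ℝ → ℂ) s * ratio l ψ lam s) := by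
  have hc : Continuous fun s => (ψ : ℝ → ℂ) s * ratio l ψ lam s :=
    (continuous_phase ψ).mul (continuous_ratio hl ψ hlam)
  set f : ℝ → ℂ := fun x => I * lam / 2 * (x - y) + ∫ s in y..x, (ψ : ℝ → ℂ) s * ratio l ψ lam s
  have hf : ∀ x, HasDerivAt f (I * lam / 2 + (ψ : ℝ → ℂ) x * ratio l ψ lam x) x := fun x => by
    have h1 : HasDerivAt (fun x : ℝ => (x : ℂ) - y) 1 x :=
      (HasDerivAt.ofReal_comp (hasDerivAt_id x)).sub_const _
    have h2 := (h1.const_mul (I * lam / 2)).add (intervalIntegral.integral_hasDerivAt_right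
      (hc.intervalIntegrable y x) (hc.stronglyMeasurableAtFilter _ _) hc.continuousAt)
    rw [mul_one] at h2
    exact h2
  have hd : ∀ x, HasDerivAt (fun x => lower l ψ lam x * exp (-f x)) 0 x := fun x => by
    refine ((hasDerivAt_lower hl ψ hlam x).mul (hf x).neg.cexp).congr_deriv ?_
    ring
  have h := is_const_of_deriv_eq_zero (fun x => (hd x).differentiableAt) (fun x => (hd x).deriv) x y
  have hy : f y = 0 := by simp [f]
  simp only [hy, neg_zero, exp_zero, mul_one] at h
  change _ = lower l ψ lam y * exp (f x)
  rw [← h, mul_assoc, ← exp_add, neg_add_cancel, exp_zero, mul_one]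

/-- The quasimomentum is the mean of `lam / 2 - i ψ r`. -/
lemma multiplier_eq_exp : multiplier l ψ 1 lam =
    exp (I * lam * l + ∫ s in (-l)..l, (ψ : ℝ → ℂ) s * ratio l ψ lam s) := by
  have h := lower_add_period hl ψ hlam (-l)
  have h1 := lower_eq_mul_exp hl ψ hlam (-l) l
  rw [show -l + 2 * l = l by ring, h1, mul_comm] at h
  rw [← mul_right_cancel₀ (lower_ne_zero hl ψ hlam (-l)) h]
  congr 2
  push_cast
  ring

lemma norm_dualRatio_lt (x : ℝ) : ‖dualRatio l ψ lam x‖ < 1 := by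
  rw [dualRatio, Complex.norm_conj]
  exact norm_ratio_lt hl ψ (by simpa using hlam) x

lemma continuous_dualRatio : Continuous (dualRatio l ψ lam) :=
  continuous_conj.comp (continuous_ratio hl ψ (by simpa using hlam))

lemma floquet_neg_one (x : ℝ) : floquet l ψ (curvePoint l ψ (-1) lam) x =
    ![conj (lower l ψ (conj lam) x), dualRatio l ψ lam x * conj (lower l ψ (conj lam) x)] := by
  have hlam' : (conj lam).im ≠ 0 := by simpa using hlam
  have h := floquet_mirror hl (ψ := ψ) 1 hlam'
  rw [conj_conj] at h
  rw [h, mirror, floquet_zero_eq hl ψ hlam', dualRatio, map_mul]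
  rfl

lemma one_sub_ratio_ne_zero (x : ℝ) : 1 - dualRatio l ψ lam x * ratio l ψ lam x ≠ 0 := by
  intro h
  have h1 := congrArg norm (sub_eq_zero.1 h)
  rw [norm_one, norm_mul] at h1
  have := mul_lt_one_of_nonneg_of_lt_one_left (norm_nonneg _) (norm_dualRatio_lt hl ψ hlam x)
    (norm_ratio_lt hl ψ hlam x).le
  linarith

lemma floquetPlus_curvePoint (σ : ℤˣ) :
    floquetPlus l ψ (curvePoint l ψ σ lam) = floquet l ψ (curvePoint l ψ (-σ) lam) := by
  rw [floquetPlus, sheetSwap_curvePoint hl σ hlam]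

/-- The Wronskian in terms of the two ratios; it does not vanish because `|q r| < 1`. -/
lemma pairing_eq (x : ℝ) :
    floquetPlus l ψ (curvePoint l ψ 1 lam) x ⬝ᵥ (matJ *ᵥ floquet l ψ (curvePoint l ψ 1 lam) x) =
      conj (lower l ψ (conj lam) x) * lower l ψ lam x *
        (1 - dualRatio l ψ lam x * ratio l ψ lam x) := by
  rw [floquetPlus_curvePoint hl ψ hlam, floquet_neg_one hl ψ hlam]
  simp only [matJ, Matrix.mulVec, dotProduct, Fin.sum_univ_two, floquet_zero_eq hl ψ hlam]
  change _ = _ * floquet l ψ (curvePoint l ψ 1 lam) x 1 * _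
  simp only [lower, Matrix.of_apply, Matrix.cons_val_zero, Matrix.cons_val_one]
  ring

omit hlam in
lemma avg_const (c : ℂ) : avg l (fun _ => c) = c := by
  have : (l : ℂ) ≠ 0 := by exact_mod_cast hl.ne'
  rw [avg, intervalIntegral.integral_const]
  simp only [sub_neg_eq_add, real_smul]
  push_cast
  field_simp
  ring

/-- `e⁺ J e` is the Wronskian of two solutions, so it does not depend on `x`. -/
lemma pairing_eq_wronskian (σ : ℤˣ) (x : ℝ) :
    floquetPlus l ψ (curvePoint l ψ σ lam) x ⬝ᵥ (matJ *ᵥ floquet l ψ (curvePoint l ψ σ lam) x) =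
      wronskian l ψ (curvePoint l ψ σ lam) := by
  have h1 := isFloquet_floquet hl (ψ := ψ) σ hlam
  have h2 := isFloquet_floquet hl (ψ := ψ) (-σ) hlam
  have hw : ∀ y, floquetPlus l ψ (curvePoint l ψ σ lam) y ⬝ᵥ
      (matJ *ᵥ floquet l ψ (curvePoint l ψ σ lam) y) =
      floquetPlus l ψ (curvePoint l ψ σ lam) x ⬝ᵥ
      (matJ *ᵥ floquet l ψ (curvePoint l ψ σ lam) x) := fun y => by
    have h := IsSol.wronskian_const h2.ode h1.ode y x
    rw [floquetPlus_curvePoint hl ψ hlam]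
    simp only [matJ, Matrix.mulVec, dotProduct, Fin.sum_univ_two]
    simp only [Matrix.of_apply, Matrix.cons_val_zero, Matrix.cons_val_one]
    linear_combination h
  rw [wronskian, funext hw, avg_const hl]

omit hl hlam in
lemma dotProduct_matJ_comm (v w : Fin 2 → ℂ) : v ⬝ᵥ (matJ *ᵥ w) = -(w ⬝ᵥ (matJ *ᵥ v)) := by
  simp only [matJ, Matrix.mulVec, dotProduct, Fin.sum_univ_two]
  simp only [Matrix.of_apply, Matrix.cons_val_zero, Matrix.cons_val_one]
  ring

lemma wronskian_neg (σ : ℤˣ) :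
    wronskian l ψ (curvePoint l ψ (-σ) lam) = -wronskian l ψ (curvePoint l ψ σ lam) := by
  rw [← pairing_eq_wronskian hl ψ hlam σ 0, ← pairing_eq_wronskian hl ψ hlam (-σ) 0,
    dotProduct_matJ_comm, floquetPlus_curvePoint hl ψ hlam, floquetPlus_curvePoint hl ψ hlam,
    neg_neg]

lemma wronskian_one_ne_zero : wronskian l ψ (curvePoint l ψ 1 lam) ≠ 0 := by
  rw [← pairing_eq_wronskian hl ψ hlam 1 0, pairing_eq hl ψ hlam]
  exact mul_ne_zero (mul_ne_zero ((map_ne_zero _).2 (lower_ne_zero hl ψ (by simpa using hlam) 0))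
    (lower_ne_zero hl ψ hlam 0)) (one_sub_ratio_ne_zero hl ψ hlam 0)

lemma wronskian_ne_zero (σ : ℤˣ) : wronskian l ψ (curvePoint l ψ σ lam) ≠ 0 := by
  rcases Int.units_eq_one_or σ with rfl | rfl
  · exact wronskian_one_ne_zero hl ψ hlam
  · rw [wronskian_neg hl ψ hlam 1]
    exact neg_ne_zero.2 (wronskian_one_ne_zero hl ψ hlam)

end

/-! ### Variation of the Floquet solutions -/

/-- The quotient `e²(x) / e²(y)` on the sheet of `P₊`. -/
def growth (l : ℝ) (ψ : ℝ → ℂ) (lam : ℂ) (y x : ℝ) : ℂ :=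
  exp (I * lam / 2 * (x - y) + ∫ s in y..x, ψ s * ratio l ψ lam s)

lemma add_smul_apply {l : ℝ} (ψ X : Phase l) (t x : ℝ) :
    ((ψ + t • X : Phase l) : ℝ → ℂ) x = (ψ : ℝ → ℂ) x + t * (X : ℝ → ℂ) x := rfl

section

variable {l : ℝ} (hl : 0 < l) (ψ φ X : Phase l) {lam : ℂ} (hlam : lam.im ≠ 0)
include hl hlam

lemma continuous_mul_ratio : Continuous fun s => (ψ : ℝ → ℂ) s * ratio l ψ lam s :=
  (continuous_phase ψ).mul (continuous_ratio hl ψ hlam)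

lemma continuous_growth (y : ℝ) : Continuous (growth l ψ lam y) := by
  have h : growth l ψ lam y = fun x => (lower l ψ lam y)⁻¹ * lower l ψ lam x := by
    funext x
    rw [lower_eq_mul_exp hl ψ hlam y x, ← mul_assoc,
      inv_mul_cancel₀ (lower_ne_zero hl ψ hlam y), one_mul, growth]
  rw [h]
  exact continuous_const.mul (continuous_lower hl ψ hlam)

/-- Comparison of the ratios of two potentials: the function `(r - r̃) e² ẽ²` has a derivative
without a term linear in `r - r̃`, and it is multiplied by `w w̃` over a period. -/
lemma ratio_sub_ratio (y : ℝ) :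
    (multiplier l ψ 1 lam * multiplier l φ 1 lam - 1) * (ratio l ψ lam y - ratio l φ lam y) =
      ∫ x in y..(y + 2 * l), (conj ((ψ : ℝ → ℂ) x - (φ : ℝ → ℂ) x)
        - ((ψ : ℝ → ℂ) x - (φ : ℝ → ℂ) x) * ratio l ψ lam x * ratio l φ lam x)
        * (growth l ψ lam y x * growth l φ lam y x) := by
  set W : ℝ → ℂ := fun x =>
    (ratio l ψ lam x - ratio l φ lam x) * (lower l ψ lam x * lower l φ lam x) with hW
  have hd : ∀ x, HasDerivAt W ((conj ((ψ : ℝ → ℂ) x - (φ : ℝ → ℂ) x)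
      - ((ψ : ℝ → ℂ) x - (φ : ℝ → ℂ) x) * ratio l ψ lam x * ratio l φ lam x)
      * (lower l ψ lam x * lower l φ lam x)) x := fun x => by
    refine (((hasDerivAt_ratio hl ψ hlam x).sub (hasDerivAt_ratio hl φ hlam x)).mul
      ((hasDerivAt_lower hl ψ hlam x).mul (hasDerivAt_lower hl φ hlam x))).congr_deriv ?_
    simp only [map_sub, Pi.sub_apply, Pi.mul_apply]
    ring
  have c1 := continuous_ratio hl ψ hlam
  have c2 := continuous_ratio hl φ hlam
  have c3 := continuous_lower hl ψ hlam
  have c4 := continuous_lower hl φ hlam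
  have c5 := continuous_phase ψ
  have c6 := continuous_phase φ
  have hint := intervalIntegral.integral_eq_sub_of_hasDerivAt (fun x _ => hd x)
    (Continuous.intervalIntegrable (by fun_prop) y (y + 2 * l))
  simp only [hW, ratio_add_period hl _ hlam, lower_add_period hl _ hlam] at hint
  have h1 := lower_ne_zero hl ψ hlam y
  have h2 := lower_ne_zero hl φ hlam y
  refine mul_right_cancel₀ (mul_ne_zero h1 h2) ?_
  rw [← intervalIntegral.integral_mul_const]
  trans ∫ x in y..(y + 2 * l), (conj ((ψ : ℝ → ℂ) x - (φ : ℝ → ℂ) x)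
      - ((ψ : ℝ → ℂ) x - (φ : ℝ → ℂ) x) * ratio l ψ lam x * ratio l φ lam x)
      * (lower l ψ lam x * lower l φ lam x)
  · rw [hint]
    ring
  · refine intervalIntegral.integral_congr fun x _ => ?_
    rw [lower_eq_mul_exp hl ψ hlam y x, lower_eq_mul_exp hl φ hlam y x, growth, growth]
    ring

omit hlam in
/-- Two multipliers on the same sheet lie on the same side of the unit circle. -/
lemma abs_norm_sub_one_le {w w' : ℂ} (h : OnSheet l ψ 1 lam w) (h' : OnSheet l φ 1 lam w') :
    0 < |‖w‖ - 1| ∧ |‖w‖ - 1| ≤ ‖w' * w - 1‖ := by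
  have hw : 0 < ‖w‖ := by
    obtain ⟨e, he⟩ := (mem_spectralCurve_iff_exists hl).1 h.1
    exact norm_pos_iff.2 he.mult_ne_zero
  have hw' : 0 < ‖w'‖ := by
    obtain ⟨e, he⟩ := (mem_spectralCurve_iff_exists hl).1 h'.1
    exact norm_pos_iff.2 he.mult_ne_zero
  have h1 := h.2
  have h2 := h'.2
  simp only [Units.val_one, Int.cast_one, one_mul] at h1 h2
  have h3 : 0 < Real.log ‖w‖ * Real.log ‖w'‖ := by
    have : 0 < lam.im ^ 2 * (Real.log ‖w‖ * Real.log ‖w'‖) := by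
      have := mul_pos_of_neg_of_neg h1 h2
      linarith
    exact pos_of_mul_pos_right this (sq_nonneg _)
  have hn : |‖w'‖ * ‖w‖ - 1| ≤ ‖w' * w - 1‖ := by
    have := abs_norm_sub_norm_le (w' * w) 1
    rwa [norm_mul, norm_one] at this
  rcases pos_and_pos_or_neg_and_neg_of_mul_pos h3 with ⟨k1, k2⟩ | ⟨k1, k2⟩
  · have e1 := (Real.log_pos_iff hw.le).1 k1
    have e2 := (Real.log_pos_iff hw'.le).1 k2
    refine ⟨abs_pos.2 (by linarith), le_trans ?_ hn⟩
    rw [abs_of_pos (by linarith), abs_of_pos (by nlinarith)]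
    nlinarith
  · have e1 := (Real.log_neg_iff hw).1 k1
    have e2 := (Real.log_neg_iff hw').1 k2
    refine ⟨abs_pos.2 (by linarith), le_trans ?_ hn⟩
    rw [abs_of_neg (by linarith), abs_of_neg (by nlinarith)]
    nlinarith

lemma norm_growth_le {C : ℝ} (hC0 : 0 ≤ C) (hC : ∀ x, ‖(ψ : ℝ → ℂ) x‖ ≤ C) {y x : ℝ}
    (hx : x ∈ Set.uIoc y (y + 2 * l)) :
    ‖growth l ψ lam y x‖ ≤ Real.exp ((‖lam‖ / 2 + C) * (2 * l)) := by
  rw [Set.uIoc_of_le (by linarith)] at hx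
  have hxy : |x - y| ≤ 2 * l := by rw [abs_of_pos (by linarith [hx.1])]; linarith [hx.2]
  refine (norm_exp_le_exp_norm _).trans (Real.exp_le_exp.2 ((norm_add_le _ _).trans ?_))
  have h1 : ‖∫ s in y..x, (ψ : ℝ → ℂ) s * ratio l ψ lam s‖ ≤ C * |x - y| := by
    refine intervalIntegral.norm_integral_le_of_norm_le_const fun s _ => ?_
    rw [norm_mul]
    exact (mul_le_of_le_one_right (norm_nonneg _) (norm_ratio_lt hl ψ hlam s).le).trans (hC s)
  have h2 : ‖I * lam / 2 * ((x : ℂ) - y)‖ = ‖lam‖ / 2 * |x - y| := by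
    rw [← ofReal_sub, norm_mul, norm_div, norm_mul, norm_I, one_mul, norm_real, Real.norm_eq_abs]
    norm_num
  rw [h2, add_mul]
  gcongr
  exact h1.trans (by gcongr)

omit hlam in
lemma exists_bound_line : ∃ C, 0 ≤ C ∧ (∀ x, ‖(X : ℝ → ℂ) x‖ ≤ C) ∧
    ∀ t : ℝ, |t| ≤ 1 → ∀ x, ‖((ψ + t • X : Phase l) : ℝ → ℂ) x‖ ≤ C := by
  obtain ⟨A, hA0, hA⟩ := exists_bound_of_periodic (by positivity : 0 < 2 * l) (periodic_phase ψ)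
    (continuous_phase ψ)
  obtain ⟨B, hB0, hB⟩ := exists_bound_of_periodic (by positivity : 0 < 2 * l) (periodic_phase X)
    (continuous_phase X)
  refine ⟨A + B, by positivity, fun x => (hB x).trans (by linarith), fun t ht x => ?_⟩
  rw [add_smul_apply]
  refine (norm_add_le _ _).trans (add_le_add (hA x) ?_)
  rw [norm_mul, norm_real, Real.norm_eq_abs]
  exact (mul_le_of_le_one_left (norm_nonneg _) ht).trans (hB x)

/-- The ratio is Lipschitz continuous in the potential at `t = 0`, uniformly in `x`. -/
lemma exists_ratio_lipschitz : ∃ K, 0 ≤ K ∧ ∀ t : ℝ, |t| ≤ 1 → ∀ y,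
    ‖ratio l (ψ + t • X : Phase l) lam y - ratio l ψ lam y‖ ≤ K * |t| := by
  obtain ⟨C, hC0, hX, hC⟩ := exists_bound_line hl ψ X
  set B := Real.exp ((‖lam‖ / 2 + C) * (2 * l))
  set κ := |‖multiplier l ψ 1 lam‖ - 1|
  refine ⟨κ⁻¹ * ((2 * C) * (B * B) * (2 * l)), by positivity, fun t ht y => ?_⟩
  obtain ⟨hκ, hκ'⟩ := abs_norm_sub_one_le hl ψ (ψ + t • X)
    (onSheet_multiplier hl 1 hlam) (onSheet_multiplier hl 1 hlam)
  have h := ratio_sub_ratio hl (ψ + t • X) ψ hlam y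
  have hbound : ‖∫ x in y..(y + 2 * l), (conj (((ψ + t • X : Phase l) : ℝ → ℂ) x - (ψ : ℝ → ℂ) x)
      - (((ψ + t • X : Phase l) : ℝ → ℂ) x - (ψ : ℝ → ℂ) x)
        * ratio l (ψ + t • X : Phase l) lam x * ratio l ψ lam x)
      * (growth l (ψ + t • X : Phase l) lam y x * growth l ψ lam y x)‖
      ≤ |t| * ((2 * C) * (B * B)) * |y + 2 * l - y| := by
    refine intervalIntegral.norm_integral_le_of_norm_le_const fun x hx => ?_
    have b1 := norm_growth_le hl (ψ + t • X) hlam hC0 (hC t ht) hx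
    have b2 := norm_growth_le hl ψ hlam hC0 (fun x => by simpa using hC 0 (by simp) x) hx
    have b3 : ‖((ψ + t • X : Phase l) : ℝ → ℂ) x - (ψ : ℝ → ℂ) x‖ ≤ |t| * C := by
      rw [add_smul_apply, add_sub_cancel_left, norm_mul, norm_real, Real.norm_eq_abs]
      exact mul_le_mul_of_nonneg_left (hX x) (abs_nonneg t)
    have b4 := (norm_ratio_lt hl (ψ + t • X) hlam x).le
    have b5 := (norm_ratio_lt hl ψ hlam x).le
    rw [norm_mul, norm_mul]
    calc _ ≤ (|t| * C + |t| * C * 1 * 1) * (B * B) := by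
          gcongr
          refine (norm_sub_le _ _).trans ?_
          rw [norm_conj, norm_mul, norm_mul]
          gcongr
      _ = _ := by ring
  rw [← h, norm_mul, add_sub_cancel_left, abs_of_pos (by positivity : (0 : ℝ) < 2 * l)] at hbound
  have : κ * ‖ratio l (ψ + t • X : Phase l) lam y - ratio l ψ lam y‖ ≤ _ :=
    (mul_le_mul_of_nonneg_right hκ' (norm_nonneg _)).trans hbound
  rw [mul_assoc κ⁻¹, le_inv_mul_iff₀ hκ]
  linarith

lemma tendsto_ratio (y : ℝ) :
    Tendsto (fun t : ℝ => ratio l (ψ + t • X : Phase l) lam y) (𝓝 0) (𝓝 (ratio l ψ lam y)) := by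
  obtain ⟨K, -, hK⟩ := exists_ratio_lipschitz hl ψ X hlam
  rw [tendsto_iff_norm_sub_tendsto_zero]
  have h0 : Tendsto (fun t : ℝ => K * |t|) (𝓝 0) (𝓝 0) := by
    simpa using (tendsto_id (α := ℝ) (x := 𝓝 0)).abs.const_mul K
  refine squeeze_zero' (Eventually.of_forall fun t => norm_nonneg _) ?_ h0
  filter_upwards [Metric.closedBall_mem_nhds (0 : ℝ) one_pos] with t ht
  exact hK t (by simpa using ht) y

omit hl hlam in
lemma tendsto_line (x : ℝ) :
    Tendsto (fun t : ℝ => ((ψ + t • X : Phase l) : ℝ → ℂ) x) (𝓝 0) (𝓝 ((ψ : ℝ → ℂ) x)) := by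
  have : Continuous fun t : ℝ => (ψ : ℝ → ℂ) x + t * (X : ℝ → ℂ) x := by fun_prop
  simpa [add_smul_apply] using this.tendsto 0

lemma tendsto_integral_mul_ratio (a b : ℝ) :
    Tendsto (fun t : ℝ => ∫ s in a..b,
      ((ψ + t • X : Phase l) : ℝ → ℂ) s * ratio l (ψ + t • X : Phase l) lam s) (𝓝 0)
      (𝓝 (∫ s in a..b, (ψ : ℝ → ℂ) s * ratio l ψ lam s)) := by
  obtain ⟨C, hC0, hX, hC⟩ := exists_bound_line hl ψ X
  refine intervalIntegral.tendsto_integral_filter_of_dominated_convergence (fun _ => C) ?_ ?_ ?_ ?_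
  · exact Eventually.of_forall fun t =>
      (continuous_mul_ratio hl (ψ + t • X) hlam).aestronglyMeasurable
  · filter_upwards [Metric.closedBall_mem_nhds (0 : ℝ) one_pos] with t ht
    refine Eventually.of_forall fun s _ => ?_
    rw [norm_mul]
    exact (mul_le_of_le_one_right (norm_nonneg _) (norm_ratio_lt hl (ψ + t • X) hlam s).le).trans
      (hC t (by simpa using ht) s)
  · exact intervalIntegrable_const
  · exact Eventually.of_forall fun s _ => (tendsto_line ψ X s).mul (tendsto_ratio hl ψ X hlam s)

lemma tendsto_growth (y x : ℝ) :
    Tendsto (fun t : ℝ => growth l (ψ + t • X : Phase l) lam y x) (𝓝 0)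
      (𝓝 (growth l ψ lam y x)) :=
  ((tendsto_integral_mul_ratio hl ψ X hlam y x).const_add _).cexp

lemma tendsto_multiplier :
    Tendsto (fun t : ℝ => multiplier l (ψ + t • X : Phase l) 1 lam) (𝓝 0)
      (𝓝 (multiplier l ψ 1 lam)) := by
  rw [multiplier_eq_exp hl ψ hlam]
  simp_rw [fun t : ℝ => multiplier_eq_exp hl (ψ + t • X) hlam]
  exact ((tendsto_integral_mul_ratio hl ψ X hlam (-l) l).const_add _).cexp

end

/-- The variation `δr` of the ratio in the direction `δψ = X`: the periodic solution of the
linearized Riccati equation, in the closed form that is the limit of `ratio_sub_ratio`. -/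
def ratioVar (l : ℝ) (ψ X : ℝ → ℂ) (lam : ℂ) (y : ℝ) : ℂ :=
  (multiplier l ψ 1 lam ^ 2 - 1)⁻¹ * ∫ x in y..(y + 2 * l),
    (conj (X x) - X x * ratio l ψ lam x ^ 2) * growth l ψ lam y x ^ 2

section

variable {l : ℝ} (hl : 0 < l) (ψ X : Phase l) {lam : ℂ} (hlam : lam.im ≠ 0)
include hl hlam

/-- The two points over a nonreal `lam` are distinct. -/
lemma multiplier_sq_ne_one : multiplier l ψ 1 lam ^ 2 - 1 ≠ 0 := fun h => by
  have h1 := ((isFloquet_floquet hl (ψ := ψ) 1 hlam).isFloquetSol hl).sign hl hlam 0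
  rw [← norm_pow, sub_eq_zero.1 h] at h1
  simp at h1

lemma hasDerivAt_ratio_line (y : ℝ) :
    HasDerivAt (fun t : ℝ => ratio l (ψ + t • X : Phase l) lam y) (ratioVar l ψ X lam y) 0 := by
  rw [hasDerivAt_iff_tendsto_slope]
  set N : ℝ → ℂ := fun t => ∫ x in y..(y + 2 * l),
    (conj ((X : ℝ → ℂ) x) - (X : ℝ → ℂ) x * ratio l (ψ + t • X : Phase l) lam x
      * ratio l ψ lam x) * (growth l (ψ + t • X : Phase l) lam y x * growth l ψ lam y x) with hN
  have key : ∀ t : ℝ, t ≠ 0 → slope (fun t : ℝ => ratio l (ψ + t • X : Phase l) lam y) 0 t =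
      (multiplier l (ψ + t • X : Phase l) 1 lam * multiplier l ψ 1 lam - 1)⁻¹ * N t := by
    intro t ht
    have htc : (t : ℂ) ≠ 0 := by exact_mod_cast ht
    have h := ratio_sub_ratio hl (ψ + t • X) ψ hlam y
    obtain ⟨hκ, hκ'⟩ := abs_norm_sub_one_le hl ψ (ψ + t • X)
      (onSheet_multiplier hl 1 hlam) (onSheet_multiplier hl 1 hlam)
    have hne := norm_pos_iff.1 (hκ.trans_le hκ')
    rw [eq_inv_mul_iff_mul_eq₀ hne, slope_def_module, sub_zero, zero_smul, add_zero, real_smul,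
      mul_left_comm, h, ← intervalIntegral.integral_const_mul]
    refine intervalIntegral.integral_congr fun x _ => ?_
    simp only [add_smul_apply, add_sub_cancel_left, map_mul, conj_ofReal]
    push_cast
    field_simp
  have hlim : Tendsto N (𝓝 0) (𝓝 (∫ x in y..(y + 2 * l),
      (conj ((X : ℝ → ℂ) x) - (X : ℝ → ℂ) x * ratio l ψ lam x * ratio l ψ lam x)
        * (growth l ψ lam y x * growth l ψ lam y x))) := by
    obtain ⟨C, hC0, hX, hC⟩ := exists_bound_line hl ψ X
    set B := Real.exp ((‖lam‖ / 2 + C) * (2 * l))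
    refine intervalIntegral.tendsto_integral_filter_of_dominated_convergence
      (fun _ => (C + C * 1 * 1) * (B * B)) ?_ ?_ intervalIntegrable_const ?_
    · refine Eventually.of_forall fun t => Continuous.aestronglyMeasurable ?_
      have c1 := continuous_ratio hl ψ hlam
      have c2 := continuous_ratio hl (ψ + t • X) hlam
      have c3 := continuous_growth hl ψ hlam y
      have c4 := continuous_growth hl (ψ + t • X) hlam y
      have c5 := continuous_phase X
      fun_prop
    · filter_upwards [Metric.closedBall_mem_nhds (0 : ℝ) one_pos] with t ht
      refine Eventually.of_forall fun x hx => ?_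
      have ht' : |t| ≤ 1 := by simpa using ht
      have b1 := norm_growth_le hl (ψ + t • X) hlam hC0 (hC t ht') hx
      have b2 := norm_growth_le hl ψ hlam hC0 (fun x => by simpa using hC 0 (by simp) x) hx
      have b4 := (norm_ratio_lt hl (ψ + t • X) hlam x).le
      have b5 := (norm_ratio_lt hl ψ hlam x).le
      have b6 := hX x
      rw [norm_mul, norm_mul]
      gcongr
      refine (norm_sub_le _ _).trans ?_
      rw [norm_conj, norm_mul, norm_mul]
      gcongr
    · refine Eventually.of_forall fun x _ => ?_
      exact ((((tendsto_ratio hl ψ X hlam x).const_mul _).mul_const _).const_sub _).mul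
        ((tendsto_growth hl ψ X hlam y x).mul_const _)
  have hsq : multiplier l ψ 1 lam * multiplier l ψ 1 lam - 1 ≠ 0 := by
    simpa [sq] using multiplier_sq_ne_one hl ψ hlam
  have hw := (((tendsto_multiplier hl ψ X hlam).mul_const (multiplier l ψ 1 lam)).sub_const
    1).inv₀ hsq
  have hmain := (hw.mul hlim).mono_left (nhdsWithin_le_nhds (s := {(0 : ℝ)}ᶜ))
  have hval : ratioVar l ψ X lam y =
      (multiplier l ψ 1 lam * multiplier l ψ 1 lam - 1)⁻¹ * ∫ x in y..(y + 2 * l),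
      (conj ((X : ℝ → ℂ) x) - (X : ℝ → ℂ) x * ratio l ψ lam x * ratio l ψ lam x)
        * (growth l ψ lam y x * growth l ψ lam y x) := by
    simp only [ratioVar, sq, mul_assoc]
  rw [hval]
  refine hmain.congr' ?_
  filter_upwards [self_mem_nhdsWithin] with t ht
  exact (key t ht).symm

lemma ratioVar_add_period (x : ℝ) : ratioVar l ψ X lam (x + 2 * l) = ratioVar l ψ X lam x := by
  have h := hasDerivAt_ratio_line hl ψ X hlam (x + 2 * l)
  simp_rw [fun t : ℝ => ratio_add_period hl (ψ + t • X) hlam] at h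
  exact h.unique (hasDerivAt_ratio_line hl ψ X hlam x)

/-- The variation of the ratio solves the linearized Riccati equation. -/
lemma hasDerivAt_ratioVar (x : ℝ) : HasDerivAt (ratioVar l ψ X lam)
    (-(I * lam + 2 * (ψ : ℝ → ℂ) x * ratio l ψ lam x) * ratioVar l ψ X lam x
      + (conj ((X : ℝ → ℂ) x) - (X : ℝ → ℂ) x * ratio l ψ lam x ^ 2)) x := by
  set g : ℝ → ℂ := fun x =>
    (conj ((X : ℝ → ℂ) x) - (X : ℝ → ℂ) x * ratio l ψ lam x ^ 2) * lower l ψ lam x ^ 2 with hg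
  have hgc : Continuous g := by
    have c1 := continuous_ratio hl ψ hlam
    have c2 := continuous_lower hl ψ hlam
    have c3 := continuous_phase X
    fun_prop
  have hw := multiplier_sq_ne_one hl ψ hlam
  set w := multiplier l ψ 1 lam
  have hform : ratioVar l ψ X lam = fun y => (w ^ 2 - 1)⁻¹ *
      ((∫ x in (0 : ℝ)..(y + 2 * l), g x) - ∫ x in (0 : ℝ)..y, g x) / lower l ψ lam y ^ 2 := by
    funext y
    have hy := lower_ne_zero hl ψ hlam y
    rw [intervalIntegral.integral_interval_sub_left (hgc.intervalIntegrable _ _)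
      (hgc.intervalIntegrable _ _), ratioVar, mul_div_assoc, ← intervalIntegral.integral_div]
    congr 1
    refine intervalIntegral.integral_congr fun x _ => ?_
    simp only [hg]
    rw [lower_eq_mul_exp hl ψ hlam y x, growth]
    field_simp
  have hprim : ∀ y, HasDerivAt (fun y => ∫ x in (0 : ℝ)..y, g x) (g y) y := fun y =>
    intervalIntegral.integral_hasDerivAt_right (hgc.intervalIntegrable _ _)
      (hgc.stronglyMeasurableAtFilter _ _) hgc.continuousAt
  have hgp : g (x + 2 * l) = w ^ 2 * g x := by
    simp only [hg, periodic_phase, ratio_add_period hl ψ hlam, lower_add_period hl ψ hlam]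
    ring
  have hy := lower_ne_zero hl ψ hlam x
  have hval := congrFun hform x
  have hd := ((((hprim (x + 2 * l)).comp_add_const x (2 * l)).sub (hprim x)).const_mul
    (w ^ 2 - 1)⁻¹).div ((hasDerivAt_lower hl ψ hlam x).pow 2) (pow_ne_zero 2 hy)
  rw [hval, hform]
  refine hd.congr_deriv ?_
  rw [hgp]
  simp only [hg, Pi.pow_apply, Pi.sub_apply]
  field_simp
  ring

lemma continuous_ratioVar : Continuous (ratioVar l ψ X lam) :=
  continuous_iff_continuousAt.2 fun x => (hasDerivAt_ratioVar hl ψ X hlam x).continuousAt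

lemma hasDerivAt_integral_line (a b : ℝ) :
    HasDerivAt (fun t : ℝ => ∫ s in a..b,
      ((ψ + t • X : Phase l) : ℝ → ℂ) s * ratio l (ψ + t • X : Phase l) lam s)
      (∫ s in a..b, ((X : ℝ → ℂ) s * ratio l ψ lam s + (ψ : ℝ → ℂ) s * ratioVar l ψ X lam s))
      0 := by
  rw [hasDerivAt_iff_tendsto_slope]
  obtain ⟨C, hC0, hX, hC⟩ := exists_bound_line hl ψ X
  obtain ⟨K, hK0, hK⟩ := exists_ratio_lipschitz hl ψ X hlam
  have key : ∀ t : ℝ, slope (fun t : ℝ => ∫ s in a..b,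
      ((ψ + t • X : Phase l) : ℝ → ℂ) s * ratio l (ψ + t • X : Phase l) lam s) 0 t =
      ∫ s in a..b, slope (fun t : ℝ =>
        ((ψ + t • X : Phase l) : ℝ → ℂ) s * ratio l (ψ + t • X : Phase l) lam s) 0 t := by
    intro t
    simp only [slope_def_module]
    rw [intervalIntegral.integral_smul, intervalIntegral.integral_sub]
    · exact (continuous_mul_ratio hl (ψ + t • X) hlam).intervalIntegrable _ _
    · exact (continuous_mul_ratio hl (ψ + (0 : ℝ) • X) hlam).intervalIntegrable _ _
  rw [funext key]
  have hpt : ∀ s, HasDerivAt (fun t : ℝ =>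
      ((ψ + t • X : Phase l) : ℝ → ℂ) s * ratio l (ψ + t • X : Phase l) lam s)
      ((X : ℝ → ℂ) s * ratio l ψ lam s + (ψ : ℝ → ℂ) s * ratioVar l ψ X lam s) 0 := fun s => by
    have h1 : HasDerivAt (fun t : ℝ => ((ψ + t • X : Phase l) : ℝ → ℂ) s) ((X : ℝ → ℂ) s) 0 := by
      simp only [add_smul_apply]
      simpa using ((HasDerivAt.ofReal_comp (hasDerivAt_id (0 : ℝ))).mul_const
        ((X : ℝ → ℂ) s)).const_add ((ψ : ℝ → ℂ) s)
    refine (h1.mul (hasDerivAt_ratio_line hl ψ X hlam s)).congr_deriv ?_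
    simp
  refine intervalIntegral.tendsto_integral_filter_of_dominated_convergence
    (fun _ => C + C * K) ?_ ?_ intervalIntegrable_const ?_
  · refine Eventually.of_forall fun t => Continuous.aestronglyMeasurable ?_
    simp only [slope_def_module]
    exact ((continuous_mul_ratio hl (ψ + t • X) hlam).sub
      (continuous_mul_ratio hl (ψ + (0 : ℝ) • X) hlam)).const_smul _
  · filter_upwards [nhdsWithin_le_nhds (Metric.closedBall_mem_nhds (0 : ℝ) one_pos),
      self_mem_nhdsWithin] with t ht ht0
    refine Eventually.of_forall fun s _ => ?_
    have ht' : |t| ≤ 1 := by simpa using ht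
    have ht0' : 0 < |t| := abs_pos.2 ht0
    rw [slope_def_module, sub_zero, norm_smul, norm_inv, Real.norm_eq_abs, zero_smul, add_zero,
      inv_mul_le_iff₀ ht0']
    have b1 := hK t ht' s
    have b2 := (norm_ratio_lt hl (ψ + t • X) hlam s).le
    have b3 := hX s
    have b4 : ‖(ψ : ℝ → ℂ) s‖ ≤ C := by simpa using hC 0 (by simp) s
    calc _ = ‖t * (X : ℝ → ℂ) s * ratio l (ψ + t • X : Phase l) lam s
          + (ψ : ℝ → ℂ) s * (ratio l (ψ + t • X : Phase l) lam s - ratio l ψ lam s)‖ := by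
          rw [add_smul_apply]
          ring_nf
      _ ≤ |t| * C * 1 + C * (K * |t|) := by
          refine (norm_add_le _ _).trans ?_
          rw [norm_mul, norm_mul, norm_mul, norm_real, Real.norm_eq_abs]
          gcongr
      _ = _ := by ring
  · exact Eventually.of_forall fun s _ => hasDerivAt_iff_tendsto_slope.1 (hpt s)

end

/-- The logarithmic variation `δ log e²` on the sheet of `P₊`. The first term comes from the
normalization `e²(-l) (1 + r(-l)) = 1`. -/
def logVar (l : ℝ) (ψ X : ℝ → ℂ) (lam : ℂ) (x : ℝ) : ℂ :=
  -ratioVar l ψ X lam (-l) / (1 + ratio l ψ lam (-l)) +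
    ∫ s in (-l)..x, (X s * ratio l ψ lam s + ψ s * ratioVar l ψ X lam s)

section

variable {l : ℝ} (hl : 0 < l) (ψ X : Phase l) {lam : ℂ} (hlam : lam.im ≠ 0)
include hl hlam

lemma continuous_logVar : Continuous (logVar l ψ X lam) := by
  have c1 := continuous_ratio hl ψ hlam
  have c2 := continuous_ratioVar hl ψ X hlam
  have c3 := continuous_phase X
  have c4 := continuous_phase ψ
  refine continuous_const.add (intervalIntegral.continuous_primitive (fun a b => ?_) _)
  exact Continuous.intervalIntegrable (by fun_prop) _ _

lemma hasDerivAt_lower_line (x : ℝ) :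
    HasDerivAt (fun t : ℝ => lower l (ψ + t • X : Phase l) lam x)
      (lower l ψ lam x * logVar l ψ X lam x) 0 := by
  have hv0 : ∀ φ : Phase l, 1 + ratio l φ lam (-l) ≠ 0 := fun φ h => by
    simpa [h] using lower_norm hl φ hlam
  have hv : ∀ φ : Phase l, lower l φ lam x = (1 + ratio l φ lam (-l))⁻¹ *
      exp (I * lam / 2 * (x - (-l : ℝ)) + ∫ s in (-l)..x, (φ : ℝ → ℂ) s * ratio l φ lam s) :=
    fun φ => by
      rw [lower_eq_mul_exp hl φ hlam (-l) x, eq_inv_of_mul_eq_one_left (lower_norm hl φ hlam)]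
  rw [hv ψ]
  simp_rw [fun t : ℝ => hv (ψ + t • X)]
  have h1 := ((hasDerivAt_ratio_line hl ψ X hlam (-l)).const_add 1).inv
    (by simpa using hv0 ψ)
  have h2 := ((hasDerivAt_integral_line hl ψ X hlam (-l) x).const_add
    (I * lam / 2 * (x - (-l : ℝ)))).cexp
  refine (h1.mul h2).congr_deriv ?_
  have := hv0 ψ
  simp only [zero_smul, add_zero, logVar, Pi.inv_apply]
  field_simp

lemma hasDerivAt_floquetLine_one (x : ℝ) : HasDerivAt (floquetLine l ψ X 1 lam x)
    ![lower l ψ lam x * (ratioVar l ψ X lam x + ratio l ψ lam x * logVar l ψ X lam x),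
      lower l ψ lam x * logVar l ψ X lam x] 0 := by
  rw [hasDerivAt_pi, Fin.forall_fin_two]
  refine ⟨?_, hasDerivAt_lower_line hl ψ X hlam x⟩
  have h : (fun t : ℝ => floquetLine l ψ X 1 lam x t 0) = fun t : ℝ =>
      ratio l (ψ + t • X : Phase l) lam x * lower l (ψ + t • X : Phase l) lam x :=
    funext fun t => floquet_zero_eq hl (ψ + t • X) hlam x
  rw [h]
  refine ((hasDerivAt_ratio_line hl ψ X hlam x).mul
    (hasDerivAt_lower_line hl ψ X hlam x)).congr_deriv ?_
  simp only [zero_smul, add_zero, Matrix.cons_val_zero]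
  ring

lemma floquetVar_one (x : ℝ) : floquetVar l ψ X 1 lam x =
    ![lower l ψ lam x * (ratioVar l ψ X lam x + ratio l ψ lam x * logVar l ψ X lam x),
      lower l ψ lam x * logVar l ψ X lam x] :=
  (hasDerivAt_floquetLine_one hl ψ X hlam x).deriv

lemma floquetLine_neg_one (x : ℝ) : floquetLine l ψ X (-1) lam x = fun t =>
    ![conj (floquetLine l ψ X 1 (conj lam) x t 1),
      conj (floquetLine l ψ X 1 (conj lam) x t 0)] := by
  funext t
  have h := floquet_mirror hl (ψ := ψ + t • X) (lam := conj lam) 1 (by simpa using hlam)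
  rw [conj_conj] at h
  exact congrFun h x

lemma hasDerivAt_floquetLine_neg_one (x : ℝ) : HasDerivAt (floquetLine l ψ X (-1) lam x)
    ![conj (floquetVar l ψ X 1 (conj lam) x 1), conj (floquetVar l ψ X 1 (conj lam) x 0)] 0 := by
  have hlam' : (conj lam).im ≠ 0 := by simpa using hlam
  have h := hasDerivAt_floquetLine_one hl ψ X hlam' x
  rw [← floquetVar_one hl ψ X hlam', hasDerivAt_pi, Fin.forall_fin_two] at h
  rw [floquetLine_neg_one hl ψ X hlam, hasDerivAt_pi, Fin.forall_fin_two]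
  exact ⟨h.2.star, h.1.star⟩

lemma floquetVar_neg_one (x : ℝ) : floquetVar l ψ X (-1) lam x =
    ![conj (floquetVar l ψ X 1 (conj lam) x 1), conj (floquetVar l ψ X 1 (conj lam) x 0)] :=
  (hasDerivAt_floquetLine_neg_one hl ψ X hlam x).deriv

lemma differentiableAt_floquetLine (σ : ℤˣ) (x : ℝ) :
    DifferentiableAt ℝ (floquetLine l ψ X σ lam x) 0 := by
  rcases Int.units_eq_one_or σ with rfl | rfl
  · exact (hasDerivAt_floquetLine_one hl ψ X hlam x).differentiableAt
  · exact (hasDerivAt_floquetLine_neg_one hl ψ X hlam x).differentiableAt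

lemma continuous_floquetVar_one : Continuous (floquetVar l ψ X 1 lam) := by
  rw [funext (floquetVar_one hl ψ X hlam)]
  have c1 := continuous_ratio hl ψ hlam
  have c2 := continuous_ratioVar hl ψ X hlam
  have c3 := continuous_lower hl ψ hlam
  have c4 := continuous_logVar hl ψ X hlam
  refine continuous_pi fun i => ?_
  fin_cases i
  · exact c3.mul (c2.add (c1.mul c4))
  · exact c3.mul c4

lemma continuous_floquetVar (σ : ℤˣ) : Continuous (floquetVar l ψ X σ lam) := by
  rcases Int.units_eq_one_or σ with rfl | rfl
  · exact continuous_floquetVar_one hl ψ X hlam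
  · have c := continuous_floquetVar_one hl ψ X (lam := conj lam) (by simpa using hlam)
    rw [funext (floquetVar_neg_one hl ψ X hlam)]
    refine continuous_pi fun i => ?_
    fin_cases i
    · exact continuous_conj.comp ((continuous_apply 1).comp c)
    · exact continuous_conj.comp ((continuous_apply 0).comp c)

end

/-! ### Uniform asymptotics in double sectors -/

/-- The filter of `(lam, x)` with `lam → ∞` in a double sector and `x ∈ s`; a big-`O` along it is an
asymptotic bound that is uniform in `x`. -/
def region (ε : ℝ) (s : Set ℝ) : Filter (ℂ × ℝ) := sector ε ×ˢ 𝓟 s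

lemma eventually_sector {ε : ℝ} (hε : 0 < ε) (R : ℝ) :
    ∀ᶠ lam in sector ε, R ≤ ‖lam‖ ∧ ε * ‖lam‖ ≤ |lam.im| ∧ lam.im ≠ 0 := by
  have h1 : ∀ᶠ lam : ℂ in Bornology.cobounded ℂ, max R 1 ≤ ‖lam‖ :=
    tendsto_norm_cobounded_atTop.eventually_ge_atTop _
  filter_upwards [mem_inf_of_left h1,
    mem_inf_of_right (mem_principal_self {lam : ℂ | ε * ‖lam‖ ≤ |lam.im|})] with lam h2 h3
  change ε * ‖lam‖ ≤ |lam.im| at h3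
  refine ⟨(le_max_left _ _).trans h2, h3, fun h0 => ?_⟩
  have h4 : 1 ≤ ‖lam‖ := (le_max_right _ _).trans h2
  rw [h0, abs_zero] at h3
  nlinarith

lemma eventually_region {ε : ℝ} (hε : 0 < ε) (s : Set ℝ) (R : ℝ) :
    ∀ᶠ p in region ε s, (R ≤ ‖p.1‖ ∧ ε * ‖p.1‖ ≤ |p.1.im| ∧ p.1.im ≠ 0) ∧ p.2 ∈ s :=
  (eventually_sector hε R).prod_mk (mem_principal_self s)

lemma ne_zero_of_im {lam : ℂ} (h : lam.im ≠ 0) : lam ≠ 0 := fun h0 => h (by simp [h0])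

lemma region_mono (ε : ℝ) {s t : Set ℝ} (h : s ⊆ t) : region ε s ≤ region ε t :=
  prod_mono le_rfl (principal_mono.2 h)

lemma isBigO_inv_pow {ε : ℝ} (hε : 0 < ε) (s : Set ℝ) {m n : ℕ} (h : n ≤ m) :
    (fun p : ℂ × ℝ => p.1⁻¹ ^ m) =O[region ε s] fun p => p.1⁻¹ ^ n := by
  refine IsBigO.of_bound 1 ?_
  filter_upwards [eventually_region hε s 1] with p hp
  rw [one_mul, norm_pow, norm_pow, norm_inv]
  exact pow_le_pow_of_le_one (by positivity) (inv_le_one_of_one_le₀ hp.1.1) h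

lemma isBigO_coeff {l : ℝ} (hl : 0 < l) (ε : ℝ) {c : ℝ → ℂ} (hp : ∀ x, c (x + 2 * l) = c x)
    (hc : Continuous c) (s : Set ℝ) :
    (fun p : ℂ × ℝ => c p.2) =O[region ε s] fun p => p.1⁻¹ ^ 0 := by
  obtain ⟨C, -, hC⟩ := exists_bound_of_periodic (by positivity : 0 < 2 * l) hp hc
  exact IsBigO.of_bound C (Eventually.of_forall fun p => by simpa using hC p.2)

/-- A periodic solution of `f' = -b f + g` with `|Re b| ≥ κ` is bounded by `sup |g| / κ`: this is
the maximum principle for `|f|²`. -/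
lemma mul_norm_le_of_periodic_ode {c : ℝ} (hc : 0 < c) {f b g : ℝ → ℂ}
    (hp : ∀ x, f (x + c) = f x) (hd : ∀ x, HasDerivAt f (-b x * f x + g x) x) {κ G : ℝ}
    (hb : ∀ x, κ ≤ |(b x).re|) (hg : ∀ x, ‖g x‖ ≤ G) (x : ℝ) : κ * ‖f x‖ ≤ G := by
  have hG : 0 ≤ G := (norm_nonneg _).trans (hg 0)
  rcases le_or_gt κ 0 with hκ | hκ
  · exact (mul_nonpos_of_nonpos_of_nonneg hκ (norm_nonneg _)).trans hG
  have hcont : Continuous f := continuous_iff_continuousAt.2 fun x => (hd x).continuousAt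
  obtain ⟨x₀, -, hx₀⟩ := isCompact_Icc.exists_isMaxOn (Set.nonempty_Icc.2 hc.le)
    (hcont.norm.pow 2).continuousOn
  have hmax : ∀ x, ‖f x‖ ^ 2 ≤ ‖f x₀‖ ^ 2 := fun x => by
    obtain ⟨y, hy, hxy⟩ := Function.Periodic.exists_mem_Ico₀ (f := f) hp hc x
    rw [hxy]
    exact hx₀ (Set.Ico_subset_Icc_self hy)
  have hz : 2 * inner ℝ (f x₀) (-b x₀ * f x₀ + g x₀) = 0 :=
    IsLocalMax.hasDerivAt_eq_zero (f := fun x => ‖f x‖ ^ 2) (Eventually.of_forall hmax)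
      (hd x₀).norm_sq
  have h1 : (b x₀).re * ‖f x₀‖ ^ 2 = (conj (f x₀) * g x₀).re := by
    rw [Complex.inner] at hz
    rw [← Complex.normSq_eq_norm_sq, Complex.normSq_apply]
    simp only [mul_re, add_re, neg_re, neg_im, conj_re, conj_im, add_im, mul_im] at hz ⊢
    linear_combination -hz / 2
  have h2 : κ * ‖f x₀‖ ^ 2 ≤ ‖f x₀‖ * G := by
    calc κ * ‖f x₀‖ ^ 2 ≤ |(b x₀).re| * ‖f x₀‖ ^ 2 := by gcongr; exact hb x₀
      _ = |(conj (f x₀) * g x₀).re| := by rw [← h1, abs_mul, abs_of_nonneg (sq_nonneg ‖f x₀‖)]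
      _ ≤ ‖conj (f x₀) * g x₀‖ := abs_re_le_norm _
      _ ≤ ‖f x₀‖ * G := by
        rw [norm_mul, norm_conj]
        gcongr
        exact hg x₀
  have h3 : ‖f x‖ ≤ ‖f x₀‖ := le_of_sq_le_sq (hmax x) (norm_nonneg _)
  have h4 : κ * ‖f x₀‖ ≤ G := by
    rcases (norm_nonneg (f x₀)).eq_or_lt with h | h
    · rwa [← h, mul_zero]
    · exact le_of_mul_le_mul_left (by linarith) h
  exact (mul_le_mul_of_nonneg_left h3 hκ.le).trans h4

/-- In a double sector, periodic solutions of `ρ' = -(i lam + a) ρ + g` gain a power of `lam`. -/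
lemma isBigO_of_periodic_ode {ε l : ℝ} (hε : 0 < ε) (hl : 0 < l) {ρ a g : ℂ → ℝ → ℂ} {n : ℕ}
    (hp : ∀ lam : ℂ, lam.im ≠ 0 → ∀ x, ρ lam (x + 2 * l) = ρ lam x)
    (hd : ∀ lam : ℂ, lam.im ≠ 0 → ∀ x,
      HasDerivAt (ρ lam) (-(I * lam + a lam x) * ρ lam x + g lam x) x)
    (ha : (fun p : ℂ × ℝ => a p.1 p.2) =O[region ε Set.univ] fun p => p.1⁻¹ ^ 0)
    (hg : (fun p : ℂ × ℝ => g p.1 p.2) =O[region ε Set.univ] fun p => p.1⁻¹ ^ n) :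
    (fun p : ℂ × ℝ => ρ p.1 p.2) =O[region ε Set.univ] fun p => p.1⁻¹ ^ (n + 1) := by
  obtain ⟨A, hA⟩ := ha.bound
  obtain ⟨B, hB⟩ := hg.bound
  rw [region, eventually_prod_principal_iff] at hA hB
  refine IsBigO.of_bound (2 / ε * B) ?_
  rw [region, eventually_prod_principal_iff]
  filter_upwards [hA, hB, eventually_sector hε (max 1 (2 * A / ε))] with lam hA hB ⟨h1, h2, h3⟩ x _
  have hpos : 0 < ‖lam‖ := lt_of_lt_of_le one_pos ((le_max_left _ _).trans h1)
  have h4 : 2 * A ≤ ‖lam‖ * ε := (div_le_iff₀ hε).1 ((le_max_right _ _).trans h1)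
  have hb : ∀ x, ε / 2 * ‖lam‖ ≤ |(I * lam + a lam x).re| := fun x => by
    have k1 := hA x trivial
    simp only [pow_zero, norm_one, mul_one] at k1
    have k2 := (abs_re_le_norm (a lam x)).trans k1
    have k3 : (I * lam + a lam x).re = (a lam x).re - lam.im := by simp; ring
    have k4 := abs_sub_abs_le_abs_sub lam.im (a lam x).re
    rw [k3, abs_sub_comm]
    linarith
  have key := mul_norm_le_of_periodic_ode (by positivity : 0 < 2 * l) (hp lam h3)
    (b := fun x => I * lam + a lam x) (hd lam h3) hb (fun x => hB x trivial) x
  rw [norm_pow, norm_inv] at key ⊢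
  rw [pow_succ]
  calc ‖ρ lam x‖ = (ε / 2 * ‖lam‖ * ‖ρ lam x‖) * (2 / ε * ‖lam‖⁻¹) := by field_simp
    _ ≤ (B * ‖lam‖⁻¹ ^ n) * (2 / ε * ‖lam‖⁻¹) := by gcongr
    _ = _ := by ring

/-- The Cauchy product of two asymptotic expansions. -/
lemma isBigO_mul_expansion {ε : ℝ} {s : Set ℝ} {f g : ℂ × ℝ → ℂ} {c d : ℕ → ℝ → ℂ}
    {N : ℕ}
    (hc : ∀ k, (fun p : ℂ × ℝ => c k p.2) =O[region ε s] fun p => p.1⁻¹ ^ 0)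
    (hg0 : g =O[region ε s] fun p => p.1⁻¹ ^ 0)
    (hf : (fun p => f p - ∑ k ∈ Finset.range N, c k p.2 * p.1⁻¹ ^ k) =O[region ε s]
      fun p => p.1⁻¹ ^ N)
    (hg : ∀ n ≤ N, (fun p => g p - ∑ k ∈ Finset.range n, d k p.2 * p.1⁻¹ ^ k) =O[region ε s]
      fun p => p.1⁻¹ ^ n) :
    (fun p => f p * g p - ∑ k ∈ Finset.range N,
      (∑ j ∈ Finset.range (k + 1), c j p.2 * d (k - j) p.2) * p.1⁻¹ ^ k) =O[region ε s]
      fun p => p.1⁻¹ ^ N := by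
  have h1 : (fun p : ℂ × ℝ => f p * g p - ∑ k ∈ Finset.range N,
      (∑ j ∈ Finset.range (k + 1), c j p.2 * d (k - j) p.2) * p.1⁻¹ ^ k) = fun p =>
      (f p - ∑ k ∈ Finset.range N, c k p.2 * p.1⁻¹ ^ k) * g p +
      ∑ m ∈ Finset.range N, c m p.2 * p.1⁻¹ ^ m *
        (g p - ∑ k ∈ Finset.range (N - m), d k p.2 * p.1⁻¹ ^ k) := by
    funext p
    have h2 : ∑ k ∈ Finset.range N, (∑ j ∈ Finset.range (k + 1), c j p.2 * d (k - j) p.2) *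
        p.1⁻¹ ^ k = ∑ m ∈ Finset.range N, ∑ k ∈ Finset.range (N - m),
        c m p.2 * d k p.2 * p.1⁻¹ ^ (m + k) := by
      rw [← Finset.sum_range_diag_flip N fun m k => c m p.2 * d k p.2 * p.1⁻¹ ^ (m + k)]
      refine Finset.sum_congr rfl fun k _ => ?_
      rw [Finset.sum_mul]
      refine Finset.sum_congr rfl fun j hj => ?_
      rw [Nat.add_sub_cancel' (Nat.lt_succ_iff.1 (Finset.mem_range.1 hj))]
    rw [h2]
    simp only [mul_sub, Finset.sum_sub_distrib, sub_mul, Finset.sum_mul, Finset.mul_sum, pow_add]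
    have h3 : ∑ m ∈ Finset.range N, ∑ k ∈ Finset.range (N - m),
        c m p.2 * d k p.2 * (p.1⁻¹ ^ m * p.1⁻¹ ^ k) = ∑ m ∈ Finset.range N,
        ∑ k ∈ Finset.range (N - m), c m p.2 * p.1⁻¹ ^ m * (d k p.2 * p.1⁻¹ ^ k) :=
      Finset.sum_congr rfl fun m _ => Finset.sum_congr rfl fun k _ => by ring
    rw [h3]
    ring
  rw [h1]
  refine IsBigO.add ?_ (IsBigO.fun_sum fun m hm => ?_)
  · simpa using hf.mul hg0
  · have h2 := ((hc m).mul (isBigO_refl (fun p : ℂ × ℝ => p.1⁻¹ ^ m) _)).mul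
      (hg (N - m) (Nat.sub_le _ _))
    refine h2.trans_eventuallyEq (Eventually.of_forall fun p => ?_)
    simp only [pow_zero, one_mul]
    rw [← pow_add, Nat.add_sub_cancel' (Finset.mem_range.1 hm).le]

/-! ### Expansion of the ratio at infinity -/

lemma contDiff_deriv {f : ℝ → ℂ} (hf : ContDiff ℝ ∞ f) : ContDiff ℝ ∞ (deriv f) :=
  (contDiff_infty_iff_deriv.1 hf).2

lemma contDiff_conj {f : ℝ → ℂ} (hf : ContDiff ℝ ∞ f) : ContDiff ℝ ∞ fun x => conj (f x) :=
  conjCLE.contDiff.comp hf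

lemma hasDerivAt_of_contDiff {f : ℝ → ℂ} (hf : ContDiff ℝ ∞ f) (x : ℝ) :
    HasDerivAt f (deriv f x) x :=
  (hf.differentiable (by simp) x).hasDerivAt

lemma deriv_periodic {f : ℝ → ℂ} {c : ℝ} (hf : ∀ x, f (x + c) = f x) (x : ℝ) :
    deriv f (x + c) = deriv f x := by
  rw [← deriv_comp_add_const, funext hf]

lemma riccatiCoeff_zero (ψ : ℝ → ℂ) (x : ℝ) : riccatiCoeff ψ 0 x = 0 := by
  rw [riccatiCoeff]

lemma riccatiCoeff_one (ψ : ℝ → ℂ) (x : ℝ) : riccatiCoeff ψ 1 x = -I * conj (ψ x) := by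
  rw [riccatiCoeff]

lemma riccatiCoeff_add_two (ψ : ℝ → ℂ) (s : ℕ) (x : ℝ) : riccatiCoeff ψ (s + 2) x =
    I * (deriv (riccatiCoeff ψ (s + 1)) x + ψ x * ∑ j ∈ Finset.range (s + 2),
      riccatiCoeff ψ j x * riccatiCoeff ψ (s + 1 - j) x) := by
  rw [riccatiCoeff, Finset.sum_range]

/-- The recursion in the form in which it is the coefficient of `lam^{-k}` of the Riccati equation,
valid for all `k ≥ 0`. -/
lemma riccatiCoeff_succ (ψ : ℝ → ℂ) (k : ℕ) (x : ℝ) : -I * riccatiCoeff ψ (k + 1) x =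
    deriv (riccatiCoeff ψ k) x + ψ x * (∑ j ∈ Finset.range (k + 1),
      riccatiCoeff ψ j x * riccatiCoeff ψ (k - j) x) - if k = 0 then conj (ψ x) else 0 := by
  rcases k with _ | s
  · have h : riccatiCoeff ψ 0 = fun _ => 0 := funext (riccatiCoeff_zero ψ)
    simp only [zero_add, riccatiCoeff_one, h, deriv_const, Finset.sum_range_one, if_true]
    linear_combination conj (ψ x) * I_mul_I
  · rw [riccatiCoeff_add_two, if_neg (by simp)]
    linear_combination -(deriv (riccatiCoeff ψ (s + 1)) x + ψ x * ∑ j ∈ Finset.range (s + 2),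
      riccatiCoeff ψ j x * riccatiCoeff ψ (s + 1 - j) x) * I_mul_I

lemma riccatiCoeff_regular {l : ℝ} (ψ : Phase l) (k : ℕ) :
    ContDiff ℝ ∞ (riccatiCoeff ψ k) ∧ ∀ x, riccatiCoeff ψ k (x + 2 * l) = riccatiCoeff ψ k x := by
  induction k using Nat.strong_induction_on with
  | _ k ih =>
    match k, ih with
    | 0, _ =>
      rw [funext (riccatiCoeff_zero ψ)]
      exact ⟨contDiff_const, fun x => rfl⟩
    | 1, _ =>
      rw [funext (riccatiCoeff_one ψ)]
      exact ⟨contDiff_const.mul (contDiff_conj (contDiff_phase ψ)),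
        fun x => by simp only [periodic_phase]⟩
    | s + 2, ih =>
      rw [funext (riccatiCoeff_add_two ψ s)]
      constructor
      · refine contDiff_const.mul ((contDiff_deriv (ih _ (by omega)).1).add
          ((contDiff_phase ψ).mul (ContDiff.sum fun j hj => ?_)))
        rw [Finset.mem_range] at hj
        exact (ih _ hj).1.mul (ih _ (by omega)).1
      · intro x
        simp only [periodic_phase, deriv_periodic (ih (s + 1) (by omega)).2]
        congr 3
        refine Finset.sum_congr rfl fun j hj => ?_
        rw [Finset.mem_range] at hj
        rw [(ih _ hj).2, (ih _ (by omega)).2]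

section

variable {l : ℝ} (hl : 0 < l) (ψ X : Phase l) {ε : ℝ} (hε : 0 < ε)
include hl hε

lemma isBigO_ratio_zero : (fun p : ℂ × ℝ => ratio l ψ p.1 p.2) =O[region ε Set.univ]
    fun p => p.1⁻¹ ^ 0 := by
  refine IsBigO.of_bound 1 ?_
  filter_upwards [eventually_region hε Set.univ 1] with p hp
  simpa using (norm_ratio_lt hl ψ hp.1.2.2 p.2).le

omit hε in
lemma isBigO_riccatiCoeff (k : ℕ) (s : Set ℝ) :
    (fun p : ℂ × ℝ => riccatiCoeff ψ k p.2) =O[region ε s] fun p => p.1⁻¹ ^ 0 :=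
  isBigO_coeff hl ε (riccatiCoeff_regular ψ k).2 (riccatiCoeff_regular ψ k).1.continuous s

/-- The formal solution of the Riccati equation is the asymptotic expansion of the ratio. -/
theorem ratio_expansion (N : ℕ) :
    (fun p : ℂ × ℝ => ratio l ψ p.1 p.2 - ∑ k ∈ Finset.range N, riccatiCoeff ψ k p.2 * p.1⁻¹ ^ k)
      =O[region ε Set.univ] fun p => p.1⁻¹ ^ N := by
  induction N using Nat.strong_induction_on with
  | _ N ih =>
    rcases N with _ | N
    · simpa using isBigO_ratio_zero hl ψ hε
    · have hψ0 := isBigO_coeff hl ε (periodic_phase ψ) (continuous_phase ψ) Set.univ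
      have hmul := isBigO_mul_expansion (fun k => isBigO_riccatiCoeff hl ψ k Set.univ)
        (isBigO_ratio_zero hl ψ hε) (ih N (by omega)) (fun n hn => ih n (by omega))
      -- The remainder of order `N + 1` solves a linear equation whose source contains the square of
      -- the ratio only to order `N`.
      refine isBigO_of_periodic_ode hε hl (a := fun _ _ => 0)
        (ρ := fun lam x => ratio l ψ lam x - ∑ k ∈ Finset.range (N + 1),
          riccatiCoeff ψ k x * lam⁻¹ ^ k)
        (g := fun lam x => -((ψ : ℝ → ℂ) x * (ratio l ψ lam x * ratio l ψ lam x -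
          ∑ k ∈ Finset.range N, (∑ j ∈ Finset.range (k + 1),
            riccatiCoeff ψ j x * riccatiCoeff ψ (k - j) x) * lam⁻¹ ^ k))
          - deriv (riccatiCoeff ψ N) x * lam⁻¹ ^ N
          + if N = 0 then conj ((ψ : ℝ → ℂ) x) else 0) ?_ ?_ ?_ ?_
      · intro lam hlam x
        simp only [ratio_add_period hl ψ hlam, (riccatiCoeff_regular ψ _).2]
      · intro lam hlam x
        have hne := ne_zero_of_im hlam
        have h1 : ∀ k, HasDerivAt (fun x => riccatiCoeff ψ k x * lam⁻¹ ^ k)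
            (deriv (riccatiCoeff ψ k) x * lam⁻¹ ^ k) x := fun k =>
          (hasDerivAt_of_contDiff (riccatiCoeff_regular ψ k).1 x).mul_const _
        refine ((hasDerivAt_ratio hl ψ hlam x).sub
          (HasDerivAt.fun_sum fun k _ => h1 k)).congr_deriv ?_
        have h2 : I * lam * ∑ k ∈ Finset.range (N + 1), riccatiCoeff ψ k x * lam⁻¹ ^ k =
            - ∑ k ∈ Finset.range N, (deriv (riccatiCoeff ψ k) x + (ψ : ℝ → ℂ) x *
              (∑ j ∈ Finset.range (k + 1), riccatiCoeff ψ j x * riccatiCoeff ψ (k - j) x)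
              - if k = 0 then conj ((ψ : ℝ → ℂ) x) else 0) * lam⁻¹ ^ k := by
          rw [Finset.sum_range_succ', riccatiCoeff_zero, zero_mul, add_zero, Finset.mul_sum,
            ← Finset.sum_neg_distrib]
          refine Finset.sum_congr rfl fun k _ => ?_
          rw [← riccatiCoeff_succ, pow_succ]
          field_simp
        have h3 : ∑ k ∈ Finset.range N, (if k = 0 then conj ((ψ : ℝ → ℂ) x) else 0) * lam⁻¹ ^ k =
            conj ((ψ : ℝ → ℂ) x) - if N = 0 then conj ((ψ : ℝ → ℂ) x) else 0 := by
          rcases N with _ | N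
          · simp
          · simp
        simp only [sub_mul, add_mul, Finset.sum_sub_distrib, Finset.sum_add_distrib, h3] at h2
        simp only [mul_assoc, ← Finset.mul_sum] at h2
        simp only [Finset.sum_range_succ _ N] at h2 ⊢
        linear_combination -h2
      · exact isBigO_zero _ _
      · refine IsBigO.add (IsBigO.sub ?_ ?_) ?_
        · simpa using (hψ0.mul hmul).neg_left
        · simpa using (isBigO_coeff hl ε (deriv_periodic (riccatiCoeff_regular ψ N).2)
            (contDiff_deriv (riccatiCoeff_regular ψ N).1).continuous Set.univ).mul
            (isBigO_refl (fun p : ℂ × ℝ => p.1⁻¹ ^ N) (region ε Set.univ))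
        · rcases N with _ | N
          · simpa using (isBigO_coeff hl ε (c := fun x => conj ((ψ : ℝ → ℂ) x))
              (fun x => by rw [periodic_phase])
              (continuous_conj.comp (continuous_phase ψ)) Set.univ)
          · simpa using isBigO_zero _ _

lemma isBigO_ratio : (fun p : ℂ × ℝ => ratio l ψ p.1 p.2) =O[region ε Set.univ]
    fun p => p.1⁻¹ ^ 1 := by
  simpa [riccatiCoeff_zero] using ratio_expansion hl ψ hε 1

/-- The first two terms of the expansion of `δr`. -/
theorem ratioVar_expansion :
    (fun p : ℂ × ℝ => ratioVar l ψ X p.1 p.2 - (-I * conj ((X : ℝ → ℂ) p.2) * p.1⁻¹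
      + conj (deriv X p.2) * p.1⁻¹ ^ 2)) =O[region ε Set.univ] fun p => p.1⁻¹ ^ 3 := by
  have hX := contDiff_phase X
  have hX' := contDiff_deriv hX
  have pX' := deriv_periodic (periodic_phase X)
  have hψ0 := isBigO_coeff hl ε (periodic_phase ψ) (continuous_phase ψ) Set.univ
  have hX0 := isBigO_coeff hl ε (periodic_phase X) (continuous_phase X) Set.univ
  have hXc0 := isBigO_coeff hl ε (c := fun x => conj ((X : ℝ → ℂ) x))
    (fun x => by rw [periodic_phase]) (contDiff_conj hX).continuous Set.univ
  have hX'0 := isBigO_coeff hl ε (c := fun x => conj (deriv X x)) (fun x => by rw [pX'])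
    (contDiff_conj hX').continuous Set.univ
  have hX''0 := isBigO_coeff hl ε (c := fun x => conj (deriv (deriv X) x))
    (fun x => by rw [deriv_periodic pX'])
    (contDiff_conj (contDiff_deriv hX')).continuous Set.univ
  have hr0 := isBigO_ratio_zero hl ψ hε
  have hr1 := isBigO_ratio hl ψ hε
  have z1 := isBigO_refl (fun p : ℂ × ℝ => p.1⁻¹ ^ 1) (region ε Set.univ)
  have z2 := isBigO_refl (fun p : ℂ × ℝ => p.1⁻¹ ^ 2) (region ε Set.univ)
  refine isBigO_of_periodic_ode hε hl (n := 2)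
    (a := fun lam x => 2 * (ψ : ℝ → ℂ) x * ratio l ψ lam x)
    (ρ := fun lam x => ratioVar l ψ X lam x - (-I * conj ((X : ℝ → ℂ) x) * lam⁻¹
      + conj (deriv X x) * lam⁻¹ ^ 2))
    (g := fun lam x => (-2 * ((ψ : ℝ → ℂ) x * ratio l ψ lam x *
        (-I * (conj ((X : ℝ → ℂ) x) * lam⁻¹ ^ 1)))
      + -2 * ((ψ : ℝ → ℂ) x * ratio l ψ lam x * (conj (deriv X x) * lam⁻¹ ^ 2))
      - (X : ℝ → ℂ) x * (ratio l ψ lam x * ratio l ψ lam x))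
      - conj (deriv (deriv X) x) * lam⁻¹ ^ 2) ?_ ?_ ?_ ?_
  · intro lam hlam x
    simp only [ratioVar_add_period hl ψ X hlam, periodic_phase, pX']
  · intro lam hlam x
    have hne := ne_zero_of_im hlam
    refine ((hasDerivAt_ratioVar hl ψ X hlam x).sub
      (((hasDerivAt_of_contDiff hX x).star.const_mul (-I)).mul_const lam⁻¹ |>.add
      ((hasDerivAt_of_contDiff hX' x).star.mul_const (lam⁻¹ ^ 2)))).congr_deriv ?_
    simp only [← starRingEnd_apply]
    field_simp
    linear_combination (conj ((X : ℝ → ℂ) x) * lam ^ 2) * I_mul_I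
  · simpa [mul_assoc] using (hψ0.mul hr0).const_mul_left 2
  · refine ((IsBigO.add ?_ ?_).sub ?_).sub ?_
    · refine IsBigO.const_mul_left ?_ _
      refine ((hψ0.mul hr1).mul ((hXc0.mul z1).const_mul_left (-I))).trans_eventuallyEq
        (Eventually.of_forall fun p => ?_)
      ring
    · refine IsBigO.const_mul_left ?_ _
      refine ((hψ0.mul hr0).mul (hX'0.mul z2)).trans_eventuallyEq
        (Eventually.of_forall fun p => ?_)
      ring
    · refine (hX0.mul (hr1.mul hr1)).trans_eventuallyEq (Eventually.of_forall fun p => ?_)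
      ring
    · simpa using hX''0.mul z2

end

/-! ### Operations on uniform expansions -/

lemma tendsto_conj_sector (ε : ℝ) :
    Tendsto (fun lam : ℂ => conj lam) (sector ε) (sector ε) := by
  refine tendsto_inf.2 ⟨?_, ?_⟩
  · refine Tendsto.mono_left ?_ inf_le_left
    rw [← tendsto_norm_atTop_iff_cobounded]
    simpa using tendsto_norm_cobounded_atTop
  · refine tendsto_principal.2 (mem_inf_of_right fun lam h => ?_)
    change ε * ‖conj lam‖ ≤ |(conj lam).im|
    simpa using h

lemma isBigO_conj_region {ε : ℝ} {s : Set ℝ} {f : ℂ → ℝ → ℂ} {n : ℕ}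
    (hf : (fun p : ℂ × ℝ => f p.1 p.2) =O[region ε s] fun p => p.1⁻¹ ^ n) :
    (fun p : ℂ × ℝ => conj (f (conj p.1) p.2)) =O[region ε s] fun p => p.1⁻¹ ^ n := by
  have ht : Tendsto (fun p : ℂ × ℝ => (conj p.1, p.2)) (region ε s) (region ε s) :=
    (tendsto_conj_sector ε).prodMap tendsto_id
  have h := hf.comp_tendsto ht
  refine (isBigO_norm_right.1 ((isBigO_norm_left.1 (h.norm_norm.congr_left fun p => ?_)).congr_right
    fun p => ?_))
  · exact (norm_conj _).symm
  · simp

lemma isBigO_at_point {ε : ℝ} {f : ℂ → ℝ → ℂ} {n : ℕ} (y : ℝ) (s : Set ℝ)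
    (hf : (fun p : ℂ × ℝ => f p.1 p.2) =O[region ε Set.univ] fun p => p.1⁻¹ ^ n) :
    (fun p : ℂ × ℝ => f p.1 y) =O[region ε s] fun p => p.1⁻¹ ^ n := by
  have ht : Tendsto (fun p : ℂ × ℝ => (p.1, y)) (region ε s) (region ε Set.univ) := by
    refine tendsto_fst.prodMk ?_
    rw [principal_univ]
    exact tendsto_top
  exact hf.comp_tendsto ht

lemma isBigO_integral {ε l : ℝ} {f : ℂ → ℝ → ℂ} {n : ℕ}
    (hf : (fun p : ℂ × ℝ => f p.1 p.2) =O[region ε (Set.Icc (-l) l)] fun p => p.1⁻¹ ^ n) :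
    (fun p : ℂ × ℝ => ∫ s in (-l)..p.2, f p.1 s) =O[region ε (Set.Icc (-l) l)]
      fun p => p.1⁻¹ ^ n := by
  obtain ⟨C, hC0, hC⟩ := hf.exists_nonneg
  have hC := hC.bound
  rw [region, eventually_prod_principal_iff] at hC
  refine IsBigO.of_bound (C * (2 * l)) ?_
  rw [region, eventually_prod_principal_iff]
  filter_upwards [hC] with lam h x hx
  have h1 : ‖∫ s in (-l)..x, f lam s‖ ≤ C * ‖lam⁻¹ ^ n‖ * |x - -l| := by
    refine intervalIntegral.norm_integral_le_of_norm_le_const fun s hs => h s ?_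
    rw [Set.uIoc_of_le hx.1] at hs
    exact ⟨hs.1.le, hs.2.trans hx.2⟩
  refine h1.trans ?_
  have h2 : |x - -l| ≤ 2 * l := by
    rw [abs_of_nonneg (by linarith [hx.1])]
    linarith [hx.2]
  calc _ ≤ C * ‖lam⁻¹ ^ n‖ * (2 * l) := by gcongr
    _ = _ := by ring

lemma isBigO_avg {ε l : ℝ} (hl : 0 < l) {f : ℂ → ℝ → ℂ} {n : ℕ}
    (hf : (fun p : ℂ × ℝ => f p.1 p.2) =O[region ε (Set.Icc (-l) l)] fun p => p.1⁻¹ ^ n) :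
    (fun lam => avg l (f lam)) =O[sector ε] fun lam => lam⁻¹ ^ n := by
  have ht : Tendsto (fun lam : ℂ => (lam, l)) (sector ε) (region ε (Set.Icc (-l) l)) := by
    refine tendsto_id.prodMk (tendsto_principal.2 (Eventually.of_forall fun _ => ?_))
    exact ⟨by linarith, le_rfl⟩
  exact ((isBigO_integral hf).comp_tendsto ht).const_mul_left _

lemma avg_add {l : ℝ} {f g : ℝ → ℂ} (hf : Continuous f) (hg : Continuous g) :
    avg l (fun x => f x + g x) = avg l f + avg l g := by
  rw [avg, avg, avg, intervalIntegral.integral_add (hf.intervalIntegrable _ _)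
    (hg.intervalIntegrable _ _), mul_add]

lemma avg_const_mul (l : ℝ) (c : ℂ) (f : ℝ → ℂ) : avg l (fun x => c * f x) = c * avg l f := by
  rw [avg, avg, intervalIntegral.integral_const_mul, mul_left_comm]

lemma avg_sub {l : ℝ} {f g : ℝ → ℂ} (hf : Continuous f) (hg : Continuous g) :
    avg l (fun x => f x - g x) = avg l f - avg l g := by
  rw [avg, avg, avg, intervalIntegral.integral_sub (hf.intervalIntegrable _ _)
    (hg.intervalIntegrable _ _), mul_sub]

lemma avg_conj (l : ℝ) (f : ℝ → ℂ) : avg l (fun x => conj (f x)) = conj (avg l f) := by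
  simp only [avg, intervalIntegral, map_mul, map_inv₀, conj_ofReal, map_sub, integral_conj]

lemma avg_add_conj {l : ℝ} {f : ℝ → ℂ} (hf : Continuous f) :
    avg l f + conj (avg l f) = avg l fun x => f x + conj (f x) := by
  rw [avg_add hf (by fun_prop), avg_conj]

/-! ### The form `⟨e* J δV ∧ δe⟩` near the punctures -/

/-- The integrand of `⟨e* J δV ∧ δe⟩` on the sheet of `P₊`, multiplied by `1 - q r`. -/
def xiNumerator (l : ℝ) (ψ X Y : ℝ → ℂ) (lam : ℂ) (x : ℝ) : ℂ :=
  (X x * ratioVar l ψ Y lam x +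
    (X x * ratio l ψ lam x - dualRatio l ψ lam x * conj (X x)) * logVar l ψ Y lam x)
  - (Y x * ratioVar l ψ X lam x +
    (Y x * ratio l ψ lam x - dualRatio l ψ lam x * conj (Y x)) * logVar l ψ X lam x)

/-- The coefficient of `lam⁻¹` in the expansion of the integrand of `⟨e* J δV ∧ δe⟩`. -/
def xiCoeff₁ (X Y : ℝ → ℂ) (x : ℝ) : ℂ := -I * (X x * conj (Y x) - Y x * conj (X x))

/-- The coefficient of `lam⁻¹` in the expansion of `δ log e²`. -/
def logVarCoeff (l : ℝ) (ψ X : ℝ → ℂ) (x : ℝ) : ℂ :=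
  I * conj (X (-l)) - I * ∫ s in (-l)..x, densityVar ψ X s

/-- The coefficient of `lam⁻²` in the expansion of the integrand of `⟨e* J δV ∧ δe⟩`. -/
def xiCoeff₂ (l : ℝ) (ψ X Y : ℝ → ℂ) (x : ℝ) : ℂ :=
  (X x * conj (deriv Y x) + -I * densityVar ψ X x * logVarCoeff l ψ Y x)
  - (Y x * conj (deriv X x) + -I * densityVar ψ Y x * logVarCoeff l ψ X x)

section

variable {l : ℝ} (hl : 0 < l) (ψ X Y : Phase l) {lam : ℂ}

lemma continuous_densityVar : Continuous (densityVar ψ X) := by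
  have c1 := continuous_phase ψ
  have c2 := continuous_phase X
  unfold densityVar
  fun_prop

lemma continuous_logVarCoeff : Continuous (logVarCoeff l ψ X) :=
  continuous_const.sub (continuous_const.mul (intervalIntegral.continuous_primitive
    (fun a b => (continuous_densityVar ψ X).intervalIntegrable a b) _))

lemma continuous_xiCoeff₁ : Continuous (xiCoeff₁ X Y) := by
  have c1 := continuous_phase X
  have c2 := continuous_phase Y
  unfold xiCoeff₁
  fun_prop

lemma continuous_xiCoeff₂ : Continuous (xiCoeff₂ l ψ X Y) := by
  have c1 := continuous_phase X
  have c2 := continuous_phase Y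
  have c3 := continuous_densityVar ψ X
  have c4 := continuous_densityVar ψ Y
  have c5 := continuous_logVarCoeff ψ X
  have c6 := continuous_logVarCoeff ψ Y
  have c7 := (contDiff_deriv (contDiff_phase X)).continuous
  have c8 := (contDiff_deriv (contDiff_phase Y)).continuous
  unfold xiCoeff₂
  fun_prop

include hl

lemma xi_one (hlam : lam.im ≠ 0) : xi l ψ X Y 1 lam = avg l fun x =>
    xiNumerator l ψ X Y lam x / (1 - dualRatio l ψ lam x * ratio l ψ lam x) := by
  unfold xi
  congr 1
  funext x
  have h1 := lower_ne_zero hl ψ hlam x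
  have h2 : conj (lower l ψ (conj lam) x) ≠ 0 :=
    (map_ne_zero _).2 (lower_ne_zero hl ψ (by simpa using hlam) x)
  have h3 := one_sub_ratio_ne_zero hl ψ hlam x
  rw [floquetStar, ← pairing_eq_wronskian hl ψ hlam 1 x, pairing_eq hl ψ hlam,
    floquetPlus_curvePoint hl ψ hlam, floquet_neg_one hl ψ hlam, floquetVar_one hl ψ X hlam,
    floquetVar_one hl ψ Y hlam]
  simp only [matJ, matY, Matrix.mulVec, dotProduct, Fin.sum_univ_two, xiNumerator, Pi.smul_apply,
    Pi.sub_apply, Matrix.of_apply, Matrix.cons_val_zero, Matrix.cons_val_one, smul_eq_mul]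
  field_simp
  ring

lemma continuous_xiNumerator (hlam : lam.im ≠ 0) : Continuous (xiNumerator l ψ X Y lam) := by
  have c1 := continuous_phase X
  have c2 := continuous_phase Y
  have c3 := continuous_ratio hl ψ hlam
  have c4 := continuous_dualRatio hl ψ hlam
  have c5 := continuous_ratioVar hl ψ X hlam
  have c6 := continuous_ratioVar hl ψ Y hlam
  have c7 := continuous_logVar hl ψ X hlam
  have c8 := continuous_logVar hl ψ Y hlam
  unfold xiNumerator
  fun_prop

lemma matJ_pairing_mirror (σ : ℤˣ) (hlam : lam.im ≠ 0) (v : Fin 2 → ℂ) (x : ℝ) :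
    floquetPlus l ψ (curvePoint l ψ (-σ) (conj lam)) x ⬝ᵥ (matJ *ᵥ ![conj (v 1), conj (v 0)]) =
      -conj (floquetPlus l ψ (curvePoint l ψ σ lam) x ⬝ᵥ (matJ *ᵥ v)) := by
  rw [floquetPlus_curvePoint hl ψ hlam, floquetPlus_curvePoint hl ψ (by simpa using hlam),
    floquet_mirror hl (-σ) hlam, mirror]
  simp only [matJ, Matrix.mulVec, dotProduct, Fin.sum_univ_two, Matrix.of_apply,
    Matrix.cons_val_zero, Matrix.cons_val_one, map_add, map_mul, map_neg, map_one, map_zero]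
  ring

/-- The mirror symmetry expresses the form near `P₋` through the form near `P₊`. -/
lemma xi_neg_one (hlam : lam.im ≠ 0) :
    xi l ψ X Y (-1) lam = conj (xi l ψ X Y 1 (conj lam)) := by
  have hlam' : (conj lam).im ≠ 0 := by simpa using hlam
  unfold xi
  rw [← avg_conj]
  congr 1
  funext x
  have hΦ : wronskian l ψ (curvePoint l ψ (-1) lam) =
      -conj (wronskian l ψ (curvePoint l ψ 1 (conj lam))) := by
    have h := matJ_pairing_mirror hl ψ 1 hlam' (floquet l ψ (curvePoint l ψ 1 (conj lam)) x) x
    have h2 := floquet_mirror hl (ψ := ψ) 1 hlam'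
    rw [conj_conj] at h h2
    rw [← pairing_eq_wronskian hl ψ hlam (-1) x, ← pairing_eq_wronskian hl ψ hlam' 1 x, ← h, h2]
    rfl
  have h := matJ_pairing_mirror hl ψ 1 hlam' (matY X x *ᵥ floquetVar l ψ Y 1 (conj lam) x
    - matY Y x *ᵥ floquetVar l ψ X 1 (conj lam) x) x
  rw [conj_conj] at h
  rw [floquetStar, floquetStar, smul_dotProduct, smul_dotProduct, hΦ,
    floquetVar_neg_one hl ψ X hlam, floquetVar_neg_one hl ψ Y hlam, smul_eq_mul, smul_eq_mul,
    map_mul, map_inv₀,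
    ← neg_eq_iff_eq_neg.2 h, inv_neg, neg_mul, mul_neg]
  congr 4
  funext i
  fin_cases i <;> simp [matY, dotProduct, Fin.sum_univ_two] <;> ring

variable {ε : ℝ} (hε : 0 < ε)
include hε

lemma isBigO_ratio_sub : (fun p : ℂ × ℝ => ratio l ψ p.1 p.2 - -I * conj ((ψ : ℝ → ℂ) p.2) * p.1⁻¹)
    =O[region ε Set.univ] fun p => p.1⁻¹ ^ 2 := by
  simpa [Finset.sum_range_succ, riccatiCoeff_zero, riccatiCoeff_one] using
    ratio_expansion hl ψ hε 2

lemma isBigO_dualRatio_sub :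
    (fun p : ℂ × ℝ => dualRatio l ψ p.1 p.2 - I * (ψ : ℝ → ℂ) p.2 * p.1⁻¹)
      =O[region ε Set.univ] fun p => p.1⁻¹ ^ 2 := by
  refine (isBigO_conj_region
    (f := fun lam x => ratio l ψ lam x - -I * conj ((ψ : ℝ → ℂ) x) * lam⁻¹)
    (isBigO_ratio_sub hl ψ hε)).congr_left fun p => ?_
  simp [dualRatio, sub_eq_add_neg]

lemma isBigO_dualRatio : (fun p : ℂ × ℝ => dualRatio l ψ p.1 p.2) =O[region ε Set.univ]
    fun p => p.1⁻¹ ^ 1 :=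
  isBigO_conj_region (f := ratio l ψ) (isBigO_ratio hl ψ hε)

lemma isBigO_ratioVar_sub :
    (fun p : ℂ × ℝ => ratioVar l ψ X p.1 p.2 - -I * conj ((X : ℝ → ℂ) p.2) * p.1⁻¹)
      =O[region ε Set.univ] fun p => p.1⁻¹ ^ 2 := by
  have hX'0 := isBigO_coeff hl ε (c := fun x => conj (deriv X x))
    (fun x => by rw [deriv_periodic (periodic_phase X)])
    (contDiff_conj (contDiff_deriv (contDiff_phase X))).continuous Set.univ
  have h := ((ratioVar_expansion hl ψ X hε).trans
    (isBigO_inv_pow hε Set.univ (by norm_num : 2 ≤ 3))).add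
    ((hX'0.mul (isBigO_refl (fun p : ℂ × ℝ => p.1⁻¹ ^ 2) _)).trans_eventuallyEq
      (Eventually.of_forall fun p => by simp))
  refine h.congr_left fun p => ?_
  ring

omit hl in
lemma isBigO_of_sub {s : Set ℝ} {f : ℂ × ℝ → ℂ} {c : ℝ → ℂ}
    (hc : (fun p : ℂ × ℝ => c p.2) =O[region ε s] fun p => p.1⁻¹ ^ 0)
    (hf : (fun p => f p - c p.2 * p.1⁻¹) =O[region ε s] fun p => p.1⁻¹ ^ 2) :
    f =O[region ε s] fun p => p.1⁻¹ ^ 1 := by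
  have h := (hf.trans (isBigO_inv_pow hε s (by norm_num : 1 ≤ 2))).add
    ((hc.mul (isBigO_refl (fun p : ℂ × ℝ => p.1⁻¹ ^ 1) _)).trans_eventuallyEq
      (Eventually.of_forall fun p => by simp))
  refine h.congr_left fun p => ?_
  ring

omit hl hε in
lemma isBigO_coeff_Icc (ε : ℝ) {c : ℝ → ℂ} (hc : Continuous c) :
    (fun p : ℂ × ℝ => c p.2) =O[region ε (Set.Icc (-l) l)] fun p => p.1⁻¹ ^ 0 := by
  obtain ⟨C, hC⟩ := isCompact_Icc.exists_bound_of_continuousOn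
    (hc.continuousOn (s := Set.Icc (-l) l))
  refine IsBigO.of_bound C ?_
  rw [region, eventually_prod_principal_iff]
  exact Eventually.of_forall fun lam x hx => by simpa using hC x hx

/-- The first term of the expansion of `δ log e²`. -/
lemma isBigO_logVar_sub :
    (fun p : ℂ × ℝ => logVar l ψ X p.1 p.2 - logVarCoeff l ψ X p.2 * p.1⁻¹)
      =O[region ε (Set.Icc (-l) l)] fun p => p.1⁻¹ ^ 2 := by
  have hsub := region_mono ε (Set.subset_univ (Set.Icc (-l) l))
  have hη := isBigO_ratioVar_sub hl ψ X hε
  have hr := isBigO_ratio_sub hl ψ hε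
  have hψ0 := isBigO_coeff hl ε (periodic_phase ψ) (continuous_phase ψ) Set.univ
  have hX0 := isBigO_coeff hl ε (periodic_phase X) (continuous_phase X) Set.univ
  have hXc0 := isBigO_coeff hl ε (c := fun x => -I * conj ((X : ℝ → ℂ) x))
    (fun x => by rw [periodic_phase])
    (continuous_const.mul (contDiff_conj (contDiff_phase X)).continuous) Set.univ
  have hint := isBigO_integral (f := fun lam x => (X : ℝ → ℂ) x * (ratio l ψ lam x
      - -I * conj ((ψ : ℝ → ℂ) x) * lam⁻¹) + (ψ : ℝ → ℂ) x * (ratioVar l ψ X lam x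
      - -I * conj ((X : ℝ → ℂ) x) * lam⁻¹)) (n := 2)
    (((by simpa using hX0.mul hr :
      (fun p : ℂ × ℝ => _) =O[region ε Set.univ] fun p => p.1⁻¹ ^ 2).add
      (by simpa using hψ0.mul hη)).mono hsub)
  have hηl := isBigO_at_point
    (f := fun lam x => ratioVar l ψ X lam x - -I * conj ((X : ℝ → ℂ) x) * lam⁻¹)
    (-l) (Set.Icc (-l) l) hη
  have hη1l := isBigO_at_point (f := ratioVar l ψ X) (-l) (Set.Icc (-l) l)
    (isBigO_of_sub hε (c := fun x => -I * conj ((X : ℝ → ℂ) x)) hXc0 hη)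
  have hr1l := isBigO_at_point (f := ratio l ψ) (-l) (Set.Icc (-l) l) (isBigO_ratio hl ψ hε)
  have hinv : (fun p : ℂ × ℝ => (1 + ratio l ψ p.1 (-l))⁻¹) =O[region ε (Set.Icc (-l) l)]
      fun p => p.1⁻¹ ^ 0 := by
    obtain ⟨C, hC⟩ := hr1l.bound
    refine IsBigO.of_bound 2 ?_
    filter_upwards [hC, eventually_region hε (Set.Icc (-l) l) (max 1 (2 * C))] with p h1 h2
    have h3 : 0 < ‖p.1‖ := lt_of_lt_of_le one_pos ((le_max_left _ _).trans h2.1.1)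
    have h4 : ‖ratio l ψ p.1 (-l)‖ ≤ 1 / 2 := by
      refine h1.trans ?_
      rw [pow_one, norm_inv, ← div_eq_mul_inv, div_le_iff₀ h3]
      linarith [(le_max_right _ _).trans h2.1.1]
    have h5 : 1 / 2 ≤ ‖1 + ratio l ψ p.1 (-l)‖ := by
      have := norm_sub_norm_le (1 : ℂ) (-ratio l ψ p.1 (-l))
      rw [norm_one, norm_neg, sub_neg_eq_add] at this
      linarith
    rw [norm_inv, pow_zero, norm_one, mul_one]
    exact (inv_le_comm₀ (by linarith) two_pos).2 (by linarith)
  have h1 := (hηl.neg_left.add ((hinv.mul (hη1l.mul hr1l)).trans_eventuallyEq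
    (Eventually.of_forall fun p => by ring))).add hint
  refine h1.congr' ?_ EventuallyEq.rfl
  filter_upwards [eventually_region hε (Set.Icc (-l) l) 0] with p hp
  have hlam := hp.1.2.2
  have c1 := continuous_ratio hl ψ hlam
  have c2 := continuous_ratioVar hl ψ X hlam
  have c3 := continuous_phase X
  have c4 := continuous_phase ψ
  have hne : 1 + ratio l ψ p.1 (-l) ≠ 0 := fun h => by simpa [h] using lower_norm hl ψ hlam
  have hsplit : ∫ s in (-l)..p.2, ((X : ℝ → ℂ) s * (ratio l ψ p.1 s
      - -I * conj ((ψ : ℝ → ℂ) s) * p.1⁻¹) + (ψ : ℝ → ℂ) s * (ratioVar l ψ X p.1 s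
      - -I * conj ((X : ℝ → ℂ) s) * p.1⁻¹)) =
      (∫ s in (-l)..p.2, ((X : ℝ → ℂ) s * ratio l ψ p.1 s
        + (ψ : ℝ → ℂ) s * ratioVar l ψ X p.1 s))
      + I * p.1⁻¹ * ∫ s in (-l)..p.2, densityVar ψ X s := by
    rw [← intervalIntegral.integral_const_mul, ← intervalIntegral.integral_add]
    · refine intervalIntegral.integral_congr fun s _ => ?_
      simp only [densityVar]
      ring
    · exact Continuous.intervalIntegrable (by fun_prop) _ _
    · exact (continuous_const.mul (continuous_densityVar ψ X)).intervalIntegrable _ _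
  rw [hsplit, logVar, logVarCoeff]
  field_simp
  ring

/-- The first two terms of the expansion of the integrand of `⟨e* J δV ∧ δe⟩`. -/
lemma xiNumerator_expansion :
    (fun p : ℂ × ℝ => xiNumerator l ψ X Y p.1 p.2 / (1 - dualRatio l ψ p.1 p.2 * ratio l ψ p.1 p.2)
      - (xiCoeff₁ X Y p.2 * p.1⁻¹ + xiCoeff₂ l ψ X Y p.2 * p.1⁻¹ ^ 2))
      =O[region ε (Set.Icc (-l) l)] fun p => p.1⁻¹ ^ 3 := by
  have hsub := region_mono ε (Set.subset_univ (Set.Icc (-l) l))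
  have hr := (isBigO_ratio hl ψ hε).mono hsub
  have hq := (isBigO_dualRatio hl ψ hε).mono hsub
  have hhalf : ∀ Z W : Phase l, (fun p : ℂ × ℝ =>
      ((Z : ℝ → ℂ) p.2 * ratioVar l ψ W p.1 p.2 + ((Z : ℝ → ℂ) p.2 * ratio l ψ p.1 p.2
        - dualRatio l ψ p.1 p.2 * conj ((Z : ℝ → ℂ) p.2)) * logVar l ψ W p.1 p.2)
      - (-I * ((Z : ℝ → ℂ) p.2 * conj ((W : ℝ → ℂ) p.2)) * p.1⁻¹
        + ((Z : ℝ → ℂ) p.2 * conj (deriv W p.2)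
          + -I * densityVar ψ Z p.2 * logVarCoeff l ψ W p.2) * p.1⁻¹ ^ 2))
      =O[region ε (Set.Icc (-l) l)] fun p => p.1⁻¹ ^ 3 := by
    intro Z W
    have hZ := isBigO_coeff_Icc (l := l) ε (continuous_phase Z)
    have hZc := isBigO_coeff_Icc (l := l) ε (continuous_conj.comp (continuous_phase Z))
    have hb := isBigO_coeff_Icc (l := l) ε (c := fun x => -I * densityVar ψ Z x)
      (continuous_const.mul (continuous_densityVar ψ Z))
    have hm := isBigO_coeff_Icc (l := l) ε (continuous_logVarCoeff ψ W)
    have hη := (ratioVar_expansion hl ψ W hε).mono hsub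
    have hL := isBigO_logVar_sub hl ψ W hε
    have hL1 := isBigO_of_sub hε hm hL
    have hB := ((hZ.mul ((isBigO_ratio_sub hl ψ hε).mono hsub)).sub
      (hZc.mul ((isBigO_dualRatio_sub hl ψ hε).mono hsub)))
    have h1 := ((hZ.mul hη).trans_eventuallyEq (g₂ := fun p : ℂ × ℝ => p.1⁻¹ ^ 3)
      (Eventually.of_forall fun p => by ring)).add
      (((hB.mul hL1).trans_eventuallyEq (g₂ := fun p : ℂ × ℝ => p.1⁻¹ ^ 3)
        (Eventually.of_forall fun p => by ring)).add
      (((hb.mul (isBigO_refl (fun p : ℂ × ℝ => p.1⁻¹ ^ 1) _)).mul hL).trans_eventuallyEq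
        (g₂ := fun p : ℂ × ℝ => p.1⁻¹ ^ 3) (Eventually.of_forall fun p => by ring)))
    refine h1.congr_left fun p => ?_
    simp only [densityVar, Function.comp_apply]
    ring
  have hN : (fun p : ℂ × ℝ => xiNumerator l ψ X Y p.1 p.2
      - (xiCoeff₁ X Y p.2 * p.1⁻¹ + xiCoeff₂ l ψ X Y p.2 * p.1⁻¹ ^ 2))
      =O[region ε (Set.Icc (-l) l)] fun p => p.1⁻¹ ^ 3 := by
    refine ((hhalf X Y).sub (hhalf Y X)).congr_left fun p => ?_
    simp only [xiNumerator, xiCoeff₁, xiCoeff₂]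
    ring
  have hN1 : (fun p : ℂ × ℝ => xiNumerator l ψ X Y p.1 p.2)
      =O[region ε (Set.Icc (-l) l)] fun p => p.1⁻¹ ^ 1 := by
    have e1 := (isBigO_coeff_Icc (l := l) ε (continuous_xiCoeff₁ X Y)).mul
      (isBigO_refl (fun p : ℂ × ℝ => p.1⁻¹ ^ 1) (region ε (Set.Icc (-l) l)))
    have e2 := (isBigO_coeff_Icc (l := l) ε (continuous_xiCoeff₂ ψ X Y)).mul
      (isBigO_inv_pow hε (Set.Icc (-l) l) (by norm_num : 1 ≤ 2))
    refine ((hN.trans (isBigO_inv_pow hε _ (by norm_num : 1 ≤ 3))).add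
      ((e1.add e2).congr_right fun p => by simp)).congr_left fun p => ?_
    ring
  have hqr := hq.mul hr
  have hinv : (fun p : ℂ × ℝ => (1 - dualRatio l ψ p.1 p.2 * ratio l ψ p.1 p.2)⁻¹)
      =O[region ε (Set.Icc (-l) l)] fun p => p.1⁻¹ ^ 0 := by
    obtain ⟨C, hC⟩ := hr.bound
    refine IsBigO.of_bound 2 ?_
    filter_upwards [hC, eventually_region hε (Set.Icc (-l) l) (max 1 (2 * C))] with p h1 h2
    have h3 : 0 < ‖p.1‖ := lt_of_lt_of_le one_pos ((le_max_left _ _).trans h2.1.1)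
    have h4 : ‖ratio l ψ p.1 p.2‖ ≤ 1 / 2 := by
      refine h1.trans ?_
      rw [pow_one, norm_inv, ← div_eq_mul_inv, div_le_iff₀ h3]
      linarith [(le_max_right _ _).trans h2.1.1]
    have h6 : ‖dualRatio l ψ p.1 p.2 * ratio l ψ p.1 p.2‖ ≤ 1 / 2 := by
      rw [norm_mul]
      exact (mul_le_of_le_one_left (norm_nonneg _)
        (norm_dualRatio_lt hl ψ h2.1.2.2 p.2).le).trans h4
    have h5 := norm_sub_norm_le (1 : ℂ) (dualRatio l ψ p.1 p.2 * ratio l ψ p.1 p.2)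
    rw [norm_one] at h5
    rw [norm_inv, pow_zero, norm_one, mul_one]
    exact (inv_le_comm₀ (by linarith) two_pos).2 (by linarith)
  have hfin := hN.add ((hN1.mul (hqr.mul hinv)).trans_eventuallyEq
    (g₂ := fun p : ℂ × ℝ => p.1⁻¹ ^ 3) (Eventually.of_forall fun p => by ring))
  refine hfin.congr' ?_ EventuallyEq.rfl
  filter_upwards [eventually_region hε (Set.Icc (-l) l) 0] with p hp
  have hne := one_sub_ratio_ne_zero hl ψ hp.1.2.2 p.2
  field_simp
  ring

/-- The expansion at `P₊` of the form, of which `xiCoeff₁` and `xiCoeff₂` give the residues. -/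
lemma xi_one_expansion :
    (fun lam => xi l ψ X Y 1 lam - (avg l (xiCoeff₁ X Y) * lam⁻¹
      + avg l (xiCoeff₂ l ψ X Y) * lam⁻¹ ^ 2)) =O[sector ε] fun lam => lam⁻¹ ^ 3 := by
  have h := isBigO_avg hl (f := fun lam x => xiNumerator l ψ X Y lam x /
      (1 - dualRatio l ψ lam x * ratio l ψ lam x)
      - (xiCoeff₁ X Y x * lam⁻¹ + xiCoeff₂ l ψ X Y x * lam⁻¹ ^ 2))
    (xiNumerator_expansion hl ψ X Y hε)
  refine h.congr' ?_ EventuallyEq.rfl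
  filter_upwards [eventually_sector hε 0] with lam hlam
  have hne := one_sub_ratio_ne_zero hl ψ hlam.2.2
  have c1 := continuous_xiNumerator hl ψ X Y hlam.2.2
  have c2 := continuous_ratio hl ψ hlam.2.2
  have c3 := continuous_dualRatio hl ψ hlam.2.2
  have c4 := continuous_xiCoeff₁ X Y
  have c5 := continuous_xiCoeff₂ ψ X Y
  have c6 : Continuous fun x => xiNumerator l ψ X Y lam x /
      (1 - dualRatio l ψ lam x * ratio l ψ lam x) := c1.div (by fun_prop) hne
  rw [avg_sub c6 (by fun_prop), avg_add (by fun_prop) (by fun_prop), xi_one hl ψ X Y hlam.2.2]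
  simp only [mul_comm _ (lam⁻¹), mul_comm _ (lam⁻¹ ^ 2), avg_const_mul]

end

/-! ### Residues at infinity -/

lemma tendsto_I_mul_sector : Tendsto (fun t : ℝ => I * (t : ℂ)) atTop (sector 1) := by
  refine tendsto_inf.2 ⟨?_, tendsto_principal.2 (Eventually.of_forall fun t => ?_)⟩
  · rw [← tendsto_norm_atTop_iff_cobounded]
    simpa using tendsto_abs_atTop_atTop
  · change 1 * ‖I * (t : ℂ)‖ ≤ |(I * (t : ℂ)).im|
    simp

/-- The polynomial part and the residue are determined along the imaginary axis. -/
lemma HasResidue.unique {f : ℂ → ℂ} {c c' : ℂ} (h : HasResidue f c) (h' : HasResidue f c') :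
    c = c' := by
  obtain ⟨P, hP⟩ := h
  obtain ⟨P', hP'⟩ := h'
  have h1 := ((hP' 1 one_pos).sub (hP 1 one_pos)).comp_tendsto tendsto_I_mul_sector
  set T : Polynomial ℂ := Polynomial.X * (P - P') + Polynomial.C (c - c') with hT
  have h2 : Tendsto (fun t : ℝ => T.eval (I * (t : ℂ))) atTop (𝓝 0) := by
    refine h1.tendsto_div_nhds_zero.congr' ?_
    filter_upwards [eventually_gt_atTop 0] with t ht
    have : (t : ℂ) ≠ 0 := by exact_mod_cast ht.ne'
    simp only [hT, Function.comp_apply, Polynomial.eval_add, Polynomial.eval_mul,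
      Polynomial.eval_X, Polynomial.eval_sub, Polynomial.eval_C]
    field_simp [I_ne_zero]
    ring
  have hdeg : T.degree ≤ 0 := by
    by_contra! hd
    refine not_tendsto_nhds_of_tendsto_atTop (T.tendsto_norm_atTop hd (l := atTop)
      (z := fun t : ℝ => I * (t : ℂ)) ?_) _ h2.norm
    simpa using tendsto_abs_atTop_atTop
  rw [Polynomial.eq_C_of_degree_le_zero hdeg] at h2
  simp only [Polynomial.eval_C] at h2
  have h3 := tendsto_nhds_unique tendsto_const_nhds h2
  simp only [hT, Polynomial.coeff_add, Polynomial.mul_coeff_zero, Polynomial.coeff_X_zero, zero_mul,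
    zero_add, Polynomial.coeff_C_zero] at h3
  exact sub_eq_zero.1 h3

lemma HasResidue.residue_eq {f : ℂ → ℂ} {c : ℂ} (h : HasResidue f c) : residue f = c :=
  (Classical.epsilon_spec (p := HasResidue f) ⟨c, h⟩ : HasResidue f (residue f)).unique h

lemma isLittleO_of_isBigO_sq {ε : ℝ} {f : ℂ → ℂ}
    (h : f =O[sector ε] fun lam => lam⁻¹ ^ 2) : f =o[sector ε] fun lam => lam⁻¹ := by
  refine h.trans_isLittleO ?_
  have h1 : Tendsto (fun lam : ℂ => lam⁻¹) (sector ε) (𝓝 0) :=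
    tendsto_inv₀_cobounded.mono_left inf_le_left
  have h2 := (isBigO_refl (fun lam : ℂ => lam⁻¹) (sector ε)).mul_isLittleO
    ((isLittleO_one_iff ℂ).2 h1)
  simpa [sq] using h2

/-- Residues of `f` and of `lam f` for `f = a / lam + b / lam² + O(lam⁻³)`. -/
lemma hasResidue_of_expansion {f : ℂ → ℂ} {a b : ℂ}
    (h : ∀ ε : ℝ, 0 < ε → (fun lam => f lam - (a * lam⁻¹ + b * lam⁻¹ ^ 2)) =O[sector ε]
      fun lam => lam⁻¹ ^ 3) :
    HasResidue (fun lam => lam ^ 0 * f lam) a ∧ HasResidue (fun lam => lam ^ 1 * f lam) b := by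
  constructor
  · refine ⟨0, fun ε hε => isLittleO_of_isBigO_sq ?_⟩
    have h1 : (fun lam : ℂ => lam⁻¹ ^ 3) =O[sector ε] fun lam => lam⁻¹ ^ 2 := by
      refine IsBigO.of_bound 1 ?_
      filter_upwards [eventually_sector hε 1] with lam hlam
      rw [one_mul, norm_pow, norm_pow, norm_inv]
      exact pow_le_pow_of_le_one (by positivity) (inv_le_one_of_one_le₀ hlam.1) (by norm_num)
    refine (((h ε hε).trans h1).add ((isBigO_refl (fun lam : ℂ => lam⁻¹ ^ 2)
      (sector ε)).const_mul_left b)).congr_left fun lam => ?_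
    simp only [pow_zero, one_mul, Polynomial.eval_zero, div_eq_mul_inv]
    ring
  · refine ⟨Polynomial.C a, fun ε hε => isLittleO_of_isBigO_sq ?_⟩
    refine ((isBigO_refl (fun lam : ℂ => lam) (sector ε)).mul (h ε hε)).congr' ?_ ?_
    · filter_upwards [eventually_sector hε 0] with lam hlam
      have := ne_zero_of_im hlam.2.2
      rw [Polynomial.eval_C]
      field_simp
      ring
    · filter_upwards [eventually_sector hε 0] with lam hlam
      have := ne_zero_of_im hlam.2.2
      field_simp

section

variable {l : ℝ} (hl : 0 < l) (ψ X Y : Phase l)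
include hl

lemma xi_neg_one_expansion {ε : ℝ} (hε : 0 < ε) :
    (fun lam => xi l ψ X Y (-1) lam - (conj (avg l (xiCoeff₁ X Y)) * lam⁻¹
      + conj (avg l (xiCoeff₂ l ψ X Y)) * lam⁻¹ ^ 2)) =O[sector ε] fun lam => lam⁻¹ ^ 3 := by
  have h := (xi_one_expansion hl ψ X Y hε).comp_tendsto (tendsto_conj_sector ε)
  refine (isBigO_norm_left.1 (h.norm_left.congr' ?_ EventuallyEq.rfl)).trans
    (IsBigO.of_bound 1 (Eventually.of_forall fun lam => by simp))
  filter_upwards [eventually_sector hε 0] with lam hlam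
  rw [xi_neg_one hl ψ X Y hlam.2.2, ← norm_conj]
  simp

/-- The residues at the punctures `P₊` and `P₋`. -/
lemma hasResidue_xi {n : ℕ} (hn : n ≤ 1) {a : ℂ}
    (ha : a = if n = 0 then avg l (xiCoeff₁ X Y) else avg l (xiCoeff₂ l ψ X Y)) :
    HasResidue (fun lam => lam ^ n * xi l ψ X Y 1 lam) a ∧
    HasResidue (fun lam => lam ^ n * xi l ψ X Y (-1) lam) (conj a) := by
  have h1 := hasResidue_of_expansion fun ε hε => xi_one_expansion hl ψ X Y (ε := ε) hε
  have h2 := hasResidue_of_expansion fun ε hε => xi_neg_one_expansion hl ψ X Y (ε := ε) hε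
  interval_cases n
  · rw [if_pos rfl] at ha
    exact ⟨ha ▸ h1.1, ha ▸ h2.1⟩
  · rw [if_neg one_ne_zero] at ha
    exact ⟨ha ▸ h1.2, ha ▸ h2.2⟩

lemma existsUnique_hasResidue_xi (σ : ℤˣ) {n : ℕ} (hn : n ≤ 1) :
    ∃! c, HasResidue (fun lam => lam ^ n * xi l ψ X Y σ lam) c := by
  obtain ⟨h1, h2⟩ := hasResidue_xi hl ψ X Y hn rfl
  rcases Int.units_eq_one_or σ with rfl | rfl
  · exact ⟨_, h1, fun c hc => hc.unique h1⟩
  · exact ⟨_, h2, fun c hc => hc.unique h2⟩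

/-- By the mirror symmetry, the residues at the two punctures are complex conjugate. -/
lemma omega_eq {n : ℕ} (hn : n ≤ 1) {a : ℂ}
    (ha : a = if n = 0 then avg l (xiCoeff₁ X Y) else avg l (xiCoeff₂ l ψ X Y)) :
    omega l n ψ X Y = a + conj a := by
  obtain ⟨h1, h2⟩ := hasResidue_xi hl ψ X Y hn ha
  have hu : (Finset.univ : Finset ℤˣ) = {1, -1} := by decide
  rw [omega, hu, Finset.sum_pair (by decide), h1.residue_eq, h2.residue_eq]

theorem omega_zero_eq : omega l 0 ψ X Y =
    2 * I * avg l fun x => conj ((X : ℝ → ℂ) x) * (Y : ℝ → ℂ) x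
      - conj ((Y : ℝ → ℂ) x) * (X : ℝ → ℂ) x := by
  have c1 := continuous_phase X
  have c2 := continuous_phase Y
  rw [omega_eq hl ψ X Y zero_le_one rfl, if_pos rfl,
    avg_add_conj (continuous_xiCoeff₁ X Y), ← avg_const_mul]
  congr 1
  funext x
  simp only [xiCoeff₁, map_mul, map_sub, map_neg, conj_I, conj_conj]
  ring

/-- On variations that preserve `∫ |ψ|²`, the boundary terms of `δ log e²` drop out of `ω₁`. -/
theorem omega_one_eq (hX : avg l (densityVar ψ X) = 0) (hY : avg l (densityVar ψ Y) = 0) :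
    omega l 1 ψ X Y = avg l fun x =>
      ((X : ℝ → ℂ) x * conj (deriv Y x) - (Y : ℝ → ℂ) x * conj (deriv X x))
        + (conj ((X : ℝ → ℂ) x) * deriv Y x - conj ((Y : ℝ → ℂ) x) * deriv X x)
        + 2 * ((∫ s in (-l)..x, densityVar ψ X s) * densityVar ψ Y x
          - (∫ s in (-l)..x, densityVar ψ Y s) * densityVar ψ X x) := by
  have c1 := continuous_phase X
  have c2 := continuous_phase Y
  have c3 := continuous_densityVar ψ X
  have c4 := continuous_densityVar ψ Y
  have c7 := (contDiff_deriv (contDiff_phase X)).continuous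
  have c8 := (contDiff_deriv (contDiff_phase Y)).continuous
  have c9 := intervalIntegral.continuous_primitive
    (fun a b => c3.intervalIntegrable (μ := MeasureTheory.volume) a b) (-l)
  have c10 := intervalIntegral.continuous_primitive
    (fun a b => c4.intervalIntegrable (μ := MeasureTheory.volume) a b) (-l)
  set B : ℝ → ℂ := fun x => (X : ℝ → ℂ) x * conj (deriv Y x) - (Y : ℝ → ℂ) x * conj (deriv X x)
    + ((∫ s in (-l)..x, densityVar ψ X s) * densityVar ψ Y x
      - (∫ s in (-l)..x, densityVar ψ Y s) * densityVar ψ X x) with hB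
  have cB : Continuous B := by fun_prop
  have h1 : avg l (xiCoeff₂ l ψ X Y) = avg l B := by
    have : xiCoeff₂ l ψ X Y = fun x => B x + (conj ((Y : ℝ → ℂ) (-l)) * densityVar ψ X x
        - conj ((X : ℝ → ℂ) (-l)) * densityVar ψ Y x) := by
      funext x
      simp only [xiCoeff₂, logVarCoeff, hB]
      ring_nf
      simp only [I_sq]
      ring
    rw [this, avg_add cB (by fun_prop), avg_sub (by fun_prop) (by fun_prop), avg_const_mul,
      avg_const_mul, hX, hY]
    simp
  have hreal : ∀ Z : Phase l, ∀ x, conj (densityVar ψ Z x) = densityVar ψ Z x := fun Z x => by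
    simp only [densityVar, map_add, map_mul, conj_conj]
    ring
  have hint : ∀ Z : Phase l, ∀ x : ℝ, conj (∫ s in (-l)..x, densityVar ψ Z s) =
      ∫ s in (-l)..x, densityVar ψ Z s := fun Z x => by
    simp only [intervalIntegral, map_sub, ← integral_conj, hreal]
  rw [omega_eq hl ψ X Y le_rfl rfl, if_neg one_ne_zero, h1, avg_add_conj cB]
  congr 1
  funext x
  simp only [hB, map_add, map_sub, map_mul, conj_conj, hreal, hint]
  ring

end

/-! ### Laurent expansions at infinity -/

/-- Taylor's formula with a holomorphic remainder, by repeated division by `z`. -/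
lemma exists_taylor_remainder {G : ℂ → ℂ} {s : Set ℂ} (hs : s ∈ 𝓝 (0 : ℂ))
    (hG : DifferentiableOn ℂ G s) (n : ℕ) :
    ∃ (c : ℕ → ℂ) (h : ℂ → ℂ), DifferentiableOn ℂ h s ∧
      ∀ z, G z = ∑ k ∈ Finset.range n, c k * z ^ k + z ^ n * h z := by
  induction n with
  | zero => exact ⟨fun _ => 0, G, hG, fun z => by simp⟩
  | succ n ih =>
    obtain ⟨c, h, hh, hc⟩ := ih
    refine ⟨fun k => if k = n then h 0 else c k, dslope h 0,
      (Complex.differentiableOn_dslope hs).2 hh, fun z => ?_⟩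
    have h1 := sub_smul_dslope h 0 z
    rw [sub_zero, smul_eq_mul] at h1
    rw [Finset.sum_range_succ, hc z, pow_succ, mul_assoc, h1]
    have h2 : ∑ k ∈ Finset.range n, (if k = n then h 0 else c k) * z ^ k =
        ∑ k ∈ Finset.range n, c k * z ^ k := Finset.sum_congr rfl fun k hk => by
      rw [if_neg (Finset.mem_range.1 hk).ne]
    rw [h2]
    simp only [↓reduceIte]
    ring

/-- A function that is holomorphic near infinity and of polynomial growth is a polynomial plus
`c / lam` plus a term of order `lam⁻²`. -/
lemma exists_laurent {R : ℝ} {F : ℂ → ℂ} (hF : DifferentiableOn ℂ F {lam | R < ‖lam‖}) {C : ℝ}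
    {N : ℕ} (hC : ∀ lam : ℂ, R < ‖lam‖ → ‖F lam‖ ≤ C * ‖lam‖ ^ N) :
    ∃ (P : Polynomial ℂ) (B R' : ℝ) (d : ℂ), R < R' ∧
      ∀ lam : ℂ, R' ≤ ‖lam‖ → ‖F lam - P.eval lam - d / lam‖ ≤ B * ‖lam‖⁻¹ ^ 2 := by
  set ρ := max R 1 with hρ
  have hρ0 : 0 < ρ := lt_of_lt_of_le one_pos (le_max_right _ _)
  set s : Set ℂ := Metric.ball 0 ρ⁻¹ with hs
  have hs0 : s ∈ 𝓝 (0 : ℂ) := Metric.ball_mem_nhds _ (by positivity)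
  have hmem : ∀ z ∈ s \ {0}, R < ‖z⁻¹‖ := fun z hz => by
    have hz0 : 0 < ‖z‖ := norm_pos_iff.2 hz.2
    have hz1 : ‖z‖ < ρ⁻¹ := by simpa [hs] using hz.1
    rw [norm_inv]
    exact (le_max_left R 1).trans_lt ((lt_inv_comm₀ hz0 hρ0).1 hz1)
  set g : ℂ → ℂ := fun z => z ^ N * F z⁻¹ with hg
  have hgd : DifferentiableOn ℂ g (s \ {0}) := by
    refine (differentiableOn_pow N).mul (hF.comp ?_ hmem)
    exact differentiableOn_inv.mono fun z hz => hz.2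
  have hgb : BddAbove (norm ∘ g '' (s \ {0})) := by
    refine ⟨C, ?_⟩
    rintro _ ⟨z, hz, rfl⟩
    have hz0 : 0 < ‖z‖ := norm_pos_iff.2 hz.2
    have h1 := hC z⁻¹ (hmem z hz)
    simp only [Function.comp_apply, hg, norm_mul, norm_pow]
    calc ‖z‖ ^ N * ‖F z⁻¹‖ ≤ ‖z‖ ^ N * (C * ‖z⁻¹‖ ^ N) := by gcongr
      _ = C := by
        rw [norm_inv, mul_left_comm, ← mul_pow, mul_inv_cancel₀ hz0.ne', one_pow, mul_one]
  -- The singularity of `z ^ N * F z⁻¹` at `0` is removable.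
  have hG := Complex.differentiableOn_update_limUnder_of_bddAbove hs0 hgd hgb
  set G := Function.update g 0 (limUnder (𝓝[≠] (0 : ℂ)) g)
  obtain ⟨c, h, hh, hc⟩ := exists_taylor_remainder hs0 hG (N + 2)
  have hcont : ContinuousAt h 0 := (hh.differentiableAt hs0).continuousAt
  obtain ⟨δ, hδ, hball⟩ := Metric.continuousAt_iff.1 hcont 1 one_pos
  set R' := max (ρ + 1) (δ⁻¹ + 1)
  have hR'1 : ρ < R' := lt_of_lt_of_le (lt_add_one _) (le_max_left _ _)
  have hR'0 : 0 < R' := hρ0.trans hR'1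
  refine ⟨∑ k ∈ Finset.range (N + 1), Polynomial.C (c k) * Polynomial.X ^ (N - k),
    ‖h 0‖ + 1, R', c (N + 1), (le_max_left _ _).trans_lt hR'1, fun lam hlam => ?_⟩
  have hpos : 0 < ‖lam‖ := hR'0.trans_le hlam
  have hne : lam ≠ 0 := norm_pos_iff.1 hpos
  have h1 := hc lam⁻¹
  have h2 : G lam⁻¹ = lam⁻¹ ^ N * F lam := by
    simp only [G, Function.update_of_ne (inv_ne_zero hne), hg, inv_inv]
  rw [h2, Finset.sum_range_succ] at h1
  have h3 : F lam - (∑ k ∈ Finset.range (N + 1), Polynomial.C (c k) *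
      Polynomial.X ^ (N - k)).eval lam - c (N + 1) / lam = lam⁻¹ ^ 2 * h lam⁻¹ := by
    have hcancel : lam ^ N * lam⁻¹ ^ N = 1 := by
      rw [← mul_pow, mul_inv_cancel₀ hne, one_pow]
    have h4 : lam ^ N * ∑ k ∈ Finset.range (N + 1), c k * lam⁻¹ ^ k =
        (∑ k ∈ Finset.range (N + 1), Polynomial.C (c k) * Polynomial.X ^ (N - k)).eval lam := by
      rw [Polynomial.eval_finsetSum, Finset.mul_sum]
      refine Finset.sum_congr rfl fun k hk => ?_
      have hk' : k ≤ N := Nat.lt_succ_iff.1 (Finset.mem_range.1 hk)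
      simp only [Polynomial.eval_mul, Polynomial.eval_C, Polynomial.eval_pow, Polynomial.eval_X]
      rw [pow_sub₀ _ hne hk', inv_pow]
      ring
    have h5 : lam ^ N * (lam⁻¹ ^ N * F lam) = F lam := by
      rw [← mul_assoc, hcancel, one_mul]
    rw [← h4, ← h5, h1]
    simp only [pow_succ, div_eq_mul_inv]
    linear_combination (c (N + 1) * lam⁻¹ + lam⁻¹ ^ 2 * h lam⁻¹) * hcancel
  have h6 : ‖h lam⁻¹‖ ≤ ‖h 0‖ + 1 := by
    have h7 : dist lam⁻¹ 0 < δ := by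
      rw [dist_zero_right, norm_inv]
      refine (inv_lt_comm₀ hpos hδ).2 (lt_of_lt_of_le (lt_add_one _) ?_)
      exact (le_max_right _ _).trans hlam
    have h8 := hball h7
    rw [dist_eq_norm] at h8
    have := norm_sub_norm_le (h lam⁻¹) (h 0)
    linarith
  rw [h3, norm_mul, norm_pow, norm_inv, mul_comm]
  gcongr

/-- For a function that is holomorphic near infinity and of polynomial growth, the residue along
double sectors is the contour integral. -/
theorem circleIntegral_eq_residue {R : ℝ} {F f : ℂ → ℂ}
    (hF : DifferentiableOn ℂ F {lam | R < ‖lam‖}) {C : ℝ} {N : ℕ}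
    (hC : ∀ lam : ℂ, R < ‖lam‖ → ‖F lam‖ ≤ C * ‖lam‖ ^ N)
    (hFf : ∀ lam : ℂ, R < ‖lam‖ → lam.im ≠ 0 → F lam = f lam) {r : ℝ} (hr : 0 < r) (hRr : R < r) :
    (2 * Real.pi * I)⁻¹ * (∮ z in C(0, r), F z) = residue f := by
  obtain ⟨P, B, R', d, hRR', hB⟩ := exists_laurent hF hC
  have hres : HasResidue f d := by
    refine ⟨P, fun ε hε => isLittleO_of_isBigO_sq (IsBigO.of_bound B ?_)⟩
    filter_upwards [eventually_sector hε R'] with lam hlam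
    rw [← hFf lam (hRR'.trans_le hlam.1) hlam.2.2, norm_pow, norm_inv]
    exact hB lam hlam.1
  rw [hres.residue_eq]
  set K : ℂ → ℂ := fun lam => F lam - P.eval lam - d / lam with hK
  have hFc : ∀ lam : ℂ, R < ‖lam‖ → DifferentiableAt ℂ F lam := fun lam hlam =>
    hF.differentiableAt ((isOpen_lt continuous_const continuous_norm).mem_nhds hlam)
  have hKd : ∀ lam : ℂ, r ≤ ‖lam‖ → DifferentiableAt ℂ K lam := fun lam hlam =>
    ((hFc lam (hRr.trans_le hlam)).sub P.differentiable.differentiableAt).sub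
      ((differentiableAt_const d).div differentiableAt_id
        (norm_pos_iff.1 (hr.trans_le hlam)))
  have hKr : ∀ r', r ≤ r' → (∮ z in C(0, r'), K z) = ∮ z in C(0, r), K z := fun r' hr' => by
    refine Complex.circleIntegral_eq_of_differentiable_on_annulus_off_countable hr hr'
      Set.countable_empty (fun z hz => (hKd z ?_).continuousAt.continuousWithinAt)
      (fun z hz => hKd z ?_)
    · simpa using hz.2
    · have := hz.1.2
      simp only [Metric.mem_closedBall, dist_zero_right, not_le] at this
      exact this.le
  -- The remainder is of order `lam⁻²`, so its integral vanishes: enlarge the circle.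
  have hK0 : (∮ z in C(0, r), K z) = 0 := by
    have hbound : ∀ᶠ r' : ℝ in atTop, ‖∮ z in C(0, r), K z‖ ≤ 2 * Real.pi * B * r'⁻¹ := by
      filter_upwards [eventually_ge_atTop r, eventually_ge_atTop R'] with r' h1 h2
      have hr' : 0 < r' := hr.trans_le h1
      rw [← hKr r' h1]
      refine (circleIntegral.norm_integral_le_of_norm_le_const (C := B * r'⁻¹ ^ 2) hr'.le
        fun z hz => ?_).trans_eq (by field_simp)
      have hz' : ‖z‖ = r' := by simpa using hz
      have := hB z (by rw [hz']; exact h2)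
      rwa [hz'] at this
    have hlim : Tendsto (fun r' : ℝ => 2 * Real.pi * B * r'⁻¹) atTop (𝓝 0) := by
      simpa using tendsto_inv_atTop_zero.const_mul (2 * Real.pi * B)
    exact norm_le_zero_iff.1 (ge_of_tendsto hlim hbound)
  have hsplit : (∮ z in C(0, r), K z) =
      (∮ z in C(0, r), F z) - (∮ z in C(0, r), P.eval z) - ∮ z in C(0, r), d / z := by
    have i1 : CircleIntegrable F 0 r := ContinuousOn.circleIntegrable hr.le fun z hz =>
      (hFc z (by rwa [mem_sphere_zero_iff_norm.1 hz])).continuousAt.continuousWithinAt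
    have i2 : CircleIntegrable (fun z => P.eval z) 0 r :=
      P.continuous.continuousOn.circleIntegrable hr.le
    have i3 : CircleIntegrable (fun z => d / z) 0 r := ContinuousOn.circleIntegrable hr.le
      (continuousOn_const.div continuousOn_id fun z hz => norm_pos_iff.1 (by simp_all))
    rw [← circleIntegral.integral_sub i1 i2, ← circleIntegral.integral_sub (i1.fun_sub i2) i3]
  have hP0 : (∮ z in C(0, r), P.eval z) = 0 :=
    Complex.circleIntegral_eq_zero_of_differentiable_on_off_countable hr.le Set.countable_empty
      P.continuous.continuousOn fun z _ => P.differentiable.differentiableAt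
  have hd : (∮ z in C(0, r), d / z) = d * (2 * Real.pi * I) := by
    have h := circleIntegral.integral_sub_center_inv 0 hr.ne'
    simp only [sub_zero] at h
    rw [← h, ← circleIntegral.integral_const_mul]
    rfl
  rw [hK0, hP0, hd, sub_zero] at hsplit
  rw [sub_eq_zero.1 hsplit.symm, mul_comm d, inv_mul_cancel_left₀ two_pi_I_ne_zero]

/-! ### The quasimomentum -/

section

variable {l : ℝ} (hl : 0 < l) (ψ : Phase l) {lam : ℂ}

lemma continuous_mul_riccatiCoeff (k : ℕ) :
    Continuous fun x => (ψ : ℝ → ℂ) x * riccatiCoeff ψ k x :=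
  (continuous_phase ψ).mul (riccatiCoeff_regular ψ k).1.continuous

include hl

/-- The logarithm of the multiplier minus the partial sum of the quasimomentum is the integral of
the remainder of the Riccati expansion. -/
lemma multiplier_mul_exp (hlam : lam.im ≠ 0) (N : ℕ) :
    multiplier l ψ 1 lam * exp (-(2 * I * l * quasimomentumSum l ψ N lam)) =
      exp (∫ x in (-l)..l, (ψ : ℝ → ℂ) x * (ratio l ψ lam x
        - ∑ k ∈ Finset.range (N + 1), riccatiCoeff ψ k x * lam⁻¹ ^ k)) := by
  have hlc : (l : ℂ) ≠ 0 := by exact_mod_cast hl.ne'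
  have h1 : ∫ x in (-l)..l, (ψ : ℝ → ℂ) x * (ratio l ψ lam x
        - ∑ k ∈ Finset.range (N + 1), riccatiCoeff ψ k x * lam⁻¹ ^ k) =
      (∫ x in (-l)..l, (ψ : ℝ → ℂ) x * ratio l ψ lam x) -
        ∑ k ∈ Finset.range (N + 1), (∫ x in (-l)..l, (ψ : ℝ → ℂ) x * riccatiCoeff ψ k x)
          * lam⁻¹ ^ k := by
    simp_rw [← intervalIntegral.integral_mul_const]
    rw [← intervalIntegral.integral_finsetSum, ← intervalIntegral.integral_sub]
    · refine intervalIntegral.integral_congr fun x _ => ?_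
      simp only [mul_sub, Finset.mul_sum, mul_assoc]
    · exact (continuous_mul_ratio hl ψ hlam).intervalIntegrable _ _
    · exact (continuous_finsetSum _ fun k _ =>
        (continuous_mul_riccatiCoeff ψ k).mul continuous_const).intervalIntegrable _ _
    · exact fun k _ => ((continuous_mul_riccatiCoeff ψ k).mul
        continuous_const).intervalIntegrable _ _
  have h2 : ∑ k ∈ Finset.range (N + 1), (∫ x in (-l)..l, (ψ : ℝ → ℂ) x * riccatiCoeff ψ k x)
      * lam⁻¹ ^ k = -(2 * I * l * ∑ k ∈ Finset.Icc 1 N,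
        (-1) ^ (k - 1) * hamiltonian l k ψ / (l : ℂ) * (lam ^ k)⁻¹) := by
    rw [Finset.sum_range_succ']
    simp only [riccatiCoeff_zero, mul_zero, intervalIntegral.integral_zero, zero_mul, add_zero]
    rw [Finset.range_eq_Ico, Finset.sum_Ico_add' (fun k =>
      (∫ x in (-l)..l, (ψ : ℝ → ℂ) x * riccatiCoeff ψ k x) * lam⁻¹ ^ k) 0 N 1, Finset.mul_sum,
      ← Finset.sum_neg_distrib, zero_add]
    refine Finset.sum_congr (by ext; simp) fun k _ => ?_
    have h3 : ((-1 : ℂ) ^ (k - 1)) * (-1) ^ (k - 1) = 1 := by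
      rw [← mul_pow]
      simp
    rw [hamiltonian, inv_pow]
    field_simp
    linear_combination
      ((∫ x in (-l)..l, (ψ : ℝ → ℂ) x * riccatiCoeff ψ k x) * lam⁻¹ ^ k * I ^ 2) * h3
      + (∫ x in (-l)..l, (ψ : ℝ → ℂ) x * riccatiCoeff ψ k x) * lam⁻¹ ^ k * I_sq
  rw [multiplier_eq_exp hl ψ hlam, ← exp_add, h1, h2, quasimomentumSum]
  congr 1
  ring

/-- The Hamiltonians are the coefficients of the quasimomentum at infinity. -/
theorem quasimomentum_expansion (σ : ℤˣ) (N : ℕ) {ε : ℝ} (hε : 0 < ε) :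
    (fun lam => multiplier l ψ σ lam *
        Complex.exp (-((σ : ℤ) * (2 * I * l * quasimomentumSum l ψ N lam))) - 1)
      =o[sector ε] fun lam => (lam ^ N)⁻¹ := by
  set D : ℂ → ℂ := fun lam => ∫ x in (-l)..l, (ψ : ℝ → ℂ) x * (ratio l ψ lam x
    - ∑ k ∈ Finset.range (N + 1), riccatiCoeff ψ k x * lam⁻¹ ^ k) with hD
  have hDO : D =O[sector ε] fun lam => lam⁻¹ ^ (N + 1) := by
    have hψ0 := isBigO_coeff hl ε (periodic_phase ψ) (continuous_phase ψ) Set.univ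
    have h1 := isBigO_integral (l := l) (f := fun lam x => (ψ : ℝ → ℂ) x * (ratio l ψ lam x
      - ∑ k ∈ Finset.range (N + 1), riccatiCoeff ψ k x * lam⁻¹ ^ k)) (n := N + 1)
      ((hψ0.mul (ratio_expansion hl ψ hε (N + 1))).congr_right (fun p => by simp) |>.mono
        (region_mono ε (Set.subset_univ _)))
    have ht : Tendsto (fun lam : ℂ => (lam, l)) (sector ε) (region ε (Set.Icc (-l) l)) := by
      refine tendsto_id.prodMk (tendsto_principal.2 (Eventually.of_forall fun _ => ?_))
      exact ⟨by linarith, le_rfl⟩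
    exact h1.comp_tendsto ht
  have hz : Tendsto (fun lam : ℂ => lam⁻¹) (sector ε) (𝓝 0) :=
    tendsto_inv₀_cobounded.mono_left inf_le_left
  have hDo : D =o[sector ε] fun lam => (lam ^ N)⁻¹ := by
    refine hDO.trans_isLittleO ?_
    simpa [pow_succ] using (isBigO_refl (fun lam : ℂ => lam⁻¹ ^ N) (sector ε)).mul_isLittleO
      ((isLittleO_one_iff ℂ).2 hz)
  have hD0 : Tendsto D (sector ε) (𝓝 0) := by
    refine hDO.trans_tendsto ?_
    simpa using hz.pow (N + 1)
  refine IsBigO.trans_isLittleO (g := D) (IsBigO.of_bound 2 ?_) hDo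
  have hsmall : ∀ᶠ lam in sector ε, ‖D lam‖ ≤ 1 := by
    filter_upwards [hD0 (Metric.closedBall_mem_nhds (0 : ℂ) one_pos)] with lam h
    simpa using h
  filter_upwards [hsmall, eventually_sector hε 0] with lam h1 h2
  have h3 := multiplier_mul_exp hl ψ h2.2.2 N
  rcases Int.units_eq_one_or σ with rfl | rfl
  · simp only [Units.val_one, Int.cast_one, one_mul]
    rw [h3]
    exact norm_exp_sub_one_le h1
  · simp only [Units.val_neg, Units.val_one, Int.cast_neg, Int.cast_one, neg_mul, one_mul, neg_neg]
    have h4 : multiplier l ψ (-1) lam * exp (2 * I * l * quasimomentumSum l ψ N lam) =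
        exp (-D lam) := by
      rw [multiplier_neg hl 1 h2.2.2, exp_neg, hD]
      simp only
      rw [← h3, mul_inv, ← exp_neg, neg_neg]
    rw [h4, ← norm_neg (D lam)]
    exact norm_exp_sub_one_le (by rwa [norm_neg])

end

/-! ### The first three Hamiltonians -/

section

variable {l : ℝ} (ψ : Phase l)

lemma riccatiCoeff_two (x : ℝ) : riccatiCoeff ψ 2 x = conj (deriv ψ x) := by
  have h : deriv (riccatiCoeff ψ 1) x = -I * conj (deriv ψ x) := by
    rw [funext (riccatiCoeff_one ψ)]
    exact ((hasDerivAt_of_contDiff (contDiff_phase ψ) x).star.const_mul (-I)).deriv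
  rw [riccatiCoeff_add_two, zero_add, h]
  simp only [Finset.sum_range_succ, Finset.sum_range_zero, riccatiCoeff_zero]
  simp only [Nat.sub_self, riccatiCoeff_zero]
  linear_combination -conj (deriv ψ x) * I_mul_I

lemma riccatiCoeff_three (x : ℝ) : riccatiCoeff ψ 3 x =
    I * (conj (deriv (deriv ψ) x) - (ψ : ℝ → ℂ) x * conj ((ψ : ℝ → ℂ) x) ^ 2) := by
  have h : deriv (riccatiCoeff ψ 2) x = conj (deriv (deriv ψ) x) := by
    rw [funext (riccatiCoeff_two ψ)]
    exact (hasDerivAt_of_contDiff (contDiff_deriv (contDiff_phase ψ)) x).star.deriv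
  rw [riccatiCoeff_add_two, h]
  simp only [Finset.sum_range_succ, Finset.sum_range_zero, riccatiCoeff_zero, Nat.reduceAdd,
    Nat.reduceSub, riccatiCoeff_one]
  linear_combination I * (ψ : ℝ → ℂ) x * conj ((ψ : ℝ → ℂ) x) ^ 2 * I_mul_I

lemma hamiltonian_one : hamiltonian l 1 ψ = 1 / 2 * ∫ x in (-l)..l, (‖(ψ : ℝ → ℂ) x‖ : ℂ) ^ 2 := by
  have h : (fun x => (ψ : ℝ → ℂ) x * riccatiCoeff ψ 1 x) =
      fun x => -I * (‖(ψ : ℝ → ℂ) x‖ : ℂ) ^ 2 := by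
    funext x
    rw [riccatiCoeff_one, ← mul_conj']
    ring
  rw [hamiltonian, h, intervalIntegral.integral_const_mul]
  linear_combination -(1 / 2 * ∫ x in (-l)..l, (‖(ψ : ℝ → ℂ) x‖ : ℂ) ^ 2) * I_mul_I

lemma hamiltonian_two : hamiltonian l 2 ψ =
    1 / (2 * I) * ∫ x in (-l)..l, (ψ : ℝ → ℂ) x * conj (deriv ψ x) := by
  simp only [hamiltonian, riccatiCoeff_two]
  rw [one_div, mul_inv, inv_I]
  ring

lemma hamiltonian_three : hamiltonian l 3 ψ =
    1 / 2 * ∫ x in (-l)..l, ((‖deriv (ψ : ℝ → ℂ) x‖ : ℂ) ^ 2 + (‖(ψ : ℝ → ℂ) x‖ : ℂ) ^ 4) := by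
  have c1 := continuous_phase ψ
  have s2 := contDiff_deriv (contDiff_phase ψ)
  have c2 := s2.continuous
  have c3 := (contDiff_deriv s2).continuous
  have hd : ∀ x, HasDerivAt (fun x : ℝ => (ψ : ℝ → ℂ) x * conj (deriv (ψ : ℝ → ℂ) x))
      (deriv (ψ : ℝ → ℂ) x * conj (deriv (ψ : ℝ → ℂ) x)
        + (ψ : ℝ → ℂ) x * conj (deriv (deriv (ψ : ℝ → ℂ)) x)) x := fun x =>
    (hasDerivAt_of_contDiff (contDiff_phase ψ) x).mul (hasDerivAt_of_contDiff s2 x).star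
  have hint := intervalIntegral.integral_eq_sub_of_hasDerivAt (a := -l) (b := l) (fun x _ => hd x)
    (Continuous.intervalIntegrable (by fun_prop) _ _)
  have hper : (ψ : ℝ → ℂ) l * conj (deriv ψ l) = (ψ : ℝ → ℂ) (-l) * conj (deriv ψ (-l)) := by
    rw [← periodic_phase ψ (-l), ← deriv_periodic (periodic_phase ψ) (-l),
      show -l + 2 * l = l by ring]
  rw [hper, sub_self] at hint
  have h : ∀ x, (ψ : ℝ → ℂ) x * riccatiCoeff ψ 3 x =
      I * ((deriv ψ x * conj (deriv ψ x) + (ψ : ℝ → ℂ) x * conj (deriv (deriv ψ) x))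
        - ((‖deriv (ψ : ℝ → ℂ) x‖ : ℂ) ^ 2 + (‖(ψ : ℝ → ℂ) x‖ : ℂ) ^ 4)) := fun x => by
    rw [riccatiCoeff_three, mul_conj', show (‖(ψ : ℝ → ℂ) x‖ : ℂ) ^ 4 =
      ((‖(ψ : ℝ → ℂ) x‖ : ℂ) ^ 2) ^ 2 by ring, ← mul_conj' ((ψ : ℝ → ℂ) x)]
    ring
  simp only [hamiltonian, h]
  rw [intervalIntegral.integral_const_mul, intervalIntegral.integral_sub, hint]
  · linear_combination -(1 / 2 * ∫ x in (-l)..l,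
      ((‖deriv (ψ : ℝ → ℂ) x‖ : ℂ) ^ 2 + (‖(ψ : ℝ → ℂ) x‖ : ℂ) ^ 4)) * I_mul_I
  · exact Continuous.intervalIntegrable (by fun_prop) _ _
  · exact Continuous.intervalIntegrable (by fun_prop) _ _

/-- A variation that preserves `H₁` to first order preserves the mean of `|ψ|²`. -/
lemma avg_densityVar_eq_zero (X : Phase l)
    (h : HasDerivAt (fun t : ℝ => hamiltonian l 1 (ψ + t • X : Phase l)) 0 0) :
    avg l (densityVar ψ X) = 0 := by
  have c1 := continuous_phase ψ
  have c2 := continuous_phase X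
  have h1 : (fun t : ℝ => hamiltonian l 1 (ψ + t • X : Phase l)) = fun t : ℝ =>
      1 / 2 * ((∫ x in (-l)..l, (‖(ψ : ℝ → ℂ) x‖ : ℂ) ^ 2)
        + t * (∫ x in (-l)..l, densityVar ψ X x)
        + (t * t) * ∫ x in (-l)..l, (‖(X : ℝ → ℂ) x‖ : ℂ) ^ 2) := by
    funext t
    rw [hamiltonian_one]
    congr 1
    rw [← intervalIntegral.integral_const_mul,
      ← intervalIntegral.integral_const_mul, ← intervalIntegral.integral_add,
      ← intervalIntegral.integral_add]
    · refine intervalIntegral.integral_congr fun x _ => ?_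
      simp only [add_smul_apply, ← mul_conj', densityVar, map_add, map_mul, conj_ofReal]
      ring
    · exact Continuous.intervalIntegrable (by unfold densityVar; fun_prop) _ _
    · exact Continuous.intervalIntegrable (by fun_prop) _ _
    · exact Continuous.intervalIntegrable (by fun_prop) _ _
    · exact (continuous_const.mul (continuous_densityVar ψ X)).intervalIntegrable _ _
  rw [h1] at h
  have ht : HasDerivAt (fun t : ℝ => (t : ℂ)) 1 0 := HasDerivAt.ofReal_comp (hasDerivAt_id 0)
  have h2 := (((ht.mul_const (∫ x in (-l)..l, densityVar ψ X x)).const_add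
    (∫ x in (-l)..l, (‖(ψ : ℝ → ℂ) x‖ : ℂ) ^ 2)).add
    ((ht.mul ht).mul_const (∫ x in (-l)..l, (‖(X : ℝ → ℂ) x‖ : ℂ) ^ 2))).const_mul (1 / 2)
  have h3 := h.unique h2
  rw [avg]
  simp at h3
  simp [h3]

end

/-! ### Formal power series over a differential algebra -/

section

open PowerSeries

variable {A : Type*} [CommRing A] [Algebra ℂ A] (D : Derivation ℂ A A)

/-- The coefficientwise extension of a derivation to power series. -/
def seriesD : Derivation ℂ A⟦X⟧ A⟦X⟧ :=
  Derivation.mk'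
    { toFun := fun f => PowerSeries.mk fun n => D (coeff n f)
      map_add' := fun f g => by ext n; simp
      map_smul' := fun c f => by ext n; simp }
    fun f g => by
      ext n
      simp only [LinearMap.coe_mk, AddHom.coe_mk, coeff_mk, coeff_mul, map_sum, Derivation.leibniz,
        smul_eq_mul, map_add, Finset.sum_add_distrib]
      congr 1
      rw [← Finset.Nat.sum_antidiagonal_swap]
      exact Finset.sum_congr rfl fun _ _ => rfl

@[simp]
lemma coeff_seriesD (n : ℕ) (f : A⟦X⟧) : coeff n (seriesD D f) = D (coeff n f) := by
  simp [seriesD]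

/-- `∂_z` and `∂_x` commute. -/
lemma derivative_seriesD (f : A⟦X⟧) :
    derivative A (seriesD D f) = seriesD D (derivative A f) := by
  ext n
  rw [coeff_derivative, coeff_seriesD, coeff_seriesD, coeff_derivative, Derivation.leibniz]
  have h : D ((n : A) + 1) = 0 := by
    rw [map_add, Derivation.map_natCast, Derivation.map_one_eq_zero, add_zero]
  rw [h, smul_zero, zero_add, smul_eq_mul, mul_comm]

/-- The coefficients of a logarithmic derivative are derivatives, up to integer factors: this is
`∂_z (u⁻¹ u') = (u⁻¹ ∂_z u)'`. -/
lemma coeff_logDeriv {u g : A⟦X⟧} (hg : g * u = 1) (n : ℕ) :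
    coeff (n + 1) (g * seriesD D u) * (n + 1) = D (coeff n (g * derivative A u)) := by
  rw [← coeff_derivative, ← coeff_seriesD]
  congr 1
  have h1 : derivative A g = -(g * g * derivative A u) := by
    have h := congrArg (derivative A) hg
    rw [Derivation.leibniz, Derivation.map_one_eq_zero, smul_eq_mul, smul_eq_mul] at h
    linear_combination g * h - derivative A g * hg
  have h2 : seriesD D g = -(g * g * seriesD D u) := by
    have h := congrArg (seriesD D) hg
    rw [Derivation.leibniz, Derivation.map_one_eq_zero, smul_eq_mul, smul_eq_mul] at h
    linear_combination g * h - seriesD D g * hg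
  rw [Derivation.leibniz, Derivation.leibniz, derivative_seriesD, h1, h2]
  simp only [smul_eq_mul]
  ring

/-- The imaginary unit as a constant power series. -/
abbrev imag (A : Type*) [CommRing A] [Algebra ℂ A] : A⟦X⟧ := algebraMap ℂ A⟦X⟧ I

/-- The logarithmic derivative of `1 - q r`, for formal solutions `r` of the Riccati equation with
coefficients `a`, `b`, and `q` of the conjugate equation with coefficients `a₀`, `b₀`. -/
lemma inv_mul_seriesD_one_sub {a b a₀ b₀ r q g : A⟦X⟧}
    (hr : X * seriesD D r = -imag A * r + X * b - X * a * (r * r))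
    (hq : X * seriesD D q = imag A * q + X * a₀ - X * b₀ * (q * q))
    (hg : g * (1 - q * r) = 1) :
    g * seriesD D (1 - q * r) = -(a * r + b₀ * q) + ((a - a₀) * r - (b - b₀) * q) * g := by
  -- The terms of order zero in `X = 1 / lam` of the two Riccati equations cancel in `(q r)'`.
  have h : seriesD D (1 - q * r) = -(a₀ * r + b * q) + q * r * (b₀ * q + a * r) := by
    refine X_mul_cancel ?_
    rw [map_sub, Derivation.map_one_eq_zero, Derivation.leibniz, smul_eq_mul, smul_eq_mul]
    linear_combination -q * hr - r * hq
  rw [h]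
  linear_combination (-(b₀ * q + a * r)) * hg

section Lax

variable {a b r q g : A⟦X⟧}

/-- The half `i/2` of the imaginary unit as a constant power series. -/
abbrev halfImag (A : Type*) [CommRing A] [Algebra ℂ A] : A⟦X⟧ := algebraMap ℂ A⟦X⟧ (I / 2)

lemma two_mul_halfImag : 2 * halfImag A = imag A := by
  rw [halfImag, imag, two_mul, ← map_add, add_halves]

/-- The square of the formal solution of the Lax equation is `-1/4`. -/
lemma lax_square (hg : g * (1 - q * r) = 1) :
    (halfImag A * (1 + q * r) * g) * (halfImag A * (1 + q * r) * g)
      + (imag A * r * g) * (-imag A * q * g) = algebraMap ℂ A⟦X⟧ (-1 / 4) := by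
  have h4 : halfImag A * halfImag A = algebraMap ℂ A⟦X⟧ (-1 / 4) := by
    rw [halfImag, ← map_mul]
    congr 1
    linear_combination (1 / 4) * I_mul_I
  have h1 : imag A * imag A = 4 * algebraMap ℂ A⟦X⟧ (-1 / 4) := by
    rw [← h4, ← two_mul_halfImag]
    ring
  linear_combination ((1 + q * r) * g) ^ 2 * h4 - r * q * g ^ 2 * h1
    + algebraMap ℂ A⟦X⟧ (-1 / 4) * (g * (1 - q * r) + 1) * hg

variable (hr : X * seriesD D r = -imag A * r + X * b - X * a * (r * r))
  (hq : X * seriesD D q = imag A * q + X * a - X * b * (q * q))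
  (hg : g * (1 - q * r) = 1)
include hr hq hg

lemma seriesD_inv : seriesD D g = g * (b * q + a * r) := by
  have h := congrArg (seriesD D) hg
  rw [Derivation.leibniz, Derivation.map_one_eq_zero, smul_eq_mul, smul_eq_mul,
    inv_mul_seriesD_one_sub D hr hq hg] at h
  linear_combination g * h - seriesD D g * hg

lemma seriesD_lax_diag : seriesD D (-halfImag A * (1 + q * r) * g) =
    b * (-imag A * q * g) - a * (imag A * r * g) := by
  have h1 := inv_mul_seriesD_one_sub D hr hq hg
  have h2 := seriesD_inv D hr hq hg
  rw [map_sub, Derivation.map_one_eq_zero] at h1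
  have h3 : seriesD D (-halfImag A) = 0 := by rw [map_neg, Derivation.map_algebraMap, neg_zero]
  rw [Derivation.leibniz, Derivation.leibniz, h3, h2, map_add, Derivation.map_one_eq_zero]
  simp only [smul_eq_mul]
  rw [← two_mul_halfImag]
  linear_combination halfImag A * h1 + halfImag A * (b * q + a * r) * hg

lemma seriesD_lax_upper : X * seriesD D (imag A * r * g) =
    -imag A * (imag A * r * g) - 2 * (X * b * (-halfImag A * (1 + q * r) * g)) := by
  have h2 := seriesD_inv D hr hq hg
  rw [Derivation.leibniz, Derivation.leibniz, Derivation.map_algebraMap, h2]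
  simp only [smul_eq_mul]
  linear_combination imag A * g * hr - X * b * (1 + q * r) * g * two_mul_halfImag (A := A)

lemma seriesD_lax_lower : X * seriesD D (-imag A * q * g) =
    imag A * (-imag A * q * g) + 2 * (X * a * (-halfImag A * (1 + q * r) * g)) := by
  have h2 := seriesD_inv D hr hq hg
  have h3 : seriesD D (-imag A) = 0 := by rw [map_neg, Derivation.map_algebraMap, neg_zero]
  rw [Derivation.leibniz, Derivation.leibniz, h3, h2]
  simp only [smul_eq_mul]
  linear_combination -imag A * g * hq + X * a * (1 + q * r) * g * two_mul_halfImag (A := A)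

end Lax

end

/-! ### The zero curvature equation -/

/-- `∑ s_k lam^{-k}` is a formal solution of `S' = [V, S]` with `S_0 = -(i/2) σ₃` and with constant
square. -/
structure IsLaxSeries (ψ : ℝ → ℂ) (s : ℕ → ℝ → Matrix (Fin 2) (Fin 2) ℂ) : Prop where
  zero : ∀ x, s 0 x = (-(I / 2)) • sigma3
  differentiable : ∀ k i j, Differentiable ℝ fun y => s k y i j
  ode : ∀ k x, Matrix.of (fun i j => deriv (fun y => s k y i j) x) =
    (matY ψ x * s k x - s k x * matY ψ x)
      - (I / 2) • (sigma3 * s (k + 1) x - s (k + 1) x * sigma3)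
  square : ∀ k x, ∑ j ∈ Finset.range (k + 2), s j x * s (k + 1 - j) x = 0

lemma sigma3_mul_self : sigma3 * sigma3 = 1 := by
  ext i j
  fin_cases i <;> fin_cases j <;> simp [sigma3]

/-- The commutator with `σ₃` doubles the off-diagonal part, up to sign. -/
lemma sigma3_commutator (M : Matrix (Fin 2) (Fin 2) ℂ) :
    sigma3 * M - M * sigma3 = !![0, 2 * M 0 1; -2 * M 1 0, 0] := by
  ext i j
  fin_cases i <;> fin_cases j <;>
    simp only [sigma3, Matrix.sub_apply, Matrix.mul_apply, Fin.sum_univ_two] <;> simp <;> ring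

lemma seriesS_succ (ψ : ℝ → ℂ) (k : ℕ) (x : ℝ) : seriesS ψ (k + 1) x = (I • sigma3) *
    (Matrix.of (fun i j => deriv (fun y => seriesS ψ k y i j) x)
      - (matY ψ x * seriesS ψ k x - seriesS ψ k x * matY ψ x)
      - ∑ j ∈ Finset.range k, seriesS ψ (j + 1) x * seriesS ψ (k - j) x) := by
  rw [seriesS, Finset.sum_range]

namespace IsLaxSeries

variable {ψ : ℝ → ℂ} {s : ℕ → ℝ → Matrix (Fin 2) (Fin 2) ℂ} (h : IsLaxSeries ψ s)
include h

/-- A formal solution of the Lax equation satisfies the recursion that defines `seriesS`. -/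
lemma eq_seriesS (k : ℕ) : s k = seriesS ψ k := by
  induction k using Nat.strong_induction_on with
  | _ k ih =>
    match k, ih with
    | 0, _ =>
      funext x
      rw [h.zero, seriesS]
    | k + 1, ih =>
      funext x
      have hsum : ∑ j ∈ Finset.range k, seriesS ψ (j + 1) x * seriesS ψ (k - j) x =
          ∑ j ∈ Finset.range k, s (j + 1) x * s (k - j) x := by
        refine Finset.sum_congr rfl fun j hj => ?_
        have := Finset.mem_range.1 hj
        rw [ih (j + 1) (by omega), ih (k - j) (by omega)]
      have hsq := h.square k x
      rw [Finset.sum_range_succ', Finset.sum_range_succ] at hsq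
      simp only [Nat.add_sub_add_right, Nat.sub_self, Nat.sub_zero, h.zero] at hsq
      rw [seriesS_succ, ← ih k (by omega), hsum, h.ode]
      have hsum' : ∑ j ∈ Finset.range k, s (j + 1) x * s (k - j) x =
          (I / 2) • (sigma3 * s (k + 1) x + s (k + 1) x * sigma3) := by
        rw [smul_add, ← Matrix.smul_mul, ← Matrix.mul_smul]
        rw [Matrix.smul_mul, neg_smul, neg_smul, Matrix.mul_neg] at hsq
        rw [add_assoc] at hsq
        rw [eq_neg_of_add_eq_zero_left hsq, Matrix.smul_mul]
        abel
      rw [hsum']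
      have : (matY ψ x * s k x - s k x * matY ψ x
          - (I / 2) • (sigma3 * s (k + 1) x - s (k + 1) x * sigma3)
          - (matY ψ x * s k x - s k x * matY ψ x)
          - (I / 2) • (sigma3 * s (k + 1) x + s (k + 1) x * sigma3)) =
          (-I) • (sigma3 * s (k + 1) x) := by
        module
      rw [this, Matrix.smul_mul, Matrix.mul_smul, smul_smul, ← mul_assoc, sigma3_mul_self, one_mul]
      simp

omit h in
lemma seriesS_of (h : IsLaxSeries ψ s) : IsLaxSeries ψ (seriesS ψ) := by
  rwa [← funext h.eq_seriesS]

end IsLaxSeries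

/-- The curvature `∂_x V_m + [V_m, V_2]` telescopes to a commutator of `σ₃` and `S_m`. -/
lemma laxV_curvature {ψ : ℝ → ℂ} (h : IsLaxSeries ψ (seriesS ψ)) (m : ℕ) (lam : ℂ) (x : ℝ) :
    Matrix.of (fun i j => deriv (fun y => laxV ψ m lam y i j) x)
      + (laxV ψ m lam x * matV ψ lam x - matV ψ lam x * laxV ψ m lam x) =
    ((-1) ^ (m + 1) * (I / 2)) • (sigma3 * seriesS ψ m x - seriesS ψ m x * sigma3) := by
  set s := seriesS ψ
  set c : ℕ → Matrix (Fin 2) (Fin 2) ℂ := fun k => sigma3 * s k x - s k x * sigma3 with hc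
  have hd : Matrix.of (fun i j => deriv (fun y => laxV ψ m lam y i j) x) =
      ((-1 : ℂ) ^ m) • ∑ k ∈ Finset.range m, lam ^ (m - 1 - k) •
        Matrix.of (fun i j => deriv (fun y => s k y i j) x) := by
    ext i j
    simp only [laxV, Matrix.of_apply, Matrix.smul_apply, Matrix.sum_apply, smul_eq_mul]
    exact (HasDerivAt.const_mul _ (HasDerivAt.fun_sum fun k _ =>
      ((h.differentiable k i j x).hasDerivAt.const_mul _))).deriv
  have hterm : ∀ k ∈ Finset.range m, lam ^ (m - 1 - k) •
      (Matrix.of (fun i j => deriv (fun y => s k y i j) x)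
        + (s k x * matV ψ lam x - matV ψ lam x * s k x)) =
      (I / 2) • (lam ^ (m - k) • c k - lam ^ (m - (k + 1)) • c (k + 1)) := by
    intro k hk
    have hk' : m - k = (m - 1 - k) + 1 := by
      have := Finset.mem_range.1 hk
      omega
    rw [h.ode, matV, hk', show m - (k + 1) = m - 1 - k by omega, pow_succ, hc]
    simp only [mul_add, add_mul, Matrix.smul_mul, Matrix.mul_smul]
    module
  have hsum : Matrix.of (fun i j => deriv (fun y => laxV ψ m lam y i j) x)
      + (laxV ψ m lam x * matV ψ lam x - matV ψ lam x * laxV ψ m lam x) =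
      ((-1 : ℂ) ^ m) • ∑ k ∈ Finset.range m, lam ^ (m - 1 - k) •
      (Matrix.of (fun i j => deriv (fun y => s k y i j) x)
        + (s k x * matV ψ lam x - matV ψ lam x * s k x)) := by
    rw [hd, laxV]
    simp only [smul_add, smul_sub, Finset.sum_add_distrib, Finset.sum_sub_distrib, Matrix.smul_mul,
      Matrix.mul_smul, Finset.sum_mul, Finset.mul_sum]
    rfl
  have hc0 : c 0 = 0 := by
    simp only [hc]
    rw [h.zero]
    simp
  rw [hsum, Finset.sum_congr rfl hterm, ← Finset.smul_sum,
    Finset.sum_range_sub' (fun k => lam ^ (m - k) • c k), hc0, Nat.sub_self, pow_zero, one_smul,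
    smul_zero, zero_sub, smul_neg, smul_neg, pow_succ, smul_smul, ← neg_smul]
  congr 1
  ring

/-- The velocity of the `m`-th flow is `±i` times the lower left entry of `S_m`. -/
lemma isFlowVelocity_iff {ψ : ℝ → ℂ} (h : IsLaxSeries ψ (seriesS ψ))
    (hconj : ∀ k x, conj (seriesS ψ k x 1 0) = seriesS ψ k x 0 1) (m : ℕ) (X : ℝ → ℂ) :
    IsFlowVelocity ψ m X ↔ ∀ x, X x = (-1) ^ m * I * seriesS ψ m x 1 0 := by
  have key : ∀ x, matY X x = ((-1) ^ (m + 1) * (I / 2)) •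
      (sigma3 * seriesS ψ m x - seriesS ψ m x * sigma3) ↔
      X x = (-1) ^ m * I * seriesS ψ m x 1 0 := by
    intro x
    rw [sigma3_commutator]
    constructor
    · intro hx
      have := congrFun (congrFun hx 1) 0
      simp only [matY, Matrix.smul_apply, smul_eq_mul, Matrix.of_apply, Matrix.cons_val_zero,
        Matrix.cons_val_one] at this
      rw [this]
      ring
    · intro hx
      have hx' : conj (X x) = (-1) ^ (m + 1) * I * seriesS ψ m x 0 1 := by
        rw [hx, map_mul, hconj, map_mul, conj_I, map_pow, map_neg, map_one]
        ring
      rw [matY, hx', hx]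
      ext i j
      fin_cases i <;> fin_cases j <;> simp <;> ring
  simp only [IsFlowVelocity, laxV_curvature h]
  exact ⟨fun H x => (key x).1 (H 0 x), fun H _ x => (key x).2 (H x)⟩

/-! ### One-parameter families of smooth periodic functions -/

/-- The algebra of smooth functions of a parameter `t` and of `x`, with period `2l` in `x`. -/
def Family (l : ℝ) : Subalgebra ℂ (ℝ × ℝ → ℂ) where
  carrier := {f | ContDiff ℝ ∞ f ∧ ∀ t x, f (t, x + 2 * l) = f (t, x)}
  mul_mem' := fun ha hb => ⟨ha.1.mul hb.1, fun t x => by simp [ha.2 t x, hb.2 t x]⟩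
  add_mem' := fun ha hb => ⟨ha.1.add hb.1, fun t x => by simp [ha.2 t x, hb.2 t x]⟩
  algebraMap_mem' := fun c => ⟨contDiff_const, fun _ _ => rfl⟩

section

variable {l : ℝ}

namespace Family

lemma contDiff_slice (f : Family l) (t : ℝ) : ContDiff ℝ ∞ fun x => (f : ℝ × ℝ → ℂ) (t, x) :=
  f.2.1.comp (contDiff_const.prodMk contDiff_id)

lemma deriv_slice {f : ℝ × ℝ → ℂ} (hf : ContDiff ℝ ∞ f) (t x : ℝ) :
    deriv (fun y => f (t, y)) x = fderiv ℝ f (t, x) (0, 1) := by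
  have h1 := (hf.differentiable (by simp) (t, x)).hasFDerivAt
  have h2 : HasDerivAt (fun y : ℝ => (t, y)) ((0 : ℝ), (1 : ℝ)) x :=
    (hasDerivAt_const x t).prodMk (hasDerivAt_id x)
  exact (h1.comp_hasDerivAt x h2).deriv

lemma deriv_mem {f : ℝ × ℝ → ℂ} (hf : f ∈ Family l) :
    (fun p : ℝ × ℝ => deriv (fun y => f (p.1, y)) p.2) ∈ Family l := by
  constructor
  · have h : (fun p : ℝ × ℝ => deriv (fun y => f (p.1, y)) p.2) =
        fun p => fderiv ℝ f p (0, 1) := funext fun p => deriv_slice hf.1 p.1 p.2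
    rw [h]
    exact (hf.1.fderiv_right (m := ∞) (by simp)).clm_apply contDiff_const
  · exact fun t x => deriv_periodic (hf.2 t) x

lemma hasDerivAt_slice (f : Family l) (t x : ℝ) : HasDerivAt (fun y => (f : ℝ × ℝ → ℂ) (t, y))
    (deriv (fun y => (f : ℝ × ℝ → ℂ) (t, y)) x) x :=
  hasDerivAt_of_contDiff (contDiff_slice f t) x

/-- The derivation `∂_x` of the algebra of families. -/
def derivX (l : ℝ) : Derivation ℂ (Family l) (Family l) :=
  Derivation.mk'
    { toFun := fun f => ⟨fun p => deriv (fun y => (f : ℝ × ℝ → ℂ) (p.1, y)) p.2, deriv_mem f.2⟩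
      map_add' := fun f g => by
        ext p
        exact ((hasDerivAt_slice f p.1 p.2).add (hasDerivAt_slice g p.1 p.2)).deriv
      map_smul' := fun c f => by
        ext p
        exact ((hasDerivAt_slice f p.1 p.2).const_mul c).deriv }
    fun f g => by
      ext p
      refine ((hasDerivAt_slice f p.1 p.2).mul (hasDerivAt_slice g p.1 p.2)).deriv.trans ?_
      change _ = (f : ℝ × ℝ → ℂ) p * _ + (g : ℝ × ℝ → ℂ) p * _
      rw [add_comm, mul_comm (deriv _ _)]
      rfl

lemma derivX_apply (f : Family l) (t x : ℝ) :
    (derivX l f : ℝ × ℝ → ℂ) (t, x) = deriv (fun y => (f : ℝ × ℝ → ℂ) (t, y)) x := rfl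

/-- Complex conjugation on families. -/
def conjHom (l : ℝ) : Family l →+* Family l where
  toFun f := ⟨fun p => conj ((f : ℝ × ℝ → ℂ) p), conjCLE.contDiff.comp f.2.1,
    fun t x => congrArg conj (f.2.2 t x)⟩
  map_one' := by ext p; simp
  map_zero' := by ext p; simp
  map_add' f g := by ext p; simp
  map_mul' f g := by ext p; simp

lemma conjHom_conjHom (f : Family l) : conjHom l (conjHom l f) = f := by
  ext p
  exact conj_conj _

lemma derivX_conjHom (f : Family l) : derivX l (conjHom l f) = conjHom l (derivX l f) := by
  ext ⟨t, x⟩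
  exact (hasDerivAt_slice f t x).star.deriv

/-- Evaluation of a family at a point. -/
def eval (p : ℝ × ℝ) : Family l →+* ℂ := (Pi.evalRingHom _ p).comp (Family l).val.toRingHom

lemma eval_apply (p : ℝ × ℝ) (f : Family l) : eval p f = (f : ℝ × ℝ → ℂ) p := rfl

/-- A potential as a family that does not depend on the parameter. -/
def const (ψ : Phase l) : Family l :=
  ⟨fun p => (ψ : ℝ → ℂ) p.2, (contDiff_phase ψ).comp contDiff_snd, fun _ x => periodic_phase ψ x⟩

/-- The parameter as a family. -/
def time (l : ℝ) : Family l :=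
  ⟨fun p => (p.1 : ℂ), ofRealCLM.contDiff.comp contDiff_fst, fun _ _ => rfl⟩

/-- The family of potentials `ψ + t Y`. -/
def line (ψ Y : Phase l) : Family l := const ψ + time l * const Y

lemma line_slice (ψ Y : Phase l) (t : ℝ) : (fun x => (line ψ Y : ℝ × ℝ → ℂ) (t, x)) =
    ((ψ + t • Y : Phase l) : ℝ → ℂ) := by
  funext x
  rw [add_smul_apply]
  rfl

/-- The Riccati coefficients depend smoothly on the parameter. -/
lemma riccati_mem (a : Family l) (k : ℕ) :
    (fun p : ℝ × ℝ => riccatiCoeff (fun y => (a : ℝ × ℝ → ℂ) (p.1, y)) k p.2) ∈ Family l := by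
  induction k using Nat.strong_induction_on with
  | _ k ih =>
    match k, ih with
    | 0, _ =>
      simp only [riccatiCoeff_zero]
      exact (Family l).zero_mem
    | 1, _ =>
      simp only [riccatiCoeff_one]
      exact (Family l).mul_mem ((Family l).algebraMap_mem (-I)) (conjHom l a).2
    | s + 2, ih =>
      simp only [riccatiCoeff_add_two]
      refine (Family l).mul_mem ((Family l).algebraMap_mem I) ((Family l).add_mem
        (deriv_mem (ih (s + 1) (by omega))) ((Family l).mul_mem a.2 ?_))
      have h := (Family l).sum_mem (t := Finset.range (s + 2)) (f := fun j p =>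
        riccatiCoeff (fun y => (a : ℝ × ℝ → ℂ) (p.1, y)) j p.2
          * riccatiCoeff (fun y => (a : ℝ × ℝ → ℂ) (p.1, y)) (s + 1 - j) p.2)
        fun j hj => (Family l).mul_mem (ih j (Finset.mem_range.1 hj)) (ih (s + 1 - j) (by omega))
      convert h using 1
      funext p
      rw [Finset.sum_apply]

open PowerSeries

/-- The generating series `r` of the Riccati coefficients of a family of potentials, in the
variable `X = 1 / lam`. -/
def riccati (a : Family l) : (Family l)⟦X⟧ := PowerSeries.mk fun k => ⟨_, riccati_mem a k⟩

lemma coeff_riccati_apply (a : Family l) (k : ℕ) (t x : ℝ) :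
    eval (t, x) (coeff k (riccati a)) =
      riccatiCoeff (fun y => (a : ℝ × ℝ → ℂ) (t, y)) k x := by
  rw [riccati, coeff_mk]
  rfl

lemma coeff_zero_riccati (a : Family l) : constantCoeff (riccati a) = 0 := by
  ext ⟨t, x⟩
  rw [← coeff_zero_eq_constantCoeff_apply]
  exact (coeff_riccati_apply a 0 t x).trans (riccatiCoeff_zero _ x)

lemma coeff_imag_mul (k : ℕ) (f : (Family l)⟦X⟧) :
    coeff k (imag (Family l) * f) = algebraMap ℂ (Family l) I * coeff k f := by
  rw [imag, ← Algebra.smul_def, ← Algebra.smul_def]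
  simp

lemma coeff_mul_apply (k : ℕ) (f g : (Family l)⟦X⟧) (p : ℝ × ℝ) :
    eval p (coeff k (f * g)) = ∑ j ∈ Finset.range (k + 1),
      eval p (coeff j f) * eval p (coeff (k - j) g) := by
  rw [coeff_mul, Finset.Nat.sum_antidiagonal_eq_sum_range_succ
    (fun i j => coeff i f * coeff j g), map_sum]
  simp only [map_mul]

/-- The Riccati equation. -/
lemma riccati_ode (a : Family l) : X * seriesD (derivX l) (riccati a) =
    -imag (Family l) * riccati a + X * C (conjHom l a) - X * C a * (riccati a * riccati a) := by
  ext k ⟨t, x⟩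
  rw [mul_assoc X (C a), neg_mul (imag (Family l)) (riccati a), map_sub, map_add, map_neg,
    coeff_imag_mul]
  rcases k with _ | k
  · rw [coeff_zero_X_mul, coeff_zero_X_mul, coeff_zero_X_mul, coeff_zero_eq_constantCoeff_apply,
      coeff_zero_riccati]
    simp
  · rw [coeff_succ_X_mul, coeff_succ_X_mul, coeff_succ_X_mul, coeff_C_mul, coeff_seriesD]
    have h := riccatiCoeff_succ (fun y => (a : ℝ × ℝ → ℂ) (t, y)) k x
    have h1 : eval (t, x) (coeff k (C (conjHom l a))) =
        if k = 0 then conj ((a : ℝ × ℝ → ℂ) (t, x)) else 0 := by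
      rw [coeff_C]
      split <;> rfl
    have h2 : eval (t, x) (derivX l (coeff k (riccati a))) =
        deriv (riccatiCoeff (fun y => (a : ℝ × ℝ → ℂ) (t, y)) k) x := by
      rw [eval_apply, derivX_apply]
      congr 1
      funext y
      exact coeff_riccati_apply a k t y
    have h3 : eval (t, x) (algebraMap ℂ (Family l) I) = I := rfl
    have h4 := coeff_mul_apply k (riccati a) (riccati a) (t, x)
    simp only [coeff_riccati_apply] at h4
    rw [← eval_apply, ← eval_apply]
    rw [map_sub, map_add, map_neg, map_mul, map_mul, h1, h2, h3, h4, coeff_riccati_apply,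
      eval_apply]
    linear_combination -h

/-- The conjugate of the series `r`. -/
def riccatiConj (a : Family l) : (Family l)⟦X⟧ := PowerSeries.map (conjHom l) (riccati a)

lemma coeff_zero_riccatiConj (a : Family l) : constantCoeff (riccatiConj a) = 0 := by
  rw [← coeff_zero_eq_constantCoeff_apply, riccatiConj, coeff_map,
    coeff_zero_eq_constantCoeff_apply, coeff_zero_riccati, map_zero]

/-- The conjugate Riccati equation. -/
lemma riccatiConj_ode (a : Family l) : X * seriesD (derivX l) (riccatiConj a) =
    imag (Family l) * riccatiConj a + X * C a
      - X * C (conjHom l a) * (riccatiConj a * riccatiConj a) := by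
  have h := congrArg (PowerSeries.map (conjHom l)) (riccati_ode a)
  have h1 : PowerSeries.map (conjHom l) (seriesD (derivX l) (riccati a)) =
      seriesD (derivX l) (riccatiConj a) := by
    ext1 k
    rw [coeff_map, coeff_seriesD, coeff_seriesD, riccatiConj, coeff_map, derivX_conjHom]
  have h2 : PowerSeries.map (conjHom l) (imag (Family l)) = -imag (Family l) := by
    rw [imag, ← map_neg, PowerSeries.algebraMap_apply, PowerSeries.algebraMap_apply, map_C]
    congr 1
    ext p
    change conj I = -I
    exact conj_I
  simp only [map_mul, map_add, map_sub, map_neg, map_X, map_C, h1, h2, conjHom_conjHom,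
    neg_neg] at h
  exact h

/-- The series `(1 - q r)⁻¹` for `r` the Riccati series of `a` and `q` the conjugate Riccati series
of `a₀`. -/
def invSeries (a₀ a : Family l) : (Family l)⟦X⟧ := invOfUnit (1 - riccatiConj a₀ * riccati a) 1

lemma invSeries_mul (a₀ a : Family l) :
    invSeries a₀ a * (1 - riccatiConj a₀ * riccati a) = 1 := by
  rw [mul_comm]
  refine mul_invOfUnit _ _ ?_
  rw [map_sub, map_mul, coeff_zero_riccati, mul_zero, map_one, sub_zero, Units.val_one]

end Family

end

/-! ### The formal solution of the Lax equation -/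

section

open PowerSeries Family

variable {l : ℝ} (ψ : Phase l)

/-- The formal solution of the Lax equation, built from the ratio `r` of the components of one
formal Baker–Akhiezer solution and the conjugate ratio `q`. -/
def laxSeries : Matrix (Fin 2) (Fin 2) (Family l)⟦X⟧ :=
  let r := riccati (const ψ)
  let q := riccatiConj (const ψ)
  let g := invSeries (const ψ) (const ψ)
  !![-halfImag (Family l) * (1 + q * r) * g, imag (Family l) * r * g;
    -imag (Family l) * q * g, halfImag (Family l) * (1 + q * r) * g]

/-- The coefficients of `laxSeries`. The potential does not depend on the parameter, which is set
to `0`. -/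
def laxCoeff (k : ℕ) (x : ℝ) : Matrix (Fin 2) (Fin 2) ℂ :=
  Matrix.of fun i j => eval (0, x) (coeff k (laxSeries ψ i j))

lemma laxCoeff_apply (k : ℕ) (x : ℝ) (i j : Fin 2) :
    laxCoeff ψ k x i j = eval (0, x) (coeff k (laxSeries ψ i j)) := rfl

lemma laxSeries_sq_apply (i j : Fin 2) :
    laxSeries ψ i 0 * laxSeries ψ 0 j + laxSeries ψ i 1 * laxSeries ψ 1 j =
      algebraMap ℂ (Family l)⟦X⟧ (if i = j then -1 / 4 else 0) := by
  have h := lax_square (invSeries_mul (const ψ) (const ψ))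
  fin_cases i <;> fin_cases j <;> simp [laxSeries] <;> [skip; ring; ring; skip] <;>
    linear_combination h

lemma deriv_laxCoeff (k : ℕ) (x : ℝ) (i j : Fin 2) :
    deriv (fun y => laxCoeff ψ k y i j) x =
      eval (0, x) (coeff k (seriesD (derivX l) (laxSeries ψ i j))) := by
  rw [coeff_seriesD, eval_apply, derivX_apply]
  rfl

lemma eval_const (t x : ℝ) : eval (t, x) (const ψ) = (ψ : ℝ → ℂ) x := rfl

lemma eval_conjHom (p : ℝ × ℝ) (f : Family l) : eval p (conjHom l f) = conj (eval p f) := rfl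

lemma eval_coeff_imag_mul (k : ℕ) (f : (Family l)⟦X⟧) (p : ℝ × ℝ) :
    eval p (coeff k (imag (Family l) * f)) = I * eval p (coeff k f) := by
  rw [coeff_imag_mul, map_mul]
  rfl

lemma eval_coeff_neg_imag_mul (k : ℕ) (f : (Family l)⟦X⟧) (p : ℝ × ℝ) :
    eval p (coeff k (-imag (Family l) * f)) = -I * eval p (coeff k f) := by
  rw [neg_mul (imag (Family l)) f, map_neg, map_neg, eval_coeff_imag_mul, neg_mul]

lemma eval_coeff_X_mul_C (a : Family l) (k : ℕ) (f : (Family l)⟦X⟧) (p : ℝ × ℝ) :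
    eval p (coeff (k + 1) (2 * (X * C a * f))) = 2 * (eval p a * eval p (coeff k f)) := by
  rw [two_mul, map_add, map_add, mul_assoc X (C a), coeff_succ_X_mul, coeff_C_mul, map_mul,
    two_mul]

lemma laxCoeff_one_one (k : ℕ) (x : ℝ) : laxCoeff ψ k x 1 1 = -laxCoeff ψ k x 0 0 := by
  have h : laxSeries ψ 1 1 = -laxSeries ψ 0 0 := by
    simp only [laxSeries, Matrix.of_apply, Matrix.cons_val_zero, Matrix.cons_val_one]
    ring
  rw [laxCoeff_apply, laxCoeff_apply, h, map_neg, map_neg]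

lemma deriv_laxCoeff_diag (k : ℕ) (x : ℝ) : deriv (fun y => laxCoeff ψ k y 0 0) x =
    conj ((ψ : ℝ → ℂ) x) * laxCoeff ψ k x 1 0 - (ψ : ℝ → ℂ) x * laxCoeff ψ k x 0 1 := by
  rw [deriv_laxCoeff]
  refine (congrArg (fun f => eval (0, x) (coeff k f)) (seriesD_lax_diag (derivX l)
    (riccati_ode (const ψ)) (riccatiConj_ode (const ψ)) (invSeries_mul (const ψ) (const ψ)))).trans
    ?_
  rw [map_sub, map_sub, coeff_C_mul, coeff_C_mul, (eval _).map_mul, (eval _).map_mul]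
  rfl

lemma deriv_laxCoeff_upper (k : ℕ) (x : ℝ) : deriv (fun y => laxCoeff ψ k y 0 1) x =
    -I * laxCoeff ψ (k + 1) x 0 1 - 2 * (conj ((ψ : ℝ → ℂ) x) * laxCoeff ψ k x 0 0) := by
  rw [deriv_laxCoeff, ← coeff_succ_X_mul]
  refine (congrArg (fun f => eval (0, x) (coeff (k + 1) f)) (seriesD_lax_upper (derivX l)
    (riccati_ode (const ψ)) (riccatiConj_ode (const ψ)) (invSeries_mul (const ψ) (const ψ)))).trans
    ?_
  rw [map_sub, map_sub, eval_coeff_neg_imag_mul, eval_coeff_X_mul_C]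
  rfl

lemma deriv_laxCoeff_lower (k : ℕ) (x : ℝ) : deriv (fun y => laxCoeff ψ k y 1 0) x =
    I * laxCoeff ψ (k + 1) x 1 0 + 2 * ((ψ : ℝ → ℂ) x * laxCoeff ψ k x 0 0) := by
  rw [deriv_laxCoeff, ← coeff_succ_X_mul]
  refine (congrArg (fun f => eval (0, x) (coeff (k + 1) f)) (seriesD_lax_lower (derivX l)
    (riccati_ode (const ψ)) (riccatiConj_ode (const ψ)) (invSeries_mul (const ψ) (const ψ)))).trans
    ?_
  rw [map_add, map_add, eval_coeff_imag_mul, eval_coeff_X_mul_C]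
  rfl

/-- The explicit series solves the Lax equation, so by uniqueness it is the series that the
recursion defines. -/
lemma isLaxSeries_laxCoeff : IsLaxSeries ψ (laxCoeff ψ) := by
  have hg := invSeries_mul (const ψ) (const ψ)
  have hr0 := coeff_zero_riccati (const ψ)
  have hq0 := coeff_zero_riccatiConj (const ψ)
  refine ⟨fun x => ?_, fun k i j => ?_, fun k x => ?_, fun k x => ?_⟩
  · have hg0 : constantCoeff (invSeries (const ψ) (const ψ)) = 1 := by
      have := congrArg constantCoeff hg
      simpa [hr0] using this
    have hh : eval (0, x) (constantCoeff (halfImag (Family l))) = I / 2 := by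
      rw [halfImag, PowerSeries.algebraMap_apply, constantCoeff_C]
      rfl
    ext i j
    rw [laxCoeff_apply, coeff_zero_eq_constantCoeff_apply]
    fin_cases i <;> fin_cases j <;> simp [laxSeries, sigma3, hr0, hq0, hg0, hh]
  · exact (contDiff_slice (coeff k (laxSeries ψ i j)) 0).differentiable (by simp)
  · rw [sigma3_commutator]
    ext i j
    fin_cases i <;> fin_cases j <;>
      simp only [matY, Matrix.sub_apply, Matrix.mul_apply, Fin.sum_univ_two] <;>
      simp [deriv_laxCoeff_diag, deriv_laxCoeff_upper, deriv_laxCoeff_lower, laxCoeff_one_one] <;>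
      ring
  · ext i j
    have h := congrArg (fun f => eval (0, x) (coeff (k + 1) f)) (laxSeries_sq_apply ψ i j)
    simp only [map_add, coeff_mul_apply] at h
    rw [PowerSeries.algebraMap_apply, coeff_C, if_neg k.succ_ne_zero, map_zero] at h
    rw [Matrix.sum_apply]
    simp only [Matrix.mul_apply, Fin.sum_univ_two, Finset.sum_add_distrib]
    exact h

end

section

open PowerSeries Family

variable {l : ℝ} (ψ Y : Phase l)

lemma isLaxSeries_seriesS : IsLaxSeries ψ (seriesS ψ) := (isLaxSeries_laxCoeff ψ).seriesS_of

lemma seriesS_eq_laxCoeff (k : ℕ) : seriesS ψ k = laxCoeff ψ k :=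
  ((isLaxSeries_laxCoeff ψ).eq_seriesS k).symm

lemma contDiff_seriesS (k : ℕ) (i j : Fin 2) : ContDiff ℝ ∞ fun x => seriesS ψ k x i j := by
  rw [seriesS_eq_laxCoeff]
  exact contDiff_slice (coeff k (laxSeries ψ i j)) 0

lemma seriesS_periodic (k : ℕ) (i j : Fin 2) (x : ℝ) :
    seriesS ψ k (x + 2 * l) i j = seriesS ψ k x i j := by
  rw [seriesS_eq_laxCoeff]
  exact (coeff k (laxSeries ψ i j)).2.2 0 x

/-- Two left inverses of the same series agree. -/
lemma eq_of_mul_eq_one {R : Type*} [CommRing R] {g g' u : R} (h : g * u = 1) (h' : g' * u = 1) :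
    g = g' := by
  linear_combination g' * h - g * h'

lemma map_conj_eval (p : ℝ × ℝ) (f : (Family l)⟦X⟧) :
    PowerSeries.map (starRingEnd ℂ) (PowerSeries.map (eval p) f) =
      PowerSeries.map (eval p) (PowerSeries.map (conjHom l) f) := by
  ext k
  simp only [coeff_map]
  rfl

/-- The off-diagonal entries of `S` are conjugate: conjugation exchanges `r` and
`q` and fixes `(1 - q r)⁻¹`. -/
lemma conj_seriesS (k : ℕ) (x : ℝ) : conj (seriesS ψ k x 1 0) = seriesS ψ k x 0 1 := by
  set e := PowerSeries.map (eval (l := l) (0, x))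
  set c := PowerSeries.map (starRingEnd ℂ)
  have h1 : c (e (riccati (const ψ))) = e (riccatiConj (const ψ)) := map_conj_eval _ _
  have h2 : c (e (riccatiConj (const ψ))) = e (riccati (const ψ)) := by
    rw [← h1]
    ext n
    simp [c]
  have h3 : e (invSeries (const ψ) (const ψ)) * (1 - e (riccatiConj (const ψ)) *
      e (riccati (const ψ))) = 1 := by
    simpa using congrArg e (invSeries_mul (const ψ) (const ψ))
  have h4 : c (e (invSeries (const ψ) (const ψ))) = e (invSeries (const ψ) (const ψ)) := by
    refine eq_of_mul_eq_one (u := 1 - e (riccatiConj (const ψ)) * e (riccati (const ψ))) ?_ h3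
    have := congrArg c h3
    rw [map_mul, map_sub, map_mul, map_one, h1, h2] at this
    rwa [mul_comm (e (riccatiConj (const ψ)))]
  have h5 : ∀ f : (Family l)⟦X⟧, eval (0, x) (coeff k f) = coeff k (e f) := fun f =>
    (coeff_map _ _ _).symm
  have h6 : ∀ f : ℂ⟦X⟧, conj (coeff k f) = coeff k (c f) := fun f => (coeff_map _ _ _).symm
  rw [seriesS_eq_laxCoeff, laxCoeff_apply, laxCoeff_apply]
  have e10 : laxSeries ψ 1 0 = -imag (Family l) *
      (riccatiConj (const ψ) * invSeries (const ψ) (const ψ)) := mul_assoc _ _ _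
  have e01 : laxSeries ψ 0 1 = imag (Family l) *
      (riccati (const ψ) * invSeries (const ψ) (const ψ)) := mul_assoc _ _ _
  rw [e10, e01, eval_coeff_neg_imag_mul, eval_coeff_imag_mul, map_mul, map_neg, conj_I, neg_neg,
    h5, h5, h6, e.map_mul, c.map_mul, h2, h4, ← e.map_mul]

/-! ### The variation of the Hamiltonians -/

/-- The generating series `(Y r - Ȳ q) (1 - q r)⁻¹` of the rates of change of the Hamiltonians along
`ψ + t Y`, where `r` belongs to `ψ + t Y` and `q` to `ψ`. -/
def rateSeries : (Family l)⟦X⟧ :=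
  (C (const Y) * riccati (line ψ Y) - C (conjHom l (const Y)) * riccatiConj (const ψ))
    * invSeries (const ψ) (line ψ Y)

lemma conjHom_line : conjHom l (line ψ Y) =
    conjHom l (const ψ) + time l * conjHom l (const Y) := by
  rw [line, map_add, map_mul]
  congr 2
  ext p
  exact conj_ofReal _

/-- The terms of the logarithmic derivative of `1 - q r` are exact derivatives. -/
lemma integral_logDeriv (k : ℕ) (t : ℝ) (a₀ a : Family l) :
    ∫ x in (-l)..l, eval (t, x) (coeff k (invSeries a₀ a *
      seriesD (derivX l) (1 - riccatiConj a₀ * riccati a))) = 0 := by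
  rcases k with _ | k
  · have h : constantCoeff (seriesD (derivX l) (1 - riccatiConj a₀ * riccati a)) = 0 := by
      rw [← coeff_zero_eq_constantCoeff_apply, coeff_seriesD, coeff_zero_eq_constantCoeff_apply,
        map_sub, map_mul, coeff_zero_riccati, mul_zero, map_one, sub_zero,
        Derivation.map_one_eq_zero]
    simp only [coeff_zero_eq_constantCoeff_apply, map_mul, h, mul_zero, map_zero,
      intervalIntegral.integral_zero]
  · set F := coeff k (invSeries a₀ a *
      derivative (Family l) (1 - riccatiConj a₀ * riccati a)) with hF
    have h : ∀ x, eval (t, x) (coeff (k + 1) (invSeries a₀ a *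
        seriesD (derivX l) (1 - riccatiConj a₀ * riccati a))) =
        deriv (fun y => (F : ℝ × ℝ → ℂ) (t, y)) x * ((k : ℂ) + 1)⁻¹ := by
      intro x
      have h1 := congrArg (eval (t, x)) (coeff_logDeriv (derivX l) (invSeries_mul a₀ a) k)
      rw [map_mul, map_add, map_natCast, map_one, ← hF, eval_apply _ (derivX l F),
        derivX_apply] at h1
      rw [← h1, mul_inv_cancel_right₀]
      exact_mod_cast k.succ_ne_zero
    simp only [h]
    rw [intervalIntegral.integral_mul_const, intervalIntegral.integral_eq_sub_of_hasDerivAt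
      (fun x _ => hasDerivAt_slice F t x)
      ((contDiff_deriv (contDiff_slice F t)).continuous.intervalIntegrable _ _)]
    have hp := F.2.2 t (-l)
    rw [show -l + 2 * l = l by ring] at hp
    rw [hp, sub_self, zero_mul]

lemma continuous_eval_slice (f : Family l) (t : ℝ) : Continuous fun x => eval (t, x) f :=
  (contDiff_slice f t).continuous

/-- The increment of the integrals that define the Hamiltonians along `ψ + t Y`. The comparison of
the ratio `r` of `ψ + t Y` with the conjugate ratio `q` of `ψ` splits off the
factor `t` exactly; the case `Y = 0` is the reality of the Hamiltonians. -/
lemma integral_riccatiCoeff_line (k : ℕ) (t : ℝ) :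
    (∫ x in (-l)..l, ((ψ + t • Y : Phase l) : ℝ → ℂ) x
        * riccatiCoeff ((ψ + t • Y : Phase l) : ℝ → ℂ) k x)
      + conj (∫ x in (-l)..l, (ψ : ℝ → ℂ) x * riccatiCoeff ψ k x) =
      t * ∫ x in (-l)..l, eval (t, x) (coeff k (rateSeries ψ Y)) := by
  have hg := inv_mul_seriesD_one_sub (derivX l) (riccati_ode (line ψ Y)) (riccatiConj_ode (const ψ))
    (invSeries_mul (const ψ) (line ψ Y))
  have hrate : (C (line ψ Y) - C (const ψ)) * riccati (line ψ Y)
      - (C (conjHom l (line ψ Y)) - C (conjHom l (const ψ))) * riccatiConj (const ψ) =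
      C (time l) * (C (const Y) * riccati (line ψ Y)
        - C (conjHom l (const Y)) * riccatiConj (const ψ)) := by
    rw [conjHom_line, line, map_add, map_add, map_mul, map_mul]
    ring
  rw [hrate, mul_assoc] at hg
  have hpt : ∀ x, ((ψ + t • Y : Phase l) : ℝ → ℂ) x
        * riccatiCoeff ((ψ + t • Y : Phase l) : ℝ → ℂ) k x
        + conj ((ψ : ℝ → ℂ) x * riccatiCoeff ψ k x) =
      t * eval (t, x) (coeff k (rateSeries ψ Y)) - eval (t, x) (coeff k
        (invSeries (const ψ) (line ψ Y) *
          seriesD (derivX l) (1 - riccatiConj (const ψ) * riccati (line ψ Y)))) := by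
    intro x
    rw [hg]
    simp only [map_add, map_neg, coeff_C_mul, RingHom.map_mul (eval (t, x))]
    rw [coeff_riccati_apply, line_slice, riccatiConj, coeff_map, eval_conjHom, eval_conjHom,
      coeff_riccati_apply, eval_const, map_mul]
    have h1 : eval (t, x) (line ψ Y) = ((ψ + t • Y : Phase l) : ℝ → ℂ) x :=
      congrFun (line_slice ψ Y t) x
    have h2 : eval (t, x) (time l) = t := rfl
    rw [h1, h2, rateSeries]
    simp only [riccatiConj]
    change _ = _ - (-(_ + _ * conj (riccatiCoeff (ψ : ℝ → ℂ) k x)) + _)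
    ring
  have hconj : conj (∫ x in (-l)..l, (ψ : ℝ → ℂ) x * riccatiCoeff ψ k x) =
      ∫ x in (-l)..l, conj ((ψ : ℝ → ℂ) x * riccatiCoeff ψ k x) := by
    simp only [intervalIntegral, map_sub, integral_conj]
  have hc : Continuous fun x => conj ((ψ : ℝ → ℂ) x * riccatiCoeff ψ k x) :=
    continuous_conj.comp (continuous_mul_riccatiCoeff ψ k)
  rw [hconj, ← intervalIntegral.integral_add
    ((continuous_mul_riccatiCoeff (ψ + t • Y) k).intervalIntegrable _ _)
    (hc.intervalIntegrable _ _)]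
  simp only [hpt]
  rw [intervalIntegral.integral_sub, integral_logDeriv, sub_zero,
    intervalIntegral.integral_const_mul]
  · exact (continuous_const.mul (continuous_eval_slice _ t)).intervalIntegrable _ _
  · exact (continuous_eval_slice _ t).intervalIntegrable _ _

lemma conj_integral_riccatiCoeff (k : ℕ) :
    conj (∫ x in (-l)..l, (ψ : ℝ → ℂ) x * riccatiCoeff ψ k x) =
      -∫ x in (-l)..l, (ψ : ℝ → ℂ) x * riccatiCoeff ψ k x := by
  have h := integral_riccatiCoeff_line ψ 0 k 0
  simp only [zero_smul, add_zero, ofReal_zero, zero_mul] at h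
  exact eq_neg_of_add_eq_zero_right h

/-- The Hamiltonians are real. -/
theorem hamiltonian_im (m : ℕ) : (hamiltonian l m ψ).im = 0 := by
  rw [← conj_eq_iff_im, hamiltonian, map_mul, conj_integral_riccatiCoeff, map_mul, map_pow,
    map_div₀, conj_I, map_neg, map_one, map_ofNat]
  ring

/-- At `t = 0` the rate series is expressed by the solution of the Lax equation. -/
lemma eval_rateSeries (k : ℕ) (x : ℝ) : eval (0, x) (coeff k (rateSeries ψ Y)) =
    -I * ((Y : ℝ → ℂ) x * seriesS ψ k x 0 1 + conj ((Y : ℝ → ℂ) x) * seriesS ψ k x 1 0) := by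
  set e := PowerSeries.map (eval (l := l) (0, x))
  have h1 : e (riccati (line ψ Y)) = e (riccati (const ψ)) := by
    ext n
    simp only [e, coeff_map]
    rw [coeff_riccati_apply, coeff_riccati_apply, line_slice, zero_smul, add_zero]
    rfl
  have h3 : e (invSeries (const ψ) (const ψ)) * (1 - e (riccatiConj (const ψ)) *
      e (riccati (const ψ))) = 1 := by
    simpa using congrArg e (invSeries_mul (const ψ) (const ψ))
  have h4 : e (invSeries (const ψ) (line ψ Y)) = e (invSeries (const ψ) (const ψ)) := by
    refine eq_of_mul_eq_one (u := 1 - e (riccatiConj (const ψ)) * e (riccati (const ψ))) ?_ h3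
    simpa [h1] using congrArg e (invSeries_mul (const ψ) (line ψ Y))
  have h5 : ∀ f : (Family l)⟦X⟧, eval (0, x) (coeff k f) = coeff k (e f) := fun f =>
    (coeff_map _ _ _).symm
  have e10 : laxSeries ψ 1 0 = -imag (Family l) *
      (riccatiConj (const ψ) * invSeries (const ψ) (const ψ)) := mul_assoc _ _ _
  have e01 : laxSeries ψ 0 1 = imag (Family l) *
      (riccati (const ψ) * invSeries (const ψ) (const ψ)) := mul_assoc _ _ _
  have h6 : eval (0, x) (coeff k (rateSeries ψ Y)) =
      (Y : ℝ → ℂ) x * coeff k (e (riccati (const ψ) * invSeries (const ψ) (const ψ)))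
      - conj ((Y : ℝ → ℂ) x) *
        coeff k (e (riccatiConj (const ψ) * invSeries (const ψ) (const ψ))) := by
    have hC : ∀ f : Family l, e (C f) = C (eval (0, x) f) := fun f => PowerSeries.map_C _ _
    rw [rateSeries, h5]
    simp only [RingHom.map_mul e, RingHom.map_sub e, hC, h1, h4]
    rw [sub_mul, mul_assoc, mul_assoc, map_sub, coeff_C_mul, coeff_C_mul]
    rfl
  rw [h6, seriesS_eq_laxCoeff, laxCoeff_apply, laxCoeff_apply, e10, e01, eval_coeff_neg_imag_mul,
    eval_coeff_imag_mul, h5, h5]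
  linear_combination ((Y : ℝ → ℂ) x * coeff k (e (riccati (const ψ) *
    invSeries (const ψ) (const ψ))) - conj ((Y : ℝ → ℂ) x) *
      coeff k (e (riccatiConj (const ψ) * invSeries (const ψ) (const ψ)))) * I_mul_I

/-- The derivative of the Hamiltonians. -/
theorem hasDerivAt_hamiltonian (m : ℕ) :
    HasDerivAt (fun t : ℝ => hamiltonian l m (ψ + t • Y : Phase l))
      ((-1) ^ (m - 1) / 2 * ∫ x in (-l)..l, ((Y : ℝ → ℂ) x * seriesS ψ m x 0 1
        + conj ((Y : ℝ → ℂ) x) * seriesS ψ m x 1 0)) 0 := by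
  set G : ℝ → ℂ := fun t => ∫ x in (-l)..l, eval (t, x) (coeff m (rateSeries ψ Y)) with hG
  have hGc : Continuous G :=
    intervalIntegral.continuous_parametric_intervalIntegral_of_continuous'
      (f := fun t x => eval (t, x) (coeff m (rateSeries ψ Y)))
      (coeff m (rateSeries ψ Y)).2.1.continuous _ _
  -- Only the continuity of `G` is needed, since the difference quotient at `0` is `G` itself.
  have hd : HasDerivAt (fun t : ℝ => (t : ℂ) * G t) (G 0) 0 := by
    rw [hasDerivAt_iff_tendsto_slope]
    refine ((hGc.tendsto 0).mono_left nhdsWithin_le_nhds).congr' ?_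
    filter_upwards [self_mem_nhdsWithin] with t ht
    have ht' : (t : ℂ) ≠ 0 := by exact_mod_cast ht
    rw [slope_def_module]
    simp
    field_simp
  have hG0 : G 0 = -I * ∫ x in (-l)..l, ((Y : ℝ → ℂ) x * seriesS ψ m x 0 1
        + conj ((Y : ℝ → ℂ) x) * seriesS ψ m x 1 0) := by
    rw [hG, ← intervalIntegral.integral_const_mul]
    exact intervalIntegral.integral_congr fun x _ => eval_rateSeries ψ Y m x
  have hH : (fun t : ℝ => hamiltonian l m (ψ + t • Y : Phase l)) = fun t : ℝ =>
      (-1) ^ (m - 1) * (I / 2) * (t * G t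
        - conj (∫ x in (-l)..l, (ψ : ℝ → ℂ) x * riccatiCoeff ψ m x)) := by
    funext t
    rw [hamiltonian, ← integral_riccatiCoeff_line, add_sub_cancel_right]
  rw [hH]
  refine ((hd.sub_const _).const_mul _).congr_deriv ?_
  rw [hG0]
  linear_combination (-(-1) ^ (m - 1) / 2 * ∫ x in (-l)..l, ((Y : ℝ → ℂ) x * seriesS ψ m x 0 1
        + conj ((Y : ℝ → ℂ) x) * seriesS ψ m x 1 0)) * I_mul_I

end

/-! ### The symplectic form and the Hamiltonian flows -/

section

variable {l : ℝ}

/-- The constant two-form `2i ⟨δψ̄ ∧ δψ⟩`. -/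
def symplecticForm (l : ℝ) : Phase l →ₗ[ℝ] Phase l →ₗ[ℝ] ℂ :=
  LinearMap.mk₂ ℝ (fun X Y => 2 * I * avg l fun x =>
      conj ((X : ℝ → ℂ) x) * (Y : ℝ → ℂ) x - conj ((Y : ℝ → ℂ) x) * (X : ℝ → ℂ) x)
    (fun X X' Y => by
      have c1 := continuous_phase X
      have c2 := continuous_phase X'
      have c3 := continuous_phase Y
      rw [← mul_add, ← avg_add (by fun_prop) (by fun_prop)]
      congr 2
      funext x
      simp only [Submodule.coe_add, Pi.add_apply, map_add]
      ring)
    (fun c X Y => by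
      rw [real_smul, mul_left_comm, ← avg_const_mul l (c : ℂ)]
      congr 2
      funext x
      simp only [Submodule.coe_smul, Pi.smul_apply, real_smul, map_mul, conj_ofReal]
      ring)
    (fun X Y Y' => by
      have c1 := continuous_phase X
      have c2 := continuous_phase Y
      have c3 := continuous_phase Y'
      rw [← mul_add, ← avg_add (by fun_prop) (by fun_prop)]
      congr 2
      funext x
      simp only [Submodule.coe_add, Pi.add_apply, map_add]
      ring)
    (fun c X Y => by
      rw [real_smul, mul_left_comm, ← avg_const_mul l (c : ℂ)]
      congr 2
      funext x
      simp only [Submodule.coe_smul, Pi.smul_apply, real_smul, map_mul, conj_ofReal]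
      ring)

lemma symplecticForm_apply (X Y : Phase l) : symplecticForm l X Y = 2 * I * avg l fun x =>
    conj ((X : ℝ → ℂ) x) * (Y : ℝ → ℂ) x - conj ((Y : ℝ → ℂ) x) * (X : ℝ → ℂ) x := rfl

variable (hl : 0 < l)
include hl

lemma norm_le_ckNorm (X : Phase l) (x : ℝ) : ‖(X : ℝ → ℂ) x‖ ≤ ckNorm 0 X := by
  obtain ⟨C, -, hC⟩ := exists_bound_of_periodic (by positivity : 0 < 2 * l) (periodic_phase X)
    (continuous_phase X)
  rw [ckNorm, zero_add, Finset.sum_range_one, iteratedDeriv_zero]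
  exact le_ciSup (f := fun x => ‖(X : ℝ → ℂ) x‖) ⟨C, by rintro _ ⟨y, rfl⟩; exact hC y⟩ x

lemma norm_symplecticForm_le (X Y : Phase l) :
    ‖symplecticForm l X Y‖ ≤ 4 * ckNorm 0 X * ckNorm 0 Y := by
  have h := intervalIntegral.norm_integral_le_of_norm_le_const (a := -l) (b := l)
    (f := fun x => conj ((X : ℝ → ℂ) x) * (Y : ℝ → ℂ) x - conj ((Y : ℝ → ℂ) x) * (X : ℝ → ℂ) x)
    (C := 2 * (ckNorm 0 X * ckNorm 0 Y)) fun x _ => by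
      have hX := norm_le_ckNorm hl X x
      have hY := norm_le_ckNorm hl Y x
      have hXY := mul_le_mul hX hY (norm_nonneg _) ((norm_nonneg _).trans hX)
      refine (norm_sub_le _ _).trans ?_
      rw [norm_mul, norm_mul, norm_conj, norm_conj, mul_comm ‖(Y : ℝ → ℂ) x‖]
      linarith
  rw [symplecticForm_apply, avg, norm_mul, norm_mul, norm_mul, norm_inv, norm_I,
    Complex.norm_real, Complex.norm_ofNat, Real.norm_of_nonneg (by positivity), mul_one]
  rw [sub_neg_eq_add, abs_of_pos (by positivity)] at h
  calc 2 * ((2 * l)⁻¹ * _) ≤ 2 * ((2 * l)⁻¹ * (2 * (ckNorm 0 X * ckNorm 0 Y) * (l + l))) := by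
        gcongr
    _ = 4 * ckNorm 0 X * ckNorm 0 Y := by
        field_simp
        ring

theorem isClosedTwoForm_omega_zero : IsClosedTwoForm l (omega l 0) := by
  have h : omega l 0 = fun _ X Y => symplecticForm l X Y := by
    funext ψ X Y
    exact omega_zero_eq hl ψ X Y
  rw [h]
  refine ⟨fun _ => ⟨symplecticForm l, fun _ _ => rfl⟩, fun _ X => ?_,
    fun _ => ⟨0, 4, norm_symplecticForm_le hl⟩, fun _ _ _ _ _ => contDiff_const,
    fun _ _ _ _ => by simp⟩
  simp [symplecticForm_apply, avg]

/-- The form `ω₀` is nondegenerate: its value on `X` and `iX` is a negative multiple of the mean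
of `|X|²`. -/
theorem omega_zero_nondegenerate (ψ X : Phase l) (h : ∀ Y, omega l 0 ψ X Y = 0) : X = 0 := by
  have cX := continuous_phase X
  let Y : Phase l := ⟨fun x => I * (X : ℝ → ℂ) x, contDiff_const.mul (contDiff_phase X),
    fun x => congrArg (I * ·) (periodic_phase X x)⟩
  have h1 : ∫ x in (-l)..l, ‖(X : ℝ → ℂ) x‖ ^ 2 = 0 := by
    have h2 := h Y
    have h3 : (fun x => conj ((X : ℝ → ℂ) x) * (Y : ℝ → ℂ) x
        - conj ((Y : ℝ → ℂ) x) * (X : ℝ → ℂ) x) =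
        fun x => 2 * I * ((‖(X : ℝ → ℂ) x‖ ^ 2 : ℝ) : ℂ) := by
      funext x
      change conj ((X : ℝ → ℂ) x) * (I * (X : ℝ → ℂ) x)
        - conj (I * (X : ℝ → ℂ) x) * (X : ℝ → ℂ) x = _
      rw [map_mul, conj_I, ofReal_pow, ← conj_mul']
      ring
    rw [omega_zero_eq hl, h3, avg_const_mul, avg, intervalIntegral.integral_ofReal] at h2
    have hl' : (l : ℂ) ≠ 0 := by exact_mod_cast hl.ne'
    simpa [hl'] using h2
  by_contra hX
  obtain ⟨x, hx⟩ : ∃ x, (X : ℝ → ℂ) x ≠ 0 := by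
    by_contra! h0
    exact hX (Subtype.ext (funext h0))
  obtain ⟨y, hy, hxy⟩ := Function.Periodic.exists_mem_Ico X.2.2 (by positivity) x (-l)
  refine (intervalIntegral.integral_pos (by linarith : -l < l)
    (f := fun x => ‖(X : ℝ → ℂ) x‖ ^ 2) (by fun_prop) (fun _ _ => by positivity)
    ⟨y, ⟨hy.1, by linarith [hy.2]⟩, ?_⟩).ne' h1
  rw [hxy] at hx
  positivity

/-- The `m`-th flow of the hierarchy is Hamiltonian. -/
theorem omega_zero_flow (m : ℕ) (hm : 1 ≤ m) (ψ X Y : Phase l) (hX : IsFlowVelocity ψ m X) :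
    omega l 0 ψ X Y = -(2 / l) * ((-1) ^ (m - 1) / 2 * ∫ x in (-l)..l,
      ((Y : ℝ → ℂ) x * seriesS ψ m x 0 1 + conj ((Y : ℝ → ℂ) x) * seriesS ψ m x 1 0)) := by
  have hX' := (isFlowVelocity_iff (isLaxSeries_seriesS ψ) (conj_seriesS ψ) m X).1 hX
  obtain ⟨k, rfl⟩ : ∃ k, m = k + 1 := ⟨m - 1, by omega⟩
  have h : (fun x => conj ((X : ℝ → ℂ) x) * (Y : ℝ → ℂ) x
      - conj ((Y : ℝ → ℂ) x) * (X : ℝ → ℂ) x) = fun x => (-1) ^ k * I *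
        ((Y : ℝ → ℂ) x * seriesS ψ (k + 1) x 0 1
          + conj ((Y : ℝ → ℂ) x) * seriesS ψ (k + 1) x 1 0) := by
    funext x
    rw [hX', map_mul, map_mul, conj_seriesS, conj_I, map_pow, map_neg, map_one]
    ring
  have hl' : (l : ℂ) ≠ 0 := by exact_mod_cast hl.ne'
  rw [omega_zero_eq hl, h, avg_const_mul, avg, Nat.add_sub_cancel]
  push_cast
  field_simp
  rw [I_sq]
  ring

omit hl in
theorem existsUnique_isFlowVelocity (m : ℕ) (ψ : Phase l) :
    ∃! X : Phase l, IsFlowVelocity ψ m X := by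
  have h := isFlowVelocity_iff (isLaxSeries_seriesS ψ) (conj_seriesS ψ) m
  refine ⟨⟨fun x => (-1) ^ m * I * seriesS ψ m x 1 0,
    contDiff_const.mul (contDiff_seriesS ψ m 1 0), fun x => ?_⟩, (h _).2 fun _ => rfl,
    fun X hX => Subtype.ext (funext ((h X).1 hX))⟩
  simp only [seriesS_periodic]

end

end KrichPhong

end

open KrichPhong in
theorem lemma2p4 (l : ℝ) (hl : 0 < l) :
    -- the Floquet solutions, their duals and their variations are well defined
    (∀ (ψ X : Phase l) (σ : ℤˣ) (lam : ℂ), lam.im ≠ 0 →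
      (∃! w, OnSheet l ψ σ lam w) ∧
      sheetSwap (curvePoint l ψ σ lam) = curvePoint l ψ (-σ) lam ∧
      (∃! e, IsFloquet l ψ (curvePoint l ψ σ lam) e) ∧
      (∀ x, floquetPlus l ψ (curvePoint l ψ σ lam) x ⬝ᵥ
        (matJ *ᵥ floquet l ψ (curvePoint l ψ σ lam) x) = wronskian l ψ (curvePoint l ψ σ lam)) ∧
      wronskian l ψ (curvePoint l ψ σ lam) ≠ 0 ∧
      (∀ x, DifferentiableAt ℝ (floquetLine l ψ X σ lam x) 0) ∧
      Continuous (floquetVar l ψ X σ lam)) ∧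
    -- the residues that define `ω_0` and `ω_1` exist and are unique
    (∀ (ψ X Y : Phase l) (σ : ℤˣ) (n : ℕ), n ≤ 1 →
      ∃! c, HasResidue (fun lam => lam ^ n * xi l ψ X Y σ lam) c) ∧
    -- they are ordinary residues whenever the form is meromorphic at `P_σ`
    (∀ (ψ X Y : Phase l) (σ : ℤˣ) (n : ℕ), n ≤ 1 → ∀ (R : ℝ) (F : ℂ → ℂ),
      DifferentiableOn ℂ F {lam | R < ‖lam‖} →
      (∃ (C : ℝ) (N : ℕ), ∀ lam, R < ‖lam‖ → ‖F lam‖ ≤ C * ‖lam‖ ^ N) →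
      (∀ lam, R < ‖lam‖ → lam.im ≠ 0 → F lam = lam ^ n * xi l ψ X Y σ lam) →
      ∀ r : ℝ, 0 < r → R < r →
        (2 * Real.pi * I)⁻¹ * (∮ z in C(0, r), F z) =
          residue fun lam => lam ^ n * xi l ψ X Y σ lam) ∧
    -- `ω_0` is a closed, nondegenerate 2-form
    IsClosedTwoForm l (omega l 0) ∧
    (∀ ψ X : Phase l, (∀ Y, omega l 0 ψ X Y = 0) → X = 0) ∧
    -- `ω_0 = 2i ⟨δψ̄ ∧ δψ⟩`
    (∀ ψ X Y : Phase l, omega l 0 ψ X Y =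
      2 * I * avg l fun x => conj (X.1 x) * Y.1 x - conj (Y.1 x) * X.1 x) ∧
    -- the Hamiltonians: the expansion of the quasimomentum, reality, the first three
    (∀ (ψ : Phase l) (σ : ℤˣ) (N : ℕ) (ε : ℝ), 0 < ε →
      (fun lam => multiplier l ψ σ lam *
          Complex.exp (-((σ : ℤ) * (2 * I * l * quasimomentumSum l ψ N lam))) - 1)
        =o[sector ε] fun lam => (lam ^ N)⁻¹) ∧
    (∀ (ψ : Phase l) (m : ℕ), 1 ≤ m → (hamiltonian l m ψ).im = 0) ∧
    (∀ ψ : Phase l,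
      hamiltonian l 1 ψ = 1 / 2 * ∫ x in (-l)..l, (‖ψ.1 x‖ : ℂ) ^ 2 ∧
      hamiltonian l 2 ψ = 1 / (2 * I) * ∫ x in (-l)..l, ψ.1 x * conj (deriv ψ.1 x) ∧
      hamiltonian l 3 ψ =
        1 / 2 * ∫ x in (-l)..l, ((‖deriv ψ.1 x‖ : ℂ) ^ 2 + (‖ψ.1 x‖ : ℂ) ^ 4)) ∧
    -- the flows of the hierarchy are Hamiltonian: `ω_0(X_m, ·) = -(2/l) δH_m`
    (∀ (m : ℕ), 1 ≤ m → ∀ ψ : Phase l,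
      (∃! X : Phase l, IsFlowVelocity ψ m X) ∧
      ∀ X : Phase l, IsFlowVelocity ψ m X → ∀ Y : Phase l, ∃ dH : ℂ,
        HasDerivAt (fun t : ℝ => hamiltonian l m (ψ + t • Y : Phase l)) dH 0 ∧
        omega l 0 ψ X Y = -(2 / l) * dH) ∧
    -- `ω_1` on the level sets of `H_1`
    (∀ ψ X Y : Phase l,
      HasDerivAt (fun t : ℝ => hamiltonian l 1 (ψ + t • X : Phase l)) 0 0 →
      HasDerivAt (fun t : ℝ => hamiltonian l 1 (ψ + t • Y : Phase l)) 0 0 →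
      omega l 1 ψ X Y = avg l fun x =>
        (X.1 x * conj (deriv Y.1 x) - Y.1 x * conj (deriv X.1 x))
          + (conj (X.1 x) * deriv Y.1 x - conj (Y.1 x) * deriv X.1 x)
          + 2 * ((∫ s in (-l)..x, densityVar ψ X s) * densityVar ψ Y x
            - (∫ s in (-l)..x, densityVar ψ Y s) * densityVar ψ X x)) := by
  refine ⟨fun ψ X σ lam hlam => ?_, fun ψ X Y σ n hn => existsUnique_hasResidue_xi hl ψ X Y σ hn,
    fun ψ X Y σ n _ R F hF hC hFf r hr hRr => ?_, isClosedTwoForm_omega_zero hl,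
    omega_zero_nondegenerate hl, omega_zero_eq hl,
    fun ψ σ N ε hε => quasimomentum_expansion hl ψ σ N hε, fun ψ m _ => hamiltonian_im ψ m,
    fun ψ => ⟨hamiltonian_one ψ, hamiltonian_two ψ, hamiltonian_three ψ⟩,
    fun m hm ψ => ⟨existsUnique_isFlowVelocity m ψ, fun X hX Y =>
      ⟨_, hasDerivAt_hamiltonian ψ Y m, omega_zero_flow hl m hm ψ X Y hX⟩⟩,
    fun ψ X Y hX hY => omega_one_eq hl ψ X Y (avg_densityVar_eq_zero ψ X hX)
      (avg_densityVar_eq_zero ψ Y hY)⟩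
  · obtain ⟨w, hw⟩ := exists_onSheet hl (ψ := ψ) σ hlam
    exact ⟨⟨w, hw, fun w' hw' => hw'.unique hl hw⟩, sheetSwap_curvePoint hl σ hlam,
      existsUnique_isFloquet hl σ hlam, pairing_eq_wronskian hl ψ hlam σ,
      wronskian_ne_zero hl ψ hlam σ, differentiableAt_floquetLine hl ψ X hlam σ,
      continuous_floquetVar hl ψ X hlam σ⟩
  · obtain ⟨C, N, hC⟩ := hC
    exact circleIntegral_eq_residue hF hC hFf hr hRr
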